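/- **Setting.** Let $U\subset\mathbb R^2$ be open and nonempty, and let $D$ be the ring of scalar linear differential operators with coefficients in $C^\infty(U)$; write $D_k$ for the operators of order $\le k$. A linear system $\mathcal E=\{F_1[u]=\dots=F_r[u]=0\}$ is studied through its left ideal $\mathcal I=\sum_j D F_j$. Let $g_k(q)\subset S^kT_q^*U$ be the annihilator of the symbols at $q$ of the elements of $\mathcal I$ of order $\le k$. $\mathcal E$ (or any left ideal) is called *regular* (and compatible) if $\dim g_k=h_k$ does not depend on $q$, for every $k$. Its *class* is $\omega=\lim_k\dim g_k$, its *complexity* is $\varkappa=\sum_{i\ge0}(\dim g_i-\omega)+\frac12\omega(\omega-1)$, and it has *type* $\sum_jE_{d_j}$ if at every point it has exactly $\#\{j:d_j=k\}$ new equations of order $k$ (symbols of order $k$ modulo prolongations of symbols of order $k-1$), for every $k$. A vector field $X\ne0$ is characteristic if all symbols vanish on the covectors annihilating $X$. A system of class $3$ below is regular, $\omega=3$, with three given characteristic vector fields $X_1,X_2,X_3$ that are pairwise independent at each point. **Laplace transformations.** For a function $a$, the gauge $L=X_i+a$ is called *adapted* if for every $k$ each element of $\mathcal I$ of order $\le k+2$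 lies in $D_{k+1}L+D_k$ (no pure power $Y^{j}$, $j>k$, of a complementary $Y$ remains). The $i$-th generalized Laplace transformation is $v=Lu$ with $L$ adapted; the transformed system $\tilde{\mathcal E}$ is given by the left ideal $\{Q\in D: QL\in\mathcal I\}$. Where $\tilde{\mathcal E}$ is regular, denote its class and complexity by $\tilde\omega,\tilde\varkappa$. **Theorem.** 1. For a system of class $3$ and each $i=1,2,3$ there is exactly one adapted gauge $L=X_i+a$, $a\in C^\infty(U)$. So there are three generalized Laplace transformations. 2. For every system of class $3$ and each of the three transformations with $\tilde{\mathcal E}$ regular: either the class is reduced ($\tilde\omega<3$), or $\tilde\omega=3$ and $\tilde\varkappa\le\varkappa+1$. So if $\varkappa$ does not rise by exactly $1$, then $\varkappa$ is preserved, or $\varkappa$ decreases, or $\omega$ is reduced. 3. Generically $\varkappa$ rises by exactly $1$, and only in singular cases is the type preserved, $\varkappa$ not raised, or $\omega$ reduced. Precisely: fix a type $\sum_{j=1}^rE_{d_j}$ and dimensions $(h_k)$ that occur for some system of class $3$, and consider the systems of class $3$ of this type with $\dim g_k=h_k$, given by $F_1,\dots,F_r$ of orders $\le d_1,\dots,d_r$.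 There is a differential polynomial $\Delta$ with constant coefficients in the coefficients of $F_1,\dots,F_r,L$ such that: - if $\Delta(F,L)(q)\neq0$ at some $q\in U$ and $\tilde{\mathcal E}$ is regular on $U$, then $\tilde\omega=3$, $\tilde\varkappa=\varkappa+1$, and $\tilde{\mathcal E}$ is not of the type $\sum_jE_{d_j}$; moreover, every neighbourhood of such a point $q$ contains a nonempty open set $W\subset U$ such that the transform of the restricted system $\mathcal E|_W$ is regular and has these properties; - the singular condition $\Delta=0$ is proper: on every nonempty open $U$ there is such a system with $\Delta(F,L)\not\equiv0$ for all three transformations; - if $\varkappa=0$ (type $E_3$), then for each such system and each $q\in U$ there is a perturbation $F+\varepsilon G$, with $G$ of order $\le1$, that for all sufficiently small real $\varepsilon\ne0$ is again such a system with the same characteristic vector fields, and has $\Delta\ne0$ at $q$ for all three transformations. 4. The singular cases do occur: on every nonempty open $U$ there are systems of class $3$ with an adapted $L$ for one of the characteristics and a regular transform such that, respectively, $\tilde\omega=3$ and the type is preserved; $\tilde\omega=3$ and $\tilde\varkappa<\varkappa$; $\tilde\omega<3$. -/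

import Mathlib

open MvPolynomial Filter Topology TopologicalSpace
open scoped ContDiff

namespace PlanePDE

noncomputable section

/-! ## Smooth functions on an open subset of the plane -/

open Classical in
/-- Extension by zero of a function on `U`; only its values on the open set `U` ever matter. -/
def zeroExt {U : Opens (ℝ × ℝ)} (f : U → ℝ) : ℝ × ℝ → ℝ :=
  fun q => if hq : q ∈ U then f ⟨q, hq⟩ else 0

theorem zeroExt_of_mem {U : Opens (ℝ × ℝ)} (f : U → ℝ) {q : ℝ × ℝ} (hq : q ∈ U) :
    zeroExt f q = f ⟨q, hq⟩ := by
  simp [zeroExt, hq]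

/-- The algebra `C^∞(U)` of smooth real functions on `U`. -/
def Smooth (U : Opens (ℝ × ℝ)) : Subalgebra ℝ (U → ℝ) where
  carrier := {f | ContDiffOn ℝ ∞ (zeroExt f) U}
  mul_mem' := by
    intro f g hf hg
    refine (ContDiffOn.mul hf hg).congr ?_
    intro q hq
    simp [zeroExt_of_mem _ hq]
  add_mem' := by
    intro f g hf hg
    refine (ContDiffOn.add hf hg).congr ?_
    intro q hq
    simp [zeroExt_of_mem _ hq]
  algebraMap_mem' := by
    intro c
    refine (contDiffOn_const (c := c)).congr ?_
    intro q hq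
    simp [zeroExt_of_mem _ hq]

/-- The coordinate vectors `(1,0)` and `(0,1)` of the plane. -/
def coordVec : Fin 2 → ℝ × ℝ := ![(1, 0), (0, 1)]

/-- The partial derivative `∂ᵢ : C^∞(U) → C^∞(U)`; `∂₀ = ∂/∂x`, `∂₁ = ∂/∂y`. -/
def partialD {U : Opens (ℝ × ℝ)} (i : Fin 2) (f : Smooth U) : Smooth U :=
  ⟨fun q => fderiv ℝ (zeroExt f.1) (q : ℝ × ℝ) (coordVec i), by
    have hf : ContDiffOn ℝ ∞ (zeroExt f.1) U := f.2
    have h1 : ContDiffOn ℝ ∞ (fderiv ℝ (zeroExt f.1)) U :=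
      hf.fderiv_of_isOpen U.isOpen (by simp)
    refine (h1.clm_apply (contDiffOn_const (c := coordVec i))).congr ?_
    intro q hq
    simp [zeroExt_of_mem _ hq]⟩

/-- The value of a smooth function at a point. -/
def evalAt {U : Opens (ℝ × ℝ)} (q : U) : Smooth U →+* ℝ :=
  (Pi.evalRingHom (fun _ : U => ℝ) q).comp (Smooth U).val.toRingHom

/-- Restriction of smooth functions to a smaller open set. -/
def restrictFun {U V : Opens (ℝ × ℝ)} (hVU : V ≤ U) : Smooth U →+* Smooth V where
  toFun f := ⟨fun q => f.1 ⟨q.1, hVU q.2⟩, by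
    have hf : ContDiffOn ℝ ∞ (zeroExt f.1) U := f.2
    refine (hf.mono hVU).congr ?_
    intro q hq
    rw [zeroExt_of_mem _ hq, zeroExt_of_mem _ (hVU hq)]⟩
  map_one' := rfl
  map_mul' _ _ := rfl
  map_zero' := rfl
  map_add' _ _ := rfl

/-! ## Scalar linear differential operators -/

/-- A scalar linear differential operator `∑ c_α ∂^α` on `U`, written with its coefficients on
the left. As an additive group this is the ring of polynomials over `C^∞(U)`, the variables
`X 0`, `X 1` standing for `∂₀`, `∂₁`; composition is `Op.comp` below, not the polynomial product. -/
abbrev Op (U : Opens (ℝ × ℝ)) := MvPolynomial (Fin 2) (Smooth U)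

/-- Composition `∂ᵢ ∘ P`: `∂ᵢ ∘ (c ∂^α) = (∂ᵢ c) ∂^α + c ∂ᵢ ∂^α`. -/
def Op.leftD {U : Opens (ℝ × ℝ)} (i : Fin 2) (P : Op U) : Op U :=
  (∑ α ∈ P.support, monomial α (partialD i (coeff α P))) + X i * P

/-- Composition `∂^α ∘ P`. -/
def Op.leftDPow {U : Opens (ℝ × ℝ)} (α : Fin 2 →₀ ℕ) (P : Op U) : Op U :=
  (Op.leftD 0)^[α 0] ((Op.leftD 1)^[α 1] P)

/-- Composition `P ∘ Q` of differential operators. -/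
def Op.comp {U : Opens (ℝ × ℝ)} (P Q : Op U) : Op U :=
  ∑ α ∈ P.support, C (coeff α P) * Op.leftDPow α Q

/-- The first order operator `v + a`, with `v` a vector field and `a` a function. -/
def firstOrder {U : Opens (ℝ × ℝ)} (v : Fin 2 → Smooth U) (a : Smooth U) : Op U :=
  C (v 0) * X 0 + C (v 1) * X 1 + C a

/-- Restriction of an operator to a smaller open set. -/
def Op.restrict {U V : Opens (ℝ × ℝ)} (hVU : V ≤ U) (P : Op U) : Op V :=
  MvPolynomial.map (restrictFun hVU) P

/-! ## Systems, symbols, class, complexity, type -/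

/-- The left ideal `∑ D ∘ F_j` generated by `F = (F₁, …, F_r)`: all differential consequences of
the system `F[u] = 0`. -/
def systemIdeal {U : Opens (ℝ × ℝ)} {r : ℕ} (F : Fin r → Op U) : Set (Op U) :=
  (Submodule.span (Smooth U)
    (Set.range fun jα : Fin r × (Fin 2 →₀ ℕ) => Op.leftDPow jα.2 (F jα.1)) : Set (Op U))

/-- The space of symbols at `q` of the elements of order `≤ k` of `I`, a space of homogeneous
polynomials of degree `k` on the cotangent plane at `q`. -/
def symbolSpace {U : Opens (ℝ × ℝ)} (I : Set (Op U)) (k : ℕ) (q : U) :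
    Submodule ℝ (MvPolynomial (Fin 2) ℝ) :=
  Submodule.span ℝ
    {σ | ∃ P ∈ I, P.totalDegree ≤ k ∧ σ = MvPolynomial.map (evalAt q) (homogeneousComponent k P)}

/-- The symbol `g_k` at `q`: the annihilator of `symbolSpace I k q` in the dual `S^k T*` of the space
`S^k T` of homogeneous polynomials of degree `k`. -/
def gSymbol {U : Opens (ℝ × ℝ)} (I : Set (Op U)) (k : ℕ) (q : U) :
    Submodule ℝ (Module.Dual ℝ (homogeneousSubmodule (Fin 2) ℝ k)) :=
  ((symbolSpace I k q).comap (homogeneousSubmodule (Fin 2) ℝ k).subtype).dualAnnihilator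

/-- The left ideal `I` is a regular system with `dim g_k = h k` at all points of `U`. Since `I`
contains all differential consequences of its elements, the constancy of these ranks is regularity
together with formal integrability (compatibility). -/
def IsRegular {U : Opens (ℝ × ℝ)} (I : Set (Op U)) (h : ℕ → ℕ) : Prop :=
  ∀ (k : ℕ) (q : U), Module.finrank ℝ (gSymbol I k q) = h k

/-- The class of a regular system with `dim g_k = h k` is `w`. -/
def HasClass (h : ℕ → ℕ) (w : ℕ) : Prop := ∀ᶠ k in atTop, h k = w

/-- The complexity `∑_{i ≥ 0} (dim g_i - w) + w (w - 1) / 2` of a regular system of class `w`. -/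
def complexity (h : ℕ → ℕ) (w : ℕ) : ℤ :=
  (∑ᶠ i : ℕ, ((h i : ℤ) - (w : ℤ))) + (w : ℤ) * ((w : ℤ) - 1) / 2

/-- The symbols of order `k` that are prolongations of the symbols of order `k - 1`. -/
def prolongedSymbols {U : Opens (ℝ × ℝ)} (I : Set (Op U)) (k : ℕ) (q : U) :
    Submodule ℝ (MvPolynomial (Fin 2) ℝ) :=
  match k with
  | 0 => ⊥
  | k + 1 => ⨆ i : Fin 2, (symbolSpace I k q).map (LinearMap.mulLeft ℝ (X i))

/-- The number of new equations of order `k` at `q`, that is `dim H^{k-1,1}`. -/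
def newEquations {U : Opens (ℝ × ℝ)} (I : Set (Op U)) (k : ℕ) (q : U) : ℕ :=
  Module.finrank ℝ
    (symbolSpace I k q ⧸ (prolongedSymbols I k q).comap (symbolSpace I k q).subtype)

/-- `I` has type `∑_j E_{d_j}`: at every point and for every `k` it has as many new equations of
order `k` as there are `j` with `d_j = k`. -/
def HasType {U : Opens (ℝ × ℝ)} (I : Set (Op U)) {r : ℕ} (d : Fin r → ℕ) : Prop :=
  ∀ (k : ℕ) (q : U), newEquations I k q = (Finset.univ.filter fun j => d j = k).card

/-- The vector field `v` is characteristic: all symbols vanish on the covectors annihilating `v`. -/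
def IsCharacteristic {U : Opens (ℝ × ℝ)} (I : Set (Op U)) (v : Fin 2 → Smooth U) : Prop :=
  ∀ (k : ℕ) (q : U), ∀ σ ∈ symbolSpace I k q,
    MvPolynomial.eval ![-evalAt q (v 1), evalAt q (v 0)] σ = 0

/-- `F[u] = 0` is a compatible regular system of class `3` with symbol dimensions `h`, whose three
characteristics are spanned by the pairwise independent vector fields `v 0`, `v 1`, `v 2`. -/
structure IsClassThree {U : Opens (ℝ × ℝ)} {r : ℕ} (F : Fin r → Op U) (h : ℕ → ℕ)
    (v : Fin 3 → Fin 2 → Smooth U) : Prop where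
  regular : IsRegular (systemIdeal F) h
  hasClass : HasClass h 3
  independent : ∀ i j, i ≠ j → ∀ q : U,
    evalAt q (v i 0) * evalAt q (v j 1) - evalAt q (v i 1) * evalAt q (v j 0) ≠ 0
  characteristic : ∀ i, IsCharacteristic (systemIdeal F) (v i)

/-- A system of class `3` as above, of type `∑_j E_{d_j}` and given by equations of orders `d_j`. -/
structure IsClassThreeOfType {U : Opens (ℝ × ℝ)} {r : ℕ} (d : Fin r → ℕ) (h : ℕ → ℕ)
    (F : Fin r → Op U) (v : Fin 3 → Fin 2 → Smooth U) : Prop extends IsClassThree F h v where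
  order_le : ∀ j, (F j).totalDegree ≤ d j
  hasType : HasType (systemIdeal F) d

/-! ## Generalized Laplace transformations -/

/-- The basic gauge is fixed: if `L` has symbol `X`, and `Y` is a complementary operator, then the
expansion `∑ c_{ji} Y^j L^i` of an element of order `≤ k + 2` of `I` contains no pure powers `Y^j` with
`j > k`. Equivalently, each such element lies in `D_{k+1} ∘ L + D_k`. -/
def IsAdapted {U : Opens (ℝ × ℝ)} (I : Set (Op U)) (L : Op U) : Prop :=
  ∀ (k : ℕ), ∀ P ∈ I, P.totalDegree ≤ k + 2 →
    ∃ Q R : Op U, Q.totalDegree ≤ k + 1 ∧ R.totalDegree ≤ k ∧ P = Op.comp Q L + R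

/-- The system for `v = L u` obtained from the system `I` for `u`: all operators `Q` with
`Q ∘ L ∈ I`. For adapted `L` this is the generalized Laplace transform. -/
def laplace {U : Opens (ℝ × ℝ)} (I : Set (Op U)) (L : Op U) : Set (Op U) :=
  {Q | Op.comp Q L ∈ I}

/-! ## Differential polynomials in the coefficients -/

/-- Differential polynomials with constant coefficients in the coefficients of `r` operators and of
one more operator. The variable `(j, α, β)` is the derivative `∂^β` of the coefficient at `∂^α` of
the operator number `j`, where `none` is the number of the additional operator. -/
abbrev DiffPoly (r : ℕ) :=
  MvPolynomial (Option (Fin r) × (Fin 2 →₀ ℕ) × (Fin 2 →₀ ℕ)) ℝ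

/-- The value of a differential polynomial on the operators `F₁, …, F_r` and `L`. -/
def DiffPoly.value {U : Opens (ℝ × ℝ)} {r : ℕ} (Δ : DiffPoly r) (F : Fin r → Op U) (L : Op U) :
    Smooth U :=
  aeval (fun jαβ : Option (Fin r) × (Fin 2 →₀ ℕ) × (Fin 2 →₀ ℕ) =>
    (partialD 0)^[jαβ.2.2 0] ((partialD 1)^[jαβ.2.2 1]
      (coeff jαβ.2.1 (jαβ.1.elim L F)))) Δ

end

end PlanePDE

open PlanePDE

namespace PlanePDE

noncomputable section

/-! ## Shortcut instances -/

/-! Everything is measured by dimensions of spaces of values of operators at a point. Write `I_n`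
for the elements of order `≤ n` of the ideal `I`, `X` for a characteristic field, `Y` for a
complementary one, `J` for the transformed ideal.

Gauge. The symbol of an element `P ∈ I` of order `≤ m + 1` vanishes on the covector annihilating
`X`, so `P = Q ∘ X + R` with `Q`, `R` of order `≤ m`. Let `t` and `b` be the leading values of `Q`
and `R` on that covector (`Rem`). Replacing `X` by `X + a` turns `b` into `b - t a`, so `X + a` is
adapted exactly when `b = t a` for all `P`. In high order all multiples of the characteristic cubic
are symbols, hence some `t` is nonzero at any given point (`ThreeChar.exists_rem_ne_zero`). The
ratio `b / t` is the same for all `P` because `t = 0` forces `b = 0` (`ThreeChar.rem_eq_zero`): then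
the symbol of `P` is divisible by the square of the characteristic form, `P` can be reduced by some
`X ∘ P₃` with `P₃ ∈ I`, and up to a factor `b` is the leading value of an element of `I` of smaller
order, which vanishes.

Complexity. Since `I ∩ D ∘ L = J ∘ L`, one has `dim J_{n-1} = dim I_n + dim D_{n-1} - dim (I_n +
D_{n-1} ∘ L)` wherever the last rank (`lapRank`) is locally maximal. Adaptedness puts `I_n + D_{n-1}
∘ L` inside `D_{n-2} + D_{n-1} ∘ L`, which has codimension two in `D_n`. With `h` and `h'` the
symbol dimensions of `I` and `J`, this gives `∑_{k<n} h'_k + 2 ≤ ∑_{k≤n} h_k`; comparing growth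
rates and then bounded parts gives class `≤ 3` and a rise of the complexity by at most one
(`IsNondegenerate.laplace_class`). If the rank is maximal in one order, differentiation makes it
maximal in all later ones (`IsNondegenerate.le_lapRank_succ`), and the rise is exactly one. A second
rank, in the order following the first equations, leaves the transform too few equations to have the
old type (`IsNondegenerate.not_hasType`).

Discriminant. Both rank conditions are implied by the nonvanishing of sums of squares of Gram
determinants of derivatives of `F` and `L`, and `discriminant` is the product of two such sums. It
is not identically zero: given the symbols `λ w_j` of some system at one point, take `F_j = w_j(∂) ∘
N` with `N = λ(∂) + e^{2ν·x} V(∂) + t e^{ν·x}`. Left multiples of one operator have the prescribed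
symbols and are compatible automatically, `L = l(∂)` is adapted, exponentials act as translations of
polynomials, and restriction to the line `l = 0` reduces the ranks to polynomials in one variable
(`IsClassThreeOfType.exists_generic`). In complexity zero there is one equation `N` of order three;
adding `ε (V + θ)` of order one keeps the gauge and makes the derivatives of order `≤ 1` of the
equation independent modulo `D ∘ L` for almost all `ε`.

The singular cases come from the constant coefficient operators `∂x ∂y (∂x + ∂y) + c`, for which the
transform is computed in a commutative polynomial ring. -/

instance (priority := 5000) smoothRing (U : Opens (ℝ × ℝ)) : Ring (Smooth U) :=
  { Subalgebra.toRing (Smooth U) with toSemiring := Subalgebra.toSemiring (Smooth U) }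

instance (priority := 5000) smoothCommRing (U : Opens (ℝ × ℝ)) : CommRing (Smooth U) :=
  { Subalgebra.toCommRing (Smooth U) with toRing := smoothRing U }

instance (priority := 5000) opAddCommGroup (U : Opens (ℝ × ℝ)) : AddCommGroup (Op U) :=
  { (inferInstance : AddCommGroup (Op U)) with
    toAddMonoid := (inferInstance : AddCommMonoid (Op U)).toAddMonoid }

instance (priority := 5000) opModule (U : Opens (ℝ × ℝ)) : Module (Smooth U) (Op U) :=
  instModuleSelf

/-! ## Calculus in `C^∞(U)` -/

section Calculus

variable {U : Opens (ℝ × ℝ)}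

theorem evalAt_apply (q : U) (f : Smooth U) : evalAt q f = f.1 q := rfl

theorem smooth_ext {f g : Smooth U} (h : ∀ q : U, evalAt q f = evalAt q g) : f = g :=
  Subtype.ext (funext h)

theorem evalAt_algebraMap (q : U) (c : ℝ) : evalAt q (algebraMap ℝ (Smooth U) c) = c := rfl

theorem contDiffAt_zeroExt (f : Smooth U) {q : ℝ × ℝ} (hq : q ∈ U) :
    ContDiffAt ℝ ∞ (zeroExt f.1) q :=
  (show ContDiffOn ℝ ∞ (zeroExt f.1) U from f.2).contDiffAt (U.isOpen.mem_nhds hq)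

theorem differentiableAt_zeroExt (f : Smooth U) {q : ℝ × ℝ} (hq : q ∈ U) :
    DifferentiableAt ℝ (zeroExt f.1) q :=
  (contDiffAt_zeroExt f hq).differentiableAt (by simp)

theorem continuous_smooth (f : Smooth U) : Continuous fun q : U => evalAt q f := by
  refine continuous_iff_continuousAt.2 fun q => ?_
  have h := (contDiffAt_zeroExt f q.2).continuousAt
  have h2 : ContinuousAt (fun q : U => zeroExt f.1 q.1) q :=
    h.comp (f := fun q : U => q.1) continuous_subtype_val.continuousAt
  refine h2.congr (Eventually.of_forall fun q => ?_)
  exact zeroExt_of_mem _ q.2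

theorem evalAt_partialD (i : Fin 2) (f : Smooth U) (q : U) :
    evalAt q (partialD i f) = fderiv ℝ (zeroExt f.1) (q : ℝ × ℝ) (coordVec i) := rfl

/-- Near a point of `U`, the extension by zero of `f` may be replaced by any function with the same
values. -/
theorem evalAt_partialD_of_eventuallyEq (i : Fin 2) (f : Smooth U) (q : U) {g : ℝ × ℝ → ℝ}
    (h : ∀ᶠ z : U in 𝓝 q, evalAt z f = g z) :
    evalAt q (partialD i f) = fderiv ℝ g (q : ℝ × ℝ) (coordVec i) := by
  rw [evalAt_partialD]
  have h1 : zeroExt f.1 =ᶠ[𝓝 (q : ℝ × ℝ)] g := by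
    rw [← map_nhds_subtype_coe_eq_nhds q.2 (U.isOpen.mem_nhds q.2)]
    refine Filter.eventually_map.2 (h.mono fun z hz => ?_)
    rw [zeroExt_of_mem _ z.2]
    exact hz
  rw [h1.fderiv_eq]

theorem partialD_add (i : Fin 2) (f g : Smooth U) :
    partialD i (f + g) = partialD i f + partialD i g := by
  refine smooth_ext fun q => ?_
  rw [evalAt_partialD_of_eventuallyEq (g := zeroExt f.1 + zeroExt g.1), map_add,
    evalAt_partialD, evalAt_partialD,
    fderiv_add (differentiableAt_zeroExt f q.2) (differentiableAt_zeroExt g q.2)]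
  · rfl
  · refine Eventually.of_forall fun z => ?_
    simp [zeroExt_of_mem _ z.2, evalAt_apply]

theorem partialD_mul (i : Fin 2) (f g : Smooth U) :
    partialD i (f * g) = f * partialD i g + partialD i f * g := by
  refine smooth_ext fun q => ?_
  rw [evalAt_partialD_of_eventuallyEq (g := zeroExt f.1 * zeroExt g.1), map_add, map_mul, map_mul,
    evalAt_partialD, evalAt_partialD,
    fderiv_mul (differentiableAt_zeroExt f q.2) (differentiableAt_zeroExt g q.2)]
  · simp [zeroExt_of_mem _ q.2, evalAt_apply, mul_comm]
  · refine Eventually.of_forall fun z => ?_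
    simp [zeroExt_of_mem _ z.2, evalAt_apply]

theorem partialD_algebraMap (i : Fin 2) (c : ℝ) :
    partialD i (algebraMap ℝ (Smooth U) c) = 0 := by
  refine smooth_ext fun q => ?_
  rw [evalAt_partialD_of_eventuallyEq (g := fun _ => c)]
  · simp
  · exact Eventually.of_forall fun z => rfl

theorem partialD_zero (i : Fin 2) : partialD i (0 : Smooth U) = 0 := by
  simpa using partialD_algebraMap (U := U) i 0

theorem partialD_one (i : Fin 2) : partialD i (1 : Smooth U) = 0 := by
  simpa using partialD_algebraMap (U := U) i 1

theorem partialD_comm (i j : Fin 2) (f : Smooth U) :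
    partialD i (partialD j f) = partialD j (partialD i f) := by
  refine smooth_ext fun q => ?_
  -- Both iterated partial derivatives are entries of the second Fréchet derivative, which is
  -- symmetric.
  have key : ∀ i j : Fin 2, evalAt q (partialD i (partialD j f)) =
      fderiv ℝ (fderiv ℝ (zeroExt f.1)) (q : ℝ × ℝ) (coordVec i) (coordVec j) := by
    intro i j
    have hd : DifferentiableAt ℝ (fderiv ℝ (zeroExt f.1)) (q : ℝ × ℝ) :=
      ((contDiffAt_zeroExt f q.2).fderiv_right (m := 1) (by norm_cast)).differentiableAt (by simp)
    rw [evalAt_partialD_of_eventuallyEq (g := fun z => fderiv ℝ (zeroExt f.1) z (coordVec j))]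
    · rw [fderiv_clm_apply hd (differentiableAt_const _)]
      simp
    · exact Eventually.of_forall fun z => rfl
  rw [key, key]
  exact ((contDiffAt_zeroExt f q.2).isSymmSndFDerivAt (by simp; norm_cast)).eq _ _

end Calculus

/-! ## Polynomials of bounded order -/

section OrdLT

variable {R : Type*} [CommRing R]

/-- Polynomials of degree `< n`. -/
def ordLT (R : Type*) [CommRing R] (n : ℕ) : Submodule R (MvPolynomial (Fin 2) R) :=
  restrictSupport R {α | α.degree < n}

theorem mem_ordLT {n : ℕ} {P : MvPolynomial (Fin 2) R} :
    P ∈ ordLT R n ↔ ∀ α, n ≤ α.degree → coeff α P = 0 := by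
  rw [ordLT, mem_restrictSupport_iff]
  constructor
  · intro h α hα
    by_contra hc
    have : α ∈ P.support := mem_support_iff.2 hc
    exact absurd (h this) (by simpa using hα)
  · intro h α hα
    by_contra hc
    exact mem_support_iff.1 hα (h α (by simpa using hc))

theorem ordLT_mono {m n : ℕ} (h : m ≤ n) : ordLT R m ≤ ordLT R n := fun _ hP =>
  mem_ordLT.2 fun α hα => mem_ordLT.1 hP α (h.trans hα)

/-- Order `≤ n` is `ordLT R (n + 1)`: the strict bound makes the zero space the bottom of the
filtration, so inductions on the order start at `ordLT R 0 = ⊥`. -/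
theorem totalDegree_le_iff {n : ℕ} {P : MvPolynomial (Fin 2) R} :
    P.totalDegree ≤ n ↔ P ∈ ordLT R (n + 1) := by
  rw [mem_ordLT]
  constructor
  · intro h α hα
    refine coeff_eq_zero_of_totalDegree_lt ?_
    have : α.degree = ∑ i ∈ α.support, α i := rfl
    omega
  · intro h
    rw [totalDegree]
    refine Finset.sup_le fun α hα => ?_
    by_contra hc
    refine mem_support_iff.1 hα (h α ?_)
    have : α.degree = α.sum fun _ e => e := rfl
    omega

theorem ordLT_zero : ordLT R 0 = ⊥ := by
  refine eq_bot_iff.2 fun P hP => ?_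
  exact (Submodule.mem_bot _).2 (MvPolynomial.ext _ _ fun α => mem_ordLT.1 hP α (Nat.zero_le _))

theorem monomial_mem_ordLT {n : ℕ} {α : Fin 2 →₀ ℕ} (h : α.degree < n) (c : R) :
    monomial α c ∈ ordLT R n :=
  mem_ordLT.2 fun β hβ => by
    rw [coeff_monomial, if_neg]
    rintro rfl
    omega

theorem C_mem_ordLT (c : R) : (C c : MvPolynomial (Fin 2) R) ∈ ordLT R 1 :=
  monomial_mem_ordLT (by simp) c

theorem X_mem_ordLT (i : Fin 2) : (X i : MvPolynomial (Fin 2) R) ∈ ordLT R 2 :=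
  monomial_mem_ordLT (by simp) 1

theorem exists_mem_ordLT (P : MvPolynomial (Fin 2) R) : ∃ n, P ∈ ordLT R n :=
  ⟨_, totalDegree_le_iff.1 le_rfl⟩

theorem ordLT_eq_span (n : ℕ) :
    ordLT R n = Submodule.span R ((fun α => monomial α (1 : R)) '' {α | α.degree < n}) :=
  restrictSupport_eq_span R _

/-- One bound is strict and the other is not (degree `≤ m` times degree `< n`), so that the case `n
= 0` is included. -/
theorem mul_mem_ordLT {m n : ℕ} {P Q : MvPolynomial (Fin 2) R} (hP : P ∈ ordLT R (m + 1))
    (hQ : Q ∈ ordLT R n) : P * Q ∈ ordLT R (m + n) := by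
  cases n with
  | zero =>
    rw [ordLT_zero, Submodule.mem_bot] at hQ
    simp [hQ]
  | succ n =>
    rw [← totalDegree_le_iff] at hP hQ
    exact totalDegree_le_iff.1 ((totalDegree_mul _ _).trans (add_le_add hP hQ))

theorem homogeneousComponent_eq_zero_of_mem {n k : ℕ} {P : MvPolynomial (Fin 2) R}
    (hP : P ∈ ordLT R n) (h : n ≤ k) : homogeneousComponent k P = 0 := by
  refine MvPolynomial.ext _ _ fun α => ?_
  rw [coeff_homogeneousComponent]
  split_ifs with h1
  · simpa using mem_ordLT.1 hP α (by omega)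
  · simp

theorem mem_ordLT_of_homogeneousComponent {k : ℕ} {P : MvPolynomial (Fin 2) R}
    (hP : P ∈ ordLT R (k + 1)) (h : homogeneousComponent k P = 0) : P ∈ ordLT R k := by
  refine mem_ordLT.2 fun α hα => ?_
  rcases hα.eq_or_lt with h1 | h1
  · have := congrArg (coeff α) h
    rwa [coeff_homogeneousComponent, if_pos h1.symm, coeff_zero] at this
  · exact mem_ordLT.1 hP α h1

theorem IsHomogeneous.mem_ordLT {k n : ℕ} {P : MvPolynomial (Fin 2) R} (h : P.IsHomogeneous k)
    (hn : k < n) : P ∈ ordLT R n :=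
  PlanePDE.mem_ordLT.2 fun α hα => h.coeff_eq_zero (by omega)

theorem sub_homogeneousComponent_mem {k : ℕ} {P : MvPolynomial (Fin 2) R}
    (hP : P ∈ ordLT R (k + 1)) : P - homogeneousComponent k P ∈ ordLT R k := by
  refine mem_ordLT_of_homogeneousComponent (Submodule.sub_mem _ hP
    (IsHomogeneous.mem_ordLT (homogeneousComponent_isHomogeneous k P) (Nat.lt_succ_self _))) ?_
  rw [map_sub, homogeneousComponent_eq_self (homogeneousComponent_isHomogeneous k P), sub_self]

theorem homogeneousComponent_mul_of_mem {a b : ℕ} {P Q : MvPolynomial (Fin 2) R}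
    (hP : P ∈ ordLT R (a + 1)) (hQ : Q ∈ ordLT R (b + 1)) :
    homogeneousComponent (a + b) (P * Q) =
      homogeneousComponent a P * homogeneousComponent b Q := by
  have h1 := sub_homogeneousComponent_mem hP
  have h2 := sub_homogeneousComponent_mem hQ
  have h3 : P * Q = homogeneousComponent a P * homogeneousComponent b Q +
      (homogeneousComponent a P * (Q - homogeneousComponent b Q) +
        Q * (P - homogeneousComponent a P)) := by ring
  have h4 : homogeneousComponent a P * (Q - homogeneousComponent b Q) ∈ ordLT R (a + b) :=
    mul_mem_ordLT (IsHomogeneous.mem_ordLT (homogeneousComponent_isHomogeneous a P)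
      (Nat.lt_succ_self _)) h2
  have h5 : Q * (P - homogeneousComponent a P) ∈ ordLT R (b + a) := mul_mem_ordLT hQ h1
  rw [h3, map_add, homogeneousComponent_eq_zero_of_mem (Submodule.add_mem _ h4
    (by rwa [add_comm] at h5)) le_rfl, add_zero]
  exact homogeneousComponent_eq_self
    ((homogeneousComponent_isHomogeneous a P).mul (homogeneousComponent_isHomogeneous b Q))

theorem map_mem_ordLT {S : Type*} [CommRing S] (f : R →+* S) {n : ℕ} {P : MvPolynomial (Fin 2) R}
    (hP : P ∈ ordLT R n) : MvPolynomial.map f P ∈ ordLT S n :=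
  mem_ordLT.2 fun α hα => by rw [coeff_map, mem_ordLT.1 hP α hα, map_zero]

theorem map_homogeneousComponent {S : Type*} [CommRing S] (f : R →+* S) (k : ℕ)
    (P : MvPolynomial (Fin 2) R) : MvPolynomial.map f (homogeneousComponent k P) =
      homogeneousComponent k (MvPolynomial.map f P) := by
  refine MvPolynomial.ext _ _ fun α => ?_
  simp only [coeff_map, coeff_homogeneousComponent]
  split_ifs <;> simp

/-- Adding one derivative at a time, whichever it is, frees later arguments from the order in which
`Op.leftDPow` applies `∂₀` and `∂₁`. -/
theorem exponent_induction {p : (Fin 2 →₀ ℕ) → Prop} (zero : p 0)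
    (step : ∀ α i, p α → p (α + Finsupp.single i 1)) (α : Fin 2 →₀ ℕ) : p α := by
  induction hn : α.degree generalizing α with
  | zero => rwa [(Finsupp.degree_eq_zero_iff α).1 hn]
  | succ n ih =>
    have hα : α ≠ 0 := by rintro rfl; simp at hn
    obtain ⟨i, hi⟩ := Finsupp.ne_iff.1 hα
    have h1 : Finsupp.single i 1 ≤ α := by
      rw [Finsupp.single_le_iff]
      exact Nat.one_le_iff_ne_zero.2 hi
    have h2 : α - Finsupp.single i 1 + Finsupp.single i 1 = α := tsub_add_cancel_of_le h1
    rw [← h2]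
    refine step _ _ (ih _ ?_)
    have h3 := congrArg Finsupp.degree h2
    rw [map_add, Finsupp.degree_single, hn] at h3
    omega

end OrdLT

/-! ## The algebra of composition -/

section Comp

variable {U : Opens (ℝ × ℝ)}

theorem coeff_leftD (i : Fin 2) (P : Op U) (β : Fin 2 →₀ ℕ) :
    coeff β (Op.leftD i P) = partialD i (coeff β P) + coeff β (X i * P) := by
  rw [Op.leftD, coeff_add, coeff_sum]
  congr 1
  simp only [coeff_monomial]
  rw [Finset.sum_ite_eq']
  split_ifs with h
  · rfl
  · rw [notMem_support_iff.1 h, partialD_zero]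

/-- Differentiation of the coefficients of an operator. -/
def coefD (i : Fin 2) (P : Op U) : Op U := Op.leftD i P - X i * P

theorem leftD_eq (i : Fin 2) (P : Op U) : Op.leftD i P = coefD i P + X i * P := by
  rw [coefD, sub_add_cancel]

theorem coeff_coefD (i : Fin 2) (P : Op U) (β : Fin 2 →₀ ℕ) :
    coeff β (coefD i P) = partialD i (coeff β P) := by
  rw [coefD, coeff_sub, coeff_leftD, add_sub_cancel_right]

theorem coefD_mem_ordLT (i : Fin 2) {n : ℕ} {P : Op U} (hP : P ∈ ordLT (Smooth U) n) :
    coefD i P ∈ ordLT (Smooth U) n :=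
  mem_ordLT.2 fun α hα => by rw [coeff_coefD, mem_ordLT.1 hP α hα, partialD_zero]

theorem coefD_add (i : Fin 2) (P Q : Op U) : coefD i (P + Q) = coefD i P + coefD i Q :=
  MvPolynomial.ext _ _ fun α => by simp only [coeff_coefD, coeff_add, partialD_add]

theorem coefD_C_mul (i : Fin 2) (c : Smooth U) (P : Op U) :
    coefD i (C c * P) = C c * coefD i P + C (partialD i c) * P :=
  MvPolynomial.ext _ _ fun α => by
    simp only [coeff_coefD, coeff_add, coeff_C_mul, partialD_mul]

theorem coefD_X_mul (i j : Fin 2) (P : Op U) : coefD i (X j * P) = X j * coefD i P :=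
  MvPolynomial.ext _ _ fun α => by
    rw [coeff_coefD, coeff_X_mul', coeff_X_mul', coeff_coefD]
    split_ifs
    · rfl
    · rw [partialD_zero]

theorem coefD_comm (i j : Fin 2) (P : Op U) : coefD i (coefD j P) = coefD j (coefD i P) :=
  MvPolynomial.ext _ _ fun α => by simp only [coeff_coefD, partialD_comm i j]

theorem leftD_add (i : Fin 2) (P Q : Op U) :
    Op.leftD i (P + Q) = Op.leftD i P + Op.leftD i Q := by
  simp only [leftD_eq, coefD_add]; ring

theorem leftD_zero (i : Fin 2) : Op.leftD i (0 : Op U) = 0 := by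
  have := leftD_add i (0 : Op U) 0
  rw [add_zero] at this
  exact left_eq_add.1 this

theorem leftD_C_mul (i : Fin 2) (c : Smooth U) (P : Op U) :
    Op.leftD i (C c * P) = C c * Op.leftD i P + C (partialD i c) * P := by
  simp only [leftD_eq, coefD_C_mul]; ring

theorem leftD_comm (i j : Fin 2) (P : Op U) :
    Op.leftD i (Op.leftD j P) = Op.leftD j (Op.leftD i P) := by
  simp only [leftD_eq, coefD_add, coefD_X_mul, coefD_comm i j]; ring

theorem leftDPow_zero (P : Op U) : Op.leftDPow 0 P = P := rfl

theorem leftDPow_add_single (α : Fin 2 →₀ ℕ) (i : Fin 2) (P : Op U) :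
    Op.leftDPow (α + Finsupp.single i 1) P = Op.leftD i (Op.leftDPow α P) := by
  fin_cases i
  · simp [Op.leftDPow, Function.iterate_succ_apply']
  · simp only [Op.leftDPow, Fin.mk_one, Finsupp.add_apply, Finsupp.single_eq_same]
    rw [Finsupp.single_eq_of_ne (by decide), add_zero, Function.iterate_succ_apply']
    -- `Op.leftDPow` applies the powers of `∂₁` first, so a new `∂₁` has to be moved through those
    -- of `∂₀`.
    have h : Function.Commute (Op.leftD (U := U) 1) (Op.leftD 0) := fun P => leftD_comm 1 0 P
    exact ((h.iterate_right (α 0)) _).symm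

theorem leftDPow_single (i : Fin 2) (P : Op U) :
    Op.leftDPow (Finsupp.single i 1) P = Op.leftD i P := by
  have := leftDPow_add_single 0 i P
  rwa [zero_add, leftDPow_zero] at this

theorem leftDPow_add (α : Fin 2 →₀ ℕ) (P Q : Op U) :
    Op.leftDPow α (P + Q) = Op.leftDPow α P + Op.leftDPow α Q := by
  induction α using exponent_induction with
  | zero => rfl
  | step α i h => simp only [leftDPow_add_single, h, leftD_add]

/-- `P ↦ P ∘ Q` as a `C^∞(U)`-linear map. -/
def compR (Q : Op U) : Op U →ₗ[Smooth U] Op U :=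
  (basisMonomials (Fin 2) (Smooth U)).constr (Smooth U) fun α => Op.leftDPow α Q

theorem compR_monomial (Q : Op U) (α : Fin 2 →₀ ℕ) (c : Smooth U) :
    compR Q (monomial α c) = C c * Op.leftDPow α Q := by
  have h : (monomial α c : Op U) = c • basisMonomials (Fin 2) (Smooth U) α := by
    rw [coe_basisMonomials, smul_monomial, smul_eq_mul, mul_one]
  rw [h, map_smul, compR, Module.Basis.constr_basis, smul_eq_C_mul]

theorem comp_eq (P Q : Op U) : Op.comp P Q = compR Q P := by
  conv_rhs => rw [P.as_sum]
  rw [map_sum]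
  exact Finset.sum_congr rfl fun α _ => (compR_monomial Q α _).symm

theorem comp_monomial (α : Fin 2 →₀ ℕ) (c : Smooth U) (Q : Op U) :
    Op.comp (monomial α c) Q = C c * Op.leftDPow α Q := by
  rw [comp_eq, compR_monomial]

theorem add_comp (P P' Q : Op U) : Op.comp (P + P') Q = Op.comp P Q + Op.comp P' Q := by
  simp only [comp_eq, map_add]

theorem sub_comp (P P' Q : Op U) : Op.comp (P - P') Q = Op.comp P Q - Op.comp P' Q := by
  simp only [comp_eq, map_sub]

theorem zero_comp (Q : Op U) : Op.comp 0 Q = 0 := by simp only [comp_eq, map_zero]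

theorem smul_comp (c : Smooth U) (P Q : Op U) : Op.comp (c • P) Q = c • Op.comp P Q := by
  simp only [comp_eq, map_smul]

theorem C_mul_comp (c : Smooth U) (P Q : Op U) : Op.comp (C c * P) Q = C c * Op.comp P Q := by
  simp only [← smul_eq_C_mul, smul_comp]

theorem C_comp (c : Smooth U) (Q : Op U) : Op.comp (C c) Q = C c * Q := by
  have := comp_monomial 0 c Q
  rwa [leftDPow_zero] at this

theorem one_comp (Q : Op U) : Op.comp 1 Q = Q := by
  rw [← C_1, C_comp, C_1, one_mul]

theorem X_comp (i : Fin 2) (Q : Op U) : Op.comp (X i) Q = Op.leftD i Q := by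
  have := comp_monomial (Finsupp.single i 1) 1 Q
  rwa [leftDPow_single, C_1, one_mul] at this

theorem comp_add (P Q R : Op U) : Op.comp P (Q + R) = Op.comp P Q + Op.comp P R := by
  induction P using MvPolynomial.induction_on' with
  | monomial α c => simp only [comp_monomial, leftDPow_add]; ring
  | add p q hp hq => simp only [add_comp, hp, hq]; ring

theorem comp_sub (P Q R : Op U) : Op.comp P (Q - R) = Op.comp P Q - Op.comp P R := by
  rw [eq_sub_iff_add_eq, ← comp_add, sub_add_cancel]

/-- This is the Leibniz rule on the coefficient of a monomial. Iteration and linearity turn it into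
associativity of composition. -/
theorem leftD_comp (i : Fin 2) (Q R : Op U) :
    Op.comp (Op.leftD i Q) R = Op.leftD i (Op.comp Q R) := by
  induction Q using MvPolynomial.induction_on' with
  | monomial α c =>
    have h : Op.leftD i (monomial α c : Op U) =
        monomial α (partialD i c) + monomial (α + Finsupp.single i 1) c := by
      rw [leftD_eq]
      congr 1
      · refine MvPolynomial.ext _ _ fun β => ?_
        rw [coeff_coefD, coeff_monomial, coeff_monomial]
        split_ifs
        · rfl
        · exact partialD_zero i
      · rw [X, monomial_mul, one_mul, add_comm]
    rw [h, add_comp, comp_monomial, comp_monomial, comp_monomial, leftD_C_mul,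
      leftDPow_add_single, add_comm]
  | add p q hp hq => simp only [leftD_add, add_comp, hp, hq]

theorem leftDPow_comp (α : Fin 2 →₀ ℕ) (Q R : Op U) :
    Op.comp (Op.leftDPow α Q) R = Op.leftDPow α (Op.comp Q R) := by
  induction α using exponent_induction with
  | zero => rfl
  | step α i h => simp only [leftDPow_add_single, leftD_comp, h]

theorem comp_assoc (P Q R : Op U) : Op.comp (Op.comp P Q) R = Op.comp P (Op.comp Q R) := by
  induction P using MvPolynomial.induction_on' with
  | monomial α c => simp only [comp_monomial, C_mul_comp, leftDPow_comp]
  | add p q hp hq => simp only [add_comp, hp, hq]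

theorem leftD_mem_ordLT (i : Fin 2) {n : ℕ} {P : Op U} (hP : P ∈ ordLT (Smooth U) n) :
    Op.leftD i P ∈ ordLT (Smooth U) (n + 1) := by
  rw [leftD_eq, add_comm n 1]
  exact Submodule.add_mem _ (ordLT_mono (by omega) (coefD_mem_ordLT i hP))
    (mul_mem_ordLT (m := 1) (X_mem_ordLT i) hP)

theorem leftDPow_sub_mem (α : Fin 2 →₀ ℕ) {b : ℕ} {Q : Op U} (hQ : Q ∈ ordLT (Smooth U) (b + 1)) :
    Op.leftDPow α Q - monomial α 1 * Q ∈ ordLT (Smooth U) (α.degree + b) := by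
  induction α using exponent_induction with
  | zero =>
    have : (monomial 0 1 : Op U) = 1 := rfl
    rw [leftDPow_zero, this, one_mul, sub_self]
    exact Submodule.zero_mem _
  | step α i h =>
    have h0 : monomial α 1 * Q ∈ ordLT (Smooth U) (α.degree + (b + 1)) :=
      mul_mem_ordLT (monomial_mem_ordLT (Nat.lt_succ_self _) _) hQ
    have h1 : Op.leftDPow (α + Finsupp.single i 1) Q - monomial (α + Finsupp.single i 1) 1 * Q =
        coefD i (monomial α 1 * Q) + Op.leftD i (Op.leftDPow α Q - monomial α 1 * Q) := by
      have h2 : (monomial (α + Finsupp.single i 1) 1 : Op U) = X i * monomial α 1 := by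
        rw [X, monomial_mul, one_mul, add_comm]
      have h3 := leftD_add i (Op.leftDPow α Q - monomial α 1 * Q) (monomial α 1 * Q)
      rw [sub_add_cancel, leftD_eq i (monomial α 1 * Q)] at h3
      rw [leftDPow_add_single, h3, h2]
      ring
    rw [h1, map_add, Finsupp.degree_single]
    refine Submodule.add_mem _ (ordLT_mono (by omega) (coefD_mem_ordLT i h0))
      (ordLT_mono (by omega) (leftD_mem_ordLT i h))

theorem leftDPow_mem_ordLT (α : Fin 2 →₀ ℕ) {n : ℕ} {Q : Op U} (hQ : Q ∈ ordLT (Smooth U) n) :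
    Op.leftDPow α Q ∈ ordLT (Smooth U) (α.degree + n) := by
  induction α using exponent_induction with
  | zero => simpa [leftDPow_zero] using hQ
  | step α i h =>
    rw [leftDPow_add_single, map_add, Finsupp.degree_single, add_right_comm]
    exact leftD_mem_ordLT i h

theorem C_mul_mem_ordLT {R : Type*} [CommRing R] (c : R) {n : ℕ} {P : MvPolynomial (Fin 2) R}
    (hP : P ∈ ordLT R n) : C c * P ∈ ordLT R n := by
  rw [← smul_eq_C_mul]; exact Submodule.smul_mem _ _ hP

theorem comp_mem_ordLT {a b : ℕ} {P Q : Op U} (hP : P ∈ ordLT (Smooth U) (a + 1))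
    (hQ : Q ∈ ordLT (Smooth U) b) : Op.comp P Q ∈ ordLT (Smooth U) (a + b) := by
  refine Submodule.sum_mem _ fun α hα => C_mul_mem_ordLT _
    (ordLT_mono ?_ (leftDPow_mem_ordLT α hQ))
  have : α.degree < a + 1 := by
    by_contra h
    exact mem_support_iff.1 hα (mem_ordLT.1 hP α (by omega))
  omega

theorem comp_mem_ordLT' {a b : ℕ} {P Q : Op U} (hP : P ∈ ordLT (Smooth U) a)
    (hQ : Q ∈ ordLT (Smooth U) (b + 1)) : Op.comp P Q ∈ ordLT (Smooth U) (a + b) := by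
  cases a with
  | zero =>
    rw [ordLT_zero, Submodule.mem_bot] at hP
    rw [hP, zero_comp]
    exact Submodule.zero_mem _
  | succ a => exact ordLT_mono (by omega) (comp_mem_ordLT hP hQ)

/-- Composition differs from the commutative product by terms in which some derivative falls on a
coefficient of `Q`, and each such term loses an order. Hence symbols multiply. -/
theorem comp_sub_mul_mem {a b : ℕ} {P Q : Op U} (hP : P ∈ ordLT (Smooth U) (a + 1))
    (hQ : Q ∈ ordLT (Smooth U) (b + 1)) : Op.comp P Q - P * Q ∈ ordLT (Smooth U) (a + b) := by
  have h : Op.comp P Q - P * Q =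
      ∑ α ∈ P.support, C (coeff α P) * (Op.leftDPow α Q - monomial α 1 * Q) := by
    conv_lhs => rw [show P * Q = (∑ α ∈ P.support, monomial α (coeff α P)) * Q by rw [← P.as_sum]]
    rw [Op.comp, Finset.sum_mul, sub_eq_iff_eq_add, ← Finset.sum_add_distrib]
    refine Finset.sum_congr rfl fun α _ => ?_
    have h1 : (monomial α (coeff α P) : Op U) = C (coeff α P) * monomial α 1 := by
      rw [C_mul_monomial, mul_one]
    rw [h1]
    ring
  rw [h]
  refine Submodule.sum_mem _ fun α hα => C_mul_mem_ordLT _ (ordLT_mono ?_ (leftDPow_sub_mem α hQ))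
  have : α.degree < a + 1 := by
    by_contra h
    exact mem_support_iff.1 hα (mem_ordLT.1 hP α (by omega))
  omega

theorem homogeneousComponent_comp {a b : ℕ} {P Q : Op U} (hP : P ∈ ordLT (Smooth U) (a + 1))
    (hQ : Q ∈ ordLT (Smooth U) (b + 1)) : homogeneousComponent (a + b) (Op.comp P Q) =
      homogeneousComponent a P * homogeneousComponent b Q := by
  have h := homogeneousComponent_eq_zero_of_mem (comp_sub_mul_mem hP hQ) le_rfl
  rw [map_sub, sub_eq_zero] at h
  rw [h, homogeneousComponent_mul_of_mem hP hQ]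

/-- Operators with constant coefficients. -/
def cst (U : Opens (ℝ × ℝ)) : MvPolynomial (Fin 2) ℝ →+* Op U :=
  MvPolynomial.map (algebraMap ℝ (Smooth U))

theorem leftD_cst (i : Fin 2) (w : MvPolynomial (Fin 2) ℝ) :
    Op.leftD i (cst U w) = X i * cst U w := by
  rw [leftD_eq, add_eq_right]
  refine MvPolynomial.ext _ _ fun α => ?_
  rw [coeff_coefD, cst, coeff_map, partialD_algebraMap, coeff_zero]

theorem cst_X (i : Fin 2) : cst U (X i) = X i := map_X _ _

theorem cst_C (c : ℝ) : cst U (C c) = C (algebraMap ℝ (Smooth U) c) := map_C _ _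

theorem leftDPow_cst (α : Fin 2 →₀ ℕ) (w : MvPolynomial (Fin 2) ℝ) :
    Op.leftDPow α (cst U w) = cst U (monomial α 1 * w) := by
  induction α using exponent_induction with
  | zero =>
    have : (monomial 0 1 : MvPolynomial (Fin 2) ℝ) = 1 := rfl
    rw [this, one_mul]; rfl
  | step α i h =>
    have h2 : (monomial (α + Finsupp.single i 1) 1 : MvPolynomial (Fin 2) ℝ) =
        X i * monomial α 1 := by rw [X, monomial_mul, one_mul, add_comm]
    rw [leftDPow_add_single, h, leftD_cst, h2, mul_assoc, map_mul _ (X i), cst_X]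

/-- There is nothing to differentiate in a right factor with constant coefficients, so composition
is multiplication of polynomials. -/
theorem comp_cst (P : Op U) (w : MvPolynomial (Fin 2) ℝ) :
    Op.comp P (cst U w) = P * cst U w := by
  induction P using MvPolynomial.induction_on' with
  | monomial α c =>
    rw [comp_monomial, leftDPow_cst, map_mul, ← mul_assoc]
    congr 1
    rw [cst, map_monomial, map_one, C_mul_monomial, mul_one]
  | add p q hp hq => rw [add_comp, hp, hq, add_mul]

/-! ## Values at a point -/

/-- The value at `q` of (the coefficients of) an operator. -/
abbrev val (q : U) : Op U →+* MvPolynomial (Fin 2) ℝ := MvPolynomial.map (evalAt q)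

theorem op_ext {P Q : Op U} (h : ∀ q : U, val q P = val q Q) : P = Q :=
  MvPolynomial.ext _ _ fun α => smooth_ext fun q => by
    have := congrArg (coeff α) (h q)
    rwa [coeff_map, coeff_map] at this

theorem val_smul (q : U) (c : Smooth U) (P : Op U) : val q (c • P) = evalAt q c • val q P := by
  rw [smul_eq_C_mul, smul_eq_C_mul, map_mul, map_C]

theorem val_cst (q : U) (w : MvPolynomial (Fin 2) ℝ) : val q (cst U w) = w := by
  rw [cst, MvPolynomial.map_map]
  have : (evalAt q).comp (algebraMap ℝ (Smooth U)) = RingHom.id ℝ := RingHom.ext fun c => rfl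
  rw [this, MvPolynomial.map_id]

theorem cst_mem_ordLT {n : ℕ} {w : MvPolynomial (Fin 2) ℝ} (h : w ∈ ordLT ℝ n) :
    cst U w ∈ ordLT (Smooth U) n := map_mem_ordLT _ h

theorem mem_ordLT_iff_val {n : ℕ} {P : Op U} :
    P ∈ ordLT (Smooth U) n ↔ ∀ q : U, val q P ∈ ordLT ℝ n := by
  refine ⟨fun h q => map_mem_ordLT _ h, fun h => mem_ordLT.2 fun α hα => smooth_ext fun q => ?_⟩
  have := mem_ordLT.1 (h q) α hα
  rwa [coeff_map] at this

/-- Composition with `L` on the right, on the values at `q` of the left factors. -/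
def compVal (L : Op U) (q : U) : MvPolynomial (Fin 2) ℝ →ₗ[ℝ] MvPolynomial (Fin 2) ℝ :=
  (basisMonomials (Fin 2) ℝ).constr ℝ fun α => val q (Op.leftDPow α L)

theorem compVal_monomial (L : Op U) (q : U) (α : Fin 2 →₀ ℕ) (c : ℝ) :
    compVal L q (monomial α c) = c • val q (Op.leftDPow α L) := by
  have h : (monomial α c : MvPolynomial (Fin 2) ℝ) = c • basisMonomials (Fin 2) ℝ α := by
    rw [coe_basisMonomials, smul_monomial, smul_eq_mul, mul_one]
  rw [h, map_smul, compVal, Module.Basis.constr_basis]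

/-- The coefficients of the left factor are never differentiated, so right composition with `L` acts
on values at a single point. This is what allows ranks to be compared pointwise. -/
theorem val_comp (P L : Op U) (q : U) : val q (Op.comp P L) = compVal L q (val q P) := by
  induction P using MvPolynomial.induction_on' with
  | monomial α c =>
    rw [comp_monomial, map_mul, map_C, map_monomial, compVal_monomial, smul_eq_C_mul]
  | add p q hp hq => rw [add_comp, map_add, map_add, map_add, hp, hq]

theorem compVal_eq (L : Op U) (q : U) (u : MvPolynomial (Fin 2) ℝ) :
    compVal L q u = val q (Op.comp (cst U u) L) := by rw [val_comp, val_cst]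

theorem compVal_cst (w u : MvPolynomial (Fin 2) ℝ) (q : U) : compVal (cst U w) q u = u * w := by
  rw [compVal_eq, comp_cst, map_mul, val_cst, val_cst]

theorem compVal_mem_ordLT {L : Op U} {b : ℕ} (hL : L ∈ ordLT (Smooth U) (b + 1)) (q : U) {n : ℕ}
    {u : MvPolynomial (Fin 2) ℝ} (hu : u ∈ ordLT ℝ n) : compVal L q u ∈ ordLT ℝ (n + b) := by
  rw [compVal_eq]
  exact map_mem_ordLT _ (comp_mem_ordLT' (cst_mem_ordLT hu) hL)

theorem homogeneousComponent_compVal {L : Op U} {b : ℕ} (hL : L ∈ ordLT (Smooth U) (b + 1)) (q : U)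
    {k : ℕ} {u : MvPolynomial (Fin 2) ℝ} (hu : u ∈ ordLT ℝ (k + 1)) :
    homogeneousComponent (k + b) (compVal L q u) =
      homogeneousComponent k u * val q (homogeneousComponent b L) := by
  rw [compVal_eq, ← map_homogeneousComponent, homogeneousComponent_comp (cst_mem_ordLT hu) hL,
    map_mul, map_homogeneousComponent, val_cst]

/-- Leading forms multiply and polynomials over `ℝ` have no zero divisors, so composition with `L`
raises the degree of a value by exactly `b`; the degree bound on `u` is lowered one step at a time.
-/
theorem mem_ordLT_of_compVal {L : Op U} {b : ℕ} (hL : L ∈ ordLT (Smooth U) (b + 1)) {q : U}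
    (hq : val q (homogeneousComponent b L) ≠ 0) {k : ℕ} {u : MvPolynomial (Fin 2) ℝ}
    (hu : compVal L q u ∈ ordLT ℝ (k + b)) : u ∈ ordLT ℝ k := by
  obtain ⟨n, hn⟩ := exists_mem_ordLT u
  induction n with
  | zero => exact ordLT_mono (Nat.zero_le _) hn
  | succ n ih =>
    rcases Nat.lt_or_ge n k with h | h
    · exact ordLT_mono h hn
    · refine ih (mem_ordLT_of_homogeneousComponent hn ?_)
      have h1 := homogeneousComponent_compVal hL q hn
      rw [homogeneousComponent_eq_zero_of_mem hu (by omega)] at h1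
      exact (mul_eq_zero.1 h1.symm).resolve_right hq

theorem compVal_injective {L : Op U} {b : ℕ} (hL : L ∈ ordLT (Smooth U) (b + 1)) {q : U}
    (hq : val q (homogeneousComponent b L) ≠ 0) : Function.Injective (compVal L q) := by
  refine (injective_iff_map_eq_zero _).2 fun u hu => ?_
  have : u ∈ ordLT ℝ 0 := mem_ordLT_of_compVal hL hq (by rw [hu]; exact Submodule.zero_mem _)
  rwa [ordLT_zero, Submodule.mem_bot] at this

theorem mem_ordLT_of_comp {L : Op U} {b : ℕ} (hL : L ∈ ordLT (Smooth U) (b + 1))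
    (h0 : ∀ q, val q (homogeneousComponent b L) ≠ 0) {k : ℕ} {Q : Op U}
    (hQ : Op.comp Q L ∈ ordLT (Smooth U) (k + b)) : Q ∈ ordLT (Smooth U) k :=
  mem_ordLT_iff_val.2 fun q => mem_ordLT_of_compVal hL (h0 q)
    (by rw [← val_comp]; exact map_mem_ordLT _ hQ)

end Comp

/-! ## Bump functions and extension by zero -/

section Bump

variable {U W : Opens (ℝ × ℝ)}

/-- The restriction to `U` of a smooth function on the plane. -/
def ofContDiff (U : Opens (ℝ × ℝ)) (f : ℝ × ℝ → ℝ) (hf : ContDiff ℝ ∞ f) : Smooth U :=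
  ⟨fun q => f q, hf.contDiffOn.congr fun q hq => by rw [zeroExt_of_mem _ hq]⟩

theorem evalAt_ofContDiff (f : ℝ × ℝ → ℝ) (hf : ContDiff ℝ ∞ f) (q : U) :
    evalAt q (ofContDiff U f hf) = f q := rfl

theorem partialD_ofContDiff (f : ℝ × ℝ → ℝ) (hf : ContDiff ℝ ∞ f) (i : Fin 2) (q : U) :
    evalAt q (partialD i (ofContDiff U f hf)) = fderiv ℝ f q (coordVec i) :=
  evalAt_partialD_of_eventuallyEq _ _ _ (Eventually.of_forall fun _ => rfl)

theorem exists_bump_plane {q : U} {p : U → Prop} (h : ∀ᶠ z in 𝓝 q, p z) :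
    ∃ f : ℝ × ℝ → ℝ, ContDiff ℝ ∞ f ∧ f q = 1 ∧
      ∀ z ∈ tsupport f, ∃ hz : z ∈ U, p ⟨z, hz⟩ := by
  have hs : {z : ℝ × ℝ | ∃ hz : z ∈ U, p ⟨z, hz⟩} ∈ 𝓝 (q : ℝ × ℝ) := by
    rw [← map_nhds_subtype_coe_eq_nhds q.2 (U.isOpen.mem_nhds q.2)]
    exact Filter.eventually_map.2 (h.mono fun z hz => ⟨z.2, hz⟩)
  obtain ⟨f, h1, -, h2, -, h3⟩ := exists_contDiff_tsupport_subset (n := ⊤) hs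
  exact ⟨f, h2, h3, fun z hz => h1 hz⟩

theorem exists_bump {q : U} {p : U → Prop} (h : ∀ᶠ z in 𝓝 q, p z) :
    ∃ χ : Smooth U, evalAt q χ = 1 ∧ ∀ z, ¬ p z → evalAt z χ = 0 := by
  obtain ⟨f, hf, h1, h2⟩ := exists_bump_plane h
  refine ⟨ofContDiff U f hf, h1, fun z hz => ?_⟩
  rw [evalAt_ofContDiff]
  by_contra hc
  obtain ⟨_, h3⟩ := h2 z (subset_tsupport f hc)
  exact hz h3

/-- A smooth function on `W` need not extend to `U`, but it does after multiplication by a cutoff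
with closed support in `W`. This carries elements of an ideal over `W` back to `U`. -/
theorem exists_extension (χ : ℝ × ℝ → ℝ) (hχ : ContDiff ℝ ∞ χ)
    (hs : tsupport χ ⊆ W) (f : Smooth W) :
    ∃ g : Smooth U, (∀ q : U, ∀ hq : (q : ℝ × ℝ) ∈ W, evalAt q g = χ q * evalAt ⟨q, hq⟩ f) ∧
      ∀ q : U, (q : ℝ × ℝ) ∉ W → evalAt q g = 0 := by
  have h : ContDiff ℝ ∞ fun z => χ z * zeroExt f.1 z := by
    refine contDiff_iff_contDiffAt.2 fun z => ?_
    by_cases hz : z ∈ W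
    · exact hχ.contDiffAt.mul (contDiffAt_zeroExt f hz)
    · have h0 : χ =ᶠ[𝓝 z] 0 := notMem_tsupport_iff_eventuallyEq.1 fun h => hz (hs h)
      refine (contDiffAt_const (c := (0 : ℝ))).congr_of_eventuallyEq (h0.mono fun y hy => ?_)
      simp [hy]
  refine ⟨ofContDiff U _ h, fun q hq => ?_, fun q hq => ?_⟩
  · rw [evalAt_ofContDiff, zeroExt_of_mem _ hq, evalAt_apply]
  · rw [evalAt_ofContDiff, zeroExt, dif_neg hq, mul_zero]

end Bump

/-! ## Fibers of modules of operators -/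

section Fiber

variable {U : Opens (ℝ × ℝ)}

/-- The values at `q` of the elements of a module of operators. -/
def fiber (A : Submodule (Smooth U) (Op U)) (q : U) : Submodule ℝ (MvPolynomial (Fin 2) ℝ) where
  carrier := {u | ∃ P ∈ A, val q P = u}
  add_mem' := by
    rintro _ _ ⟨P, hP, rfl⟩ ⟨Q, hQ, rfl⟩
    exact ⟨P + Q, A.add_mem hP hQ, map_add _ _ _⟩
  zero_mem' := ⟨0, A.zero_mem, map_zero _⟩
  smul_mem' := by
    rintro c _ ⟨P, hP, rfl⟩
    refine ⟨algebraMap ℝ (Smooth U) c • P, A.smul_mem _ hP, ?_⟩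
    rw [val_smul, evalAt_algebraMap]

variable {A B M : Submodule (Smooth U) (Op U)} {q : U}

theorem val_mem_fiber {P : Op U} (hP : P ∈ A) (q : U) : val q P ∈ fiber A q := ⟨P, hP, rfl⟩

theorem fiber_mono {U : Opens (ℝ × ℝ)} {A B : Submodule (Smooth U) (Op U)} (h : A ≤ B) (q : U) : fiber A q ≤ fiber B q := by
  rintro _ ⟨P, hP, rfl⟩
  exact ⟨P, h hP, rfl⟩

theorem fiber_sup (A B : Submodule (Smooth U) (Op U)) (q : U) :
    fiber (U := U) (A ⊔ B) q = fiber A q ⊔ fiber B q := by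
  refine le_antisymm ?_ (sup_le (fiber_mono (U := U) (A := A) le_sup_left q)
    (fiber_mono (U := U) (A := B) le_sup_right q))
  rintro _ ⟨P, hP, rfl⟩
  obtain ⟨a, ha, b, hb, rfl⟩ := Submodule.mem_sup.1 hP
  rw [map_add]
  exact Submodule.add_mem_sup ⟨a, ha, rfl⟩ ⟨b, hb, rfl⟩

theorem fiber_le_ordLT {n : ℕ} (h : A ≤ ordLT (Smooth U) n) (q : U) :
    fiber A q ≤ ordLT ℝ n := by
  rintro _ ⟨P, hP, rfl⟩
  exact map_mem_ordLT _ (h hP)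

theorem fiber_ordLT (n : ℕ) (q : U) : fiber (ordLT (Smooth U) n) q = ordLT ℝ n :=
  le_antisymm (fiber_le_ordLT (U := U) le_rfl q) fun u hu => ⟨cst U u, cst_mem_ordLT hu, val_cst q u⟩

instance finiteDimensional_ordLT (n : ℕ) : FiniteDimensional ℝ (ordLT ℝ n) := by
  have : ordLT ℝ n ≤ restrictTotalDegree (Fin 2) ℝ n := fun P hP =>
    (mem_restrictTotalDegree _ _ _).2 (totalDegree_le_iff.2 (ordLT_mono (Nat.le_succ n) hP))
  exact Submodule.finiteDimensional_of_le this

theorem finiteDimensional_of_le_ordLT {n : ℕ} {E : Submodule ℝ (MvPolynomial (Fin 2) ℝ)}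
    (h : E ≤ ordLT ℝ n) : FiniteDimensional ℝ E :=
  Submodule.finiteDimensional_of_le h

/-- The `C^∞(U)`-linear extension of a linear functional on polynomials. -/
def extFunctional (U : Opens (ℝ × ℝ)) (φ : MvPolynomial (Fin 2) ℝ →ₗ[ℝ] ℝ) :
    Op U →ₗ[Smooth U] Smooth U :=
  (basisMonomials (Fin 2) (Smooth U)).constr (Smooth U) fun α =>
    algebraMap ℝ (Smooth U) (φ (monomial α 1))

theorem evalAt_extFunctional (φ : MvPolynomial (Fin 2) ℝ →ₗ[ℝ] ℝ) (q : U) (P : Op U) :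
    evalAt q (extFunctional U φ P) = φ (val q P) := by
  induction P using MvPolynomial.induction_on' with
  | monomial α c =>
    have h : (monomial α c : Op U) = c • basisMonomials (Fin 2) (Smooth U) α := by
      rw [coe_basisMonomials, smul_monomial, smul_eq_mul, mul_one]
    have h2 : (monomial α (evalAt q c) : MvPolynomial (Fin 2) ℝ) =
        evalAt q c • monomial α 1 := by rw [smul_monomial, smul_eq_mul, mul_one]
    rw [map_monomial, h2, h, LinearMap.map_smul φ, LinearMap.map_smul, extFunctional,
      Module.Basis.constr_basis, smul_eq_mul, smul_eq_mul, map_mul, evalAt_algebraMap]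
  | add p q hp hq => simp only [map_add, hp, hq]

/-- Elements of `A` are lifted from a basis of the fiber, and the dual basis is extended to all
polynomials, so that the same functionals can be evaluated on the fibers at nearby points. -/
theorem exists_frame {n : ℕ} (hA : A ≤ ordLT (Smooth U) n) (q : U) :
    ∃ (t : ℕ) (s : Fin t → Op U) (φ : Fin t → MvPolynomial (Fin 2) ℝ →ₗ[ℝ] ℝ),
      Module.finrank ℝ (fiber A q) = t ∧
      (∀ i, s i ∈ A) ∧ ∀ i k, φ k (val q (s i)) = if i = k then 1 else 0 := by
  have := finiteDimensional_of_le_ordLT (fiber_le_ordLT hA q)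
  let b := Module.finBasis ℝ (fiber A q)
  have h1 : ∀ i, ∃ P ∈ A, val q P = (b i : MvPolynomial (Fin 2) ℝ) := fun i => (b i).2
  choose s hs hsb using h1
  have h2 : ∀ k, ∃ g : MvPolynomial (Fin 2) ℝ →ₗ[ℝ] ℝ, g ∘ₗ (fiber A q).subtype = b.coord k :=
    fun k => LinearMap.exists_extend _
  choose φ hφ using h2
  refine ⟨_, s, φ, rfl, hs, fun i k => ?_⟩
  have h3 := LinearMap.congr_fun (hφ k) (b i)
  rw [hsb]
  simp only [LinearMap.comp_apply, Submodule.subtype_apply, Module.Basis.coord_apply,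
    Module.Basis.repr_self, Finsupp.single_apply] at h3
  exact h3

/-- The matrix of the values of functionals on operators. -/
def frameMatrix {t : ℕ} (s : Fin t → Op U) (φ : Fin t → MvPolynomial (Fin 2) ℝ →ₗ[ℝ] ℝ) :
    Matrix (Fin t) (Fin t) (Smooth U) := Matrix.of fun i k => extFunctional U (φ k) (s i)

theorem evalAt_det_frameMatrix {t : ℕ} (s : Fin t → Op U)
    (φ : Fin t → MvPolynomial (Fin 2) ℝ →ₗ[ℝ] ℝ) (z : U) :
    evalAt z (frameMatrix s φ).det =
      (Matrix.of fun i k : Fin t => φ k (val z (s i))).det := by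
  rw [RingHom.map_det]
  congr 1
  ext i k
  exact evalAt_extFunctional _ _ _

theorem evalAt_det_frameMatrix_eq_one {t : ℕ} {s : Fin t → Op U}
    {φ : Fin t → MvPolynomial (Fin 2) ℝ →ₗ[ℝ] ℝ}
    (hφ : ∀ i k, φ k (val q (s i)) = if i = k then 1 else 0) :
    evalAt q (frameMatrix s φ).det = 1 := by
  rw [evalAt_det_frameMatrix, ← Matrix.det_one (n := Fin t)]
  congr 1
  ext i k
  simp [hφ, Matrix.one_apply]

/-- The determinant is continuous and equals one at `q`. -/
theorem eventually_det_frameMatrix_ne_zero {t : ℕ} {s : Fin t → Op U}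
    {φ : Fin t → MvPolynomial (Fin 2) ℝ →ₗ[ℝ] ℝ}
    (hφ : ∀ i k, φ k (val q (s i)) = if i = k then 1 else 0) :
    ∀ᶠ z in 𝓝 q, evalAt z (frameMatrix s φ).det ≠ 0 :=
  (continuous_smooth _).continuousAt.eventually_ne
    (by rw [evalAt_det_frameMatrix_eq_one hφ]; exact one_ne_zero)

theorem linearIndependent_of_det {t : ℕ} {V : Type*} [AddCommGroup V] [Module ℝ V]
    (x : Fin t → V) (φ : Fin t → V →ₗ[ℝ] ℝ)
    (h : (Matrix.of fun i k => φ k (x i)).det ≠ 0) : LinearIndependent ℝ x :=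
  LinearIndependent.of_comp (LinearMap.pi φ)
    (Matrix.linearIndependent_rows_of_det_ne_zero h)

theorem card_le_finrank_fiber {n t : ℕ} (hA : A ≤ ordLT (Smooth U) n) {x : Fin t → Op U}
    (hx : ∀ i, x i ∈ A) (h : LinearIndependent ℝ fun i => val q (x i)) :
    t ≤ Module.finrank ℝ (fiber A q) := by
  have := finiteDimensional_of_le_ordLT (fiber_le_ordLT hA q)
  have h1 := finrank_span_eq_card h
  rw [Fintype.card_fin] at h1
  rw [← h1]
  refine Submodule.finrank_mono (Submodule.span_le.2 ?_)
  rintro _ ⟨i, rfl⟩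
  exact val_mem_fiber (hx i) q

/-- The rank of the fibers is lower semicontinuous. -/
theorem eventually_finrank_fiber_le {n : ℕ} (hA : A ≤ ordLT (Smooth U) n) (q : U) :
    ∀ᶠ z in 𝓝 q, Module.finrank ℝ (fiber A q) ≤ Module.finrank ℝ (fiber A z) := by
  obtain ⟨t, s, φ, ht, hs, hφ⟩ := exists_frame hA q
  rw [ht]
  refine (eventually_det_frameMatrix_ne_zero hφ).mono fun z hz =>
    card_le_finrank_fiber hA hs (linearIndependent_of_det _ φ ?_)
  rwa [← evalAt_det_frameMatrix]

/-- A combination of a frame that is annihilated by the functionals is zero. -/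
theorem val_eq_zero_of_frame {n t : ℕ} (hM : M ≤ ordLT (Smooth U) n) {s : Fin t → Op U}
    (hs : ∀ i, s i ∈ M) {φ : Fin t → MvPolynomial (Fin 2) ℝ →ₗ[ℝ] ℝ} {z : U}
    (hdet : (Matrix.of fun i k : Fin t => φ k (val z (s i))).det ≠ 0)
    (ht : Module.finrank ℝ (fiber M z) ≤ t) {Z : Op U} (hZ : Z ∈ M)
    (hφZ : ∀ k, φ k (val z Z) = 0) : val z Z = 0 := by
  have hfd := finiteDimensional_of_le_ordLT (fiber_le_ordLT hM z)
  have hli := linearIndependent_of_det (fun i => val z (s i)) φ hdet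
  have hspan : Submodule.span ℝ (Set.range fun i => val z (s i)) = fiber M z := by
    refine Submodule.eq_of_le_of_finrank_le (Submodule.span_le.2 ?_) ?_
    · rintro _ ⟨i, rfl⟩
      exact val_mem_fiber (hs i) z
    · rw [finrank_span_eq_card hli, Fintype.card_fin]
      exact ht
  have hmem : val z Z ∈ Submodule.span ℝ (Set.range fun i => val z (s i)) := by
    rw [hspan]
    exact val_mem_fiber hZ z
  obtain ⟨c, hc⟩ := (Submodule.mem_span_range_iff_exists_fun ℝ).1 hmem
  have hc0 : Matrix.vecMul c (Matrix.of fun i k : Fin t => φ k (val z (s i))) = 0 := by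
    funext k
    have h5 := congrArg (φ k) hc
    rw [hφZ, map_sum] at h5
    simpa [Matrix.vecMul, dotProduct] using h5
  rw [← hc, Matrix.eq_zero_of_vecMul_eq_zero hdet hc0]
  simp

/-- Cramer's rule: up to the determinant, a vector is a combination of `s` plus a vector annihilated by
the functionals `Φ`. -/
theorem exists_cramer {R V : Type*} [CommRing R] [AddCommGroup V] [Module R V] {t : ℕ}
    (s : Fin t → V) (Φ : Fin t → V →ₗ[R] R) (P : V) :
    ∃ (g : Fin t → R) (Z : V), (Matrix.of fun i k : Fin t => Φ k (s i)).det • P =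
      Z + ∑ i, g i • s i ∧ (∀ k, Φ k Z = 0) ∧
      ∀ f : R →+* ℝ, (∀ k, f (Φ k P) = 0) → ∀ i, f (g i) = 0 := by
  set N : Matrix (Fin t) (Fin t) R := Matrix.of fun i k : Fin t => Φ k (s i) with hN
  let b : Fin t → R := fun k => Φ k P
  let g : Fin t → R := Matrix.vecMul b N.adjugate
  have hg : ∀ k, ∑ i, g i * Φ k (s i) = N.det * b k := fun k => by
    have h3 : Matrix.vecMul g N = N.det • b := by
      rw [Matrix.vecMul_vecMul, Matrix.adjugate_mul, Matrix.vecMul_smul, Matrix.vecMul_one]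
    exact congrFun h3 k
  refine ⟨g, N.det • P - ∑ i, g i • s i, (sub_add_cancel _ _).symm, fun k => ?_, fun f h0 i => ?_⟩
  · rw [map_sub, map_smul, map_sum, sub_eq_zero, smul_eq_mul]
    simp only [map_smul, smul_eq_mul]
    exact (hg k).symm
  · have hb : ∀ k, f (b k) = 0 := h0
    simp only [g, Matrix.vecMul, dotProduct, map_sum, map_mul, hb, zero_mul,
      Finset.sum_const_zero]

/-- If the rank of `M ≥ A` near `q` does not exceed the rank of `A` at `q`, then the elements of `M`
are near `q` combinations of elements of `A`, with coefficients that vanish at `q` if the element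
does. -/
theorem exists_smul_eq_sum {n : ℕ} (hAM : A ≤ M) (hM : M ≤ ordLT (Smooth U) n)
    (h : ∀ᶠ z in 𝓝 q, Module.finrank ℝ (fiber M z) ≤ Module.finrank ℝ (fiber A q))
    {P : Op U} (hP : P ∈ M) :
    ∃ (t : ℕ) (s : Fin t → Op U) (g : Fin t → Smooth U) (δ : Smooth U), (∀ i, s i ∈ A) ∧
      evalAt q δ ≠ 0 ∧ δ • P = ∑ i, g i • s i ∧ (val q P = 0 → ∀ i, evalAt q (g i) = 0) := by
  obtain ⟨t, s, φ, ht, hs, hφ⟩ := exists_frame (hAM.trans hM) q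
  rw [ht] at h
  -- `χ` vanishes wherever the frame degenerates or the rank of `M` exceeds `t`. Elsewhere the frame
  -- spans the fiber of `M`, so the remainder `Z` of Cramer's rule is zero. Thus the relation holds
  -- on all of `U` after multiplication by `χ`, and `δ = χ d` is one at `q`.
  obtain ⟨χ, hχ, hχ0⟩ := exists_bump ((eventually_det_frameMatrix_ne_zero hφ).and h)
  have h1 := evalAt_det_frameMatrix_eq_one hφ
  have hd := evalAt_det_frameMatrix s φ
  obtain ⟨g, Z, hZ, hφZ, hg⟩ := exists_cramer s (fun k => extFunctional U (φ k)) P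
  change (frameMatrix s φ).det • P = _ at hZ
  generalize (frameMatrix s φ).det = d at h1 hd hχ0 hZ
  have hsum : ∑ i, g i • s i ∈ M := M.sum_mem fun i _ => M.smul_mem _ (hAM (hs i))
  have hZM : Z ∈ M := by
    have h4 := M.smul_mem d hP
    rw [hZ] at h4
    exact (M.add_mem_iff_left hsum).1 h4
  have hz : χ • Z = 0 := by
    refine op_ext fun z => ?_
    rw [val_smul, map_zero]
    by_cases hzp : evalAt z d ≠ 0 ∧ Module.finrank ℝ (fiber M z) ≤ t
    · rw [val_eq_zero_of_frame hM (fun i => hAM (hs i)) (φ := φ) (by rw [← hd]; exact hzp.1) hzp.2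
        hZM fun k => by rw [← evalAt_extFunctional, hφZ, map_zero], smul_zero]
    · rw [hχ0 z hzp, zero_smul]
  refine ⟨t, s, fun i => χ * g i, χ * d, hs, by rw [map_mul, hχ, h1]; norm_num, ?_, fun h0 i => ?_⟩
  · rw [mul_smul, hZ, smul_add, hz, zero_add, Finset.smul_sum]
    exact Finset.sum_congr rfl fun i _ => (mul_smul _ _ _).symm
  · rw [map_mul, hg (evalAt q) (fun k => by rw [evalAt_extFunctional, h0, map_zero]) i, mul_zero]

end Fiber

/-! ## Dimensions -/

section Dimension

/-- The dimension of the space of polynomials of degree `< n` in two variables. -/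
def tri (n : ℕ) : ℕ := ∑ k ∈ Finset.range n, (k + 1)

theorem tri_succ (n : ℕ) : tri (n + 1) = tri n + (n + 1) := Finset.sum_range_succ _ _

theorem tri_zero : tri 0 = 0 := rfl

theorem finrank_homogeneousSubmodule (k : ℕ) :
    Module.finrank ℝ (homogeneousSubmodule (Fin 2) ℝ k) = k + 1 := by
  have h : homogeneousSubmodule (Fin 2) ℝ k = restrictSupport ℝ {α | α.degree = k} := by
    ext P
    rw [mem_homogeneousSubmodule, mem_restrictSupport_iff]
    constructor
    · intro hP α hα
      by_contra hc
      exact mem_support_iff.1 hα (hP.coeff_eq_zero hc)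
    · intro hP α hα
      rw [← hP (mem_support_iff.2 hα), Finsupp.degree_eq_weight_one]
      rfl
  rw [h, Module.finrank_eq_nat_card_basis (basisRestrictSupport ℝ {α : Fin 2 →₀ ℕ | α.degree = k})]
  let e : ({α : Fin 2 →₀ ℕ | α.degree = k}) ≃ Finset.HasAntidiagonal.antidiagonal k :=
    { toFun := fun α => ⟨(α.1 0, α.1 1), by
        have := α.2
        simp only [Set.mem_ofPred_eq, Finsupp.degree_eq_sum, Fin.sum_univ_two] at this
        simpa using this⟩
      invFun := fun p => ⟨Finsupp.equivFunOnFinite.symm ![p.1.1, p.1.2], by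
        have := p.2
        rw [Finset.HasAntidiagonal.mem_antidiagonal] at this
        simp [Finsupp.degree_eq_sum, Fin.sum_univ_two, this]⟩
      left_inv := fun α => by
        ext i
        fin_cases i <;> simp
      right_inv := fun p => by simp }
  rw [Nat.card_congr e, Nat.card_eq_fintype_card, Fintype.card_coe, Finset.Nat.card_antidiagonal]

/-- Rank and nullity of the map taking the leading form of degree `k`: the kernel consists of the
elements of smaller degree. -/
theorem finrank_map_homogeneousComponent_add {k : ℕ} {E : Submodule ℝ (MvPolynomial (Fin 2) ℝ)}
    (hE : E ≤ ordLT ℝ (k + 1)) :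
    Module.finrank ℝ (E.map (homogeneousComponent k)) +
      Module.finrank ℝ (E ⊓ ordLT ℝ k : Submodule ℝ (MvPolynomial (Fin 2) ℝ)) =
      Module.finrank ℝ E := by
  have := finiteDimensional_of_le_ordLT hE
  let f : E →ₗ[ℝ] MvPolynomial (Fin 2) ℝ := (homogeneousComponent k).domRestrict E
  have h1 := LinearMap.finrank_range_add_finrank_ker f
  have h2 : LinearMap.range f = E.map (homogeneousComponent k) := LinearMap.range_domRestrict _ _
  have h3 : (LinearMap.ker f).map E.subtype = E ⊓ ordLT ℝ k := by
    ext u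
    simp only [Submodule.mem_map, LinearMap.mem_ker, Submodule.mem_inf]
    constructor
    · rintro ⟨x, hx, rfl⟩
      exact ⟨x.2, mem_ordLT_of_homogeneousComponent (hE x.2) hx⟩
    · rintro ⟨hu, hk⟩
      exact ⟨⟨u, hu⟩, homogeneousComponent_eq_zero_of_mem hk le_rfl, rfl⟩
  rw [h2, ← Submodule.finrank_map_subtype_eq, h3] at h1
  exact h1

theorem map_homogeneousComponent_le (E : Submodule ℝ (MvPolynomial (Fin 2) ℝ)) (k : ℕ) :
    E.map (homogeneousComponent k) ≤ homogeneousSubmodule (Fin 2) ℝ k := by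
  rintro _ ⟨u, -, rfl⟩
  exact homogeneousComponent_isHomogeneous k u

theorem homogeneousSubmodule_le_ordLT (k : ℕ) :
    homogeneousSubmodule (Fin 2) ℝ k ≤ ordLT ℝ (k + 1) := fun _ hu =>
  IsHomogeneous.mem_ordLT hu (Nat.lt_succ_self _)

theorem finrank_ordLT (n : ℕ) : Module.finrank ℝ (ordLT ℝ n) = tri n := by
  induction n with
  | zero => rw [ordLT_zero, finrank_bot, tri_zero]
  | succ n ih =>
    have h := finrank_map_homogeneousComponent_add (k := n) (E := ordLT ℝ (n + 1)) le_rfl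
    have h1 : (ordLT ℝ (n + 1)).map (homogeneousComponent n) = homogeneousSubmodule (Fin 2) ℝ n := by
      refine le_antisymm (map_homogeneousComponent_le _ _) fun u hu => ?_
      exact ⟨u, homogeneousSubmodule_le_ordLT n hu, homogeneousComponent_eq_self hu⟩
    rw [h1, finrank_homogeneousSubmodule, inf_eq_right.2 (ordLT_mono (Nat.le_succ n)), ih] at h
    rw [← h, tri_succ]
    omega

end Dimension

/-! ## Left ideals -/

section LeftIdeal

variable {U : Opens (ℝ × ℝ)}

/-- Stability under composition with `∂₀`, `∂₁` on the left. -/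
def IsLeft (I : Submodule (Smooth U) (Op U)) : Prop := ∀ i, ∀ P ∈ I, Op.leftD i P ∈ I

theorem IsLeft.leftDPow_mem {I : Submodule (Smooth U) (Op U)} (hI : IsLeft I) (α : Fin 2 →₀ ℕ)
    {P : Op U} (hP : P ∈ I) : Op.leftDPow α P ∈ I := by
  induction α using exponent_induction with
  | zero => exact hP
  | step α i h => rw [leftDPow_add_single]; exact hI i _ h

theorem IsLeft.comp_mem {I : Submodule (Smooth U) (Op U)} (hI : IsLeft I) (Q : Op U)
    {P : Op U} (hP : P ∈ I) : Op.comp Q P ∈ I := by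
  induction Q using MvPolynomial.induction_on' with
  | monomial α c =>
    rw [comp_monomial, ← smul_eq_C_mul]
    exact I.smul_mem _ (hI.leftDPow_mem α hP)
  | add p q hp hq => rw [add_comp]; exact I.add_mem hp hq

/-- The left ideal generated by a system, as a module. -/
def systemMod {r : ℕ} (F : Fin r → Op U) : Submodule (Smooth U) (Op U) :=
  Submodule.span (Smooth U)
    (Set.range fun jα : Fin r × (Fin 2 →₀ ℕ) => Op.leftDPow jα.2 (F jα.1))

theorem coe_systemMod {r : ℕ} (F : Fin r → Op U) :
    (systemMod F : Set (Op U)) = systemIdeal F := rfl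

theorem leftDPow_mem_systemMod {r : ℕ} (F : Fin r → Op U) (j : Fin r) (α : Fin 2 →₀ ℕ) :
    Op.leftDPow α (F j) ∈ systemMod F := Submodule.subset_span ⟨(j, α), rfl⟩

theorem isLeft_systemMod {r : ℕ} (F : Fin r → Op U) : IsLeft (systemMod F) := by
  intro i P hP
  refine Submodule.span_induction (p := fun P _ => Op.leftD i P ∈ systemMod F) ?_ ?_ ?_ ?_ hP
  · rintro _ ⟨⟨j, α⟩, rfl⟩
    have := leftDPow_mem_systemMod F j (α + Finsupp.single i 1)
    rwa [leftDPow_add_single] at this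
  · rw [leftD_zero]; exact Submodule.zero_mem _
  · intro P Q _ _ hP hQ
    rw [leftD_add]; exact Submodule.add_mem _ hP hQ
  · intro c P hP' hP
    rw [smul_eq_C_mul, leftD_C_mul, ← smul_eq_C_mul, ← smul_eq_C_mul]
    exact Submodule.add_mem _ (Submodule.smul_mem _ _ hP) (Submodule.smul_mem _ _ hP')

theorem mem_systemMod {r : ℕ} (F : Fin r → Op U) (j : Fin r) : F j ∈ systemMod F :=
  leftDPow_mem_systemMod F j 0

/-- The transformed ideal as a module. -/
def laplaceMod (I : Submodule (Smooth U) (Op U)) (L : Op U) : Submodule (Smooth U) (Op U) :=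
  I.comap (compR L)

theorem mem_laplaceMod {I : Submodule (Smooth U) (Op U)} {L Q : Op U} :
    Q ∈ laplaceMod I L ↔ Op.comp Q L ∈ I := by rw [comp_eq]; rfl

theorem coe_laplaceMod (I : Submodule (Smooth U) (Op U)) (L : Op U) :
    (laplaceMod I L : Set (Op U)) = laplace (I : Set (Op U)) L := by
  ext Q
  exact mem_laplaceMod

theorem isLeft_laplaceMod {I : Submodule (Smooth U) (Op U)} (hI : IsLeft I) (L : Op U) :
    IsLeft (laplaceMod I L) := fun i P hP => by
  rw [mem_laplaceMod] at hP ⊢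
  rw [leftD_comp]
  exact hI i _ hP

/-- The elements of order `< n`. -/
def trunc (I : Submodule (Smooth U) (Op U)) (n : ℕ) : Submodule (Smooth U) (Op U) :=
  I ⊓ ordLT (Smooth U) n

theorem trunc_le_ordLT (I : Submodule (Smooth U) (Op U)) (n : ℕ) :
    trunc I n ≤ ordLT (Smooth U) n := inf_le_right

theorem trunc_mono (I : Submodule (Smooth U) (Op U)) {m n : ℕ} (h : m ≤ n) :
    trunc I m ≤ trunc I n := inf_le_inf_left _ (ordLT_mono h)

theorem IsLeft.leftD_mem_trunc {I : Submodule (Smooth U) (Op U)} (hI : IsLeft I) (i : Fin 2) {n : ℕ}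
    {P : Op U} (hP : P ∈ trunc I n) : Op.leftD i P ∈ trunc I (n + 1) :=
  ⟨hI i _ hP.1, leftD_mem_ordLT i hP.2⟩

/-! ## Symbols of an ideal -/

/-- The span in the definition is superfluous: the symbols at `q` are the linear image of a fiber,
to which the semicontinuity and lifting results apply. -/
theorem symbolSpace_eq (I : Submodule (Smooth U) (Op U)) (k : ℕ) (q : U) :
    symbolSpace (I : Set (Op U)) k q =
      (fiber (trunc I (k + 1)) q).map (homogeneousComponent k) := by
  refine le_antisymm (Submodule.span_le.2 ?_) ?_
  · rintro _ ⟨P, hP, hk, rfl⟩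
    rw [map_homogeneousComponent]
    exact ⟨_, val_mem_fiber (A := trunc I (k + 1)) ⟨hP, totalDegree_le_iff.1 hk⟩ q, rfl⟩
  · rintro _ ⟨_, ⟨P, hP, rfl⟩, rfl⟩
    refine Submodule.subset_span ⟨P, hP.1, totalDegree_le_iff.2 hP.2, ?_⟩
    rw [map_homogeneousComponent]

theorem mem_symbolSpace {I : Submodule (Smooth U) (Op U)} {k : ℕ} {q : U}
    {σ : MvPolynomial (Fin 2) ℝ} : σ ∈ symbolSpace (I : Set (Op U)) k q ↔
      ∃ P ∈ trunc I (k + 1), val q (homogeneousComponent k P) = σ := by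
  rw [symbolSpace_eq]
  constructor
  · rintro ⟨_, ⟨P, hP, rfl⟩, rfl⟩
    exact ⟨P, hP, map_homogeneousComponent _ _ _⟩
  · rintro ⟨P, hP, rfl⟩
    exact ⟨_, val_mem_fiber hP q, (map_homogeneousComponent _ _ _).symm⟩

theorem symbolSpace_le (I : Submodule (Smooth U) (Op U)) (k : ℕ) (q : U) :
    symbolSpace (I : Set (Op U)) k q ≤ homogeneousSubmodule (Fin 2) ℝ k := by
  rw [symbolSpace_eq]
  exact map_homogeneousComponent_le _ _

instance finiteDimensional_homogeneousSubmodule (k : ℕ) :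
    FiniteDimensional ℝ (homogeneousSubmodule (Fin 2) ℝ k) :=
  finiteDimensional_of_le_ordLT (homogeneousSubmodule_le_ordLT k)

instance finiteDimensional_symbolSpace (I : Submodule (Smooth U) (Op U)) (k : ℕ) (q : U) :
    FiniteDimensional ℝ (symbolSpace (I : Set (Op U)) k q) :=
  Submodule.finiteDimensional_of_le (symbolSpace_le I k q)

theorem finrank_gSymbol_add (I : Submodule (Smooth U) (Op U)) (k : ℕ) (q : U) :
    Module.finrank ℝ (gSymbol (I : Set (Op U)) k q) +
      Module.finrank ℝ (symbolSpace (I : Set (Op U)) k q) = k + 1 := by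
  have h1 := Subspace.finrank_add_finrank_dualAnnihilator_eq
    ((symbolSpace (I : Set (Op U)) k q).comap (homogeneousSubmodule (Fin 2) ℝ k).subtype)
  rw [finrank_homogeneousSubmodule, ← Submodule.finrank_map_subtype_eq,
    Submodule.map_comap_subtype, inf_eq_right.2 (symbolSpace_le I k q), add_comm] at h1
  exact h1

theorem IsRegular.finrank_symbolSpace {I : Submodule (Smooth U) (Op U)} {h : ℕ → ℕ}
    (hI : IsRegular (I : Set (Op U)) h) (k : ℕ) (q : U) :
    h k + Module.finrank ℝ (symbolSpace (I : Set (Op U)) k q) = k + 1 := by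
  rw [← hI k q]
  exact finrank_gSymbol_add I k q

theorem isRegular_iff {I : Submodule (Smooth U) (Op U)} {h : ℕ → ℕ} :
    IsRegular (I : Set (Op U)) h ↔
      ∀ k q, h k + Module.finrank ℝ (symbolSpace (I : Set (Op U)) k q) = k + 1 := by
  refine ⟨fun hI k q => hI.finrank_symbolSpace k q, fun hI k q => ?_⟩
  have := hI k q
  have := finrank_gSymbol_add I k q
  omega

theorem IsLeft.X_mul_mem_symbolSpace {I : Submodule (Smooth U) (Op U)} (hI : IsLeft I) (i : Fin 2)
    {k : ℕ} {q : U} {σ : MvPolynomial (Fin 2) ℝ} (hσ : σ ∈ symbolSpace (I : Set (Op U)) k q) :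
    X i * σ ∈ symbolSpace (I : Set (Op U)) (k + 1) q := by
  rw [mem_symbolSpace] at hσ ⊢
  obtain ⟨P, hP, rfl⟩ := hσ
  refine ⟨Op.leftD i P, hI.leftD_mem_trunc i hP, ?_⟩
  rw [← X_comp, add_comm k 1, homogeneousComponent_comp (X_mem_ordLT i) hP.2, map_mul,
    homogeneousComponent_eq_self (isHomogeneous_X _ i), map_X]

/-! ## Lifting values -/

/-- Where the rank of the image of `A` under a linear map `T` is constant, the values of the elements
of `A` annihilated by `T` are the values of `A` at which `T` vanishes. -/
theorem val_mem_fiber_ker {n : ℕ} {A : Submodule (Smooth U) (Op U)} (T : Op U →ₗ[Smooth U] Op U)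
    (hT : A.map T ≤ ordLT (Smooth U) n) {q : U}
    (h : ∀ᶠ z in 𝓝 q, Module.finrank ℝ (fiber (A.map T) z) ≤ Module.finrank ℝ (fiber (A.map T) q))
    {P : Op U} (hP : P ∈ A) (h0 : val q (T P) = 0) :
    val q P ∈ fiber (A ⊓ LinearMap.ker T) q := by
  obtain ⟨t, s, g, δ, hs, hδ, hsum, hg⟩ :=
    exists_smul_eq_sum le_rfl hT h (Submodule.mem_map_of_mem hP)
  choose a ha has using hs
  have hg := hg h0
  -- The correction makes `T` vanish identically. Its coefficients vanish at `q`, so the value at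
  -- `q` is only multiplied by `δ(q) ≠ 0`.
  have hx : δ • P - ∑ i, g i • a i ∈ A ⊓ LinearMap.ker T := by
    refine ⟨A.sub_mem (A.smul_mem _ hP) (A.sum_mem fun i _ => A.smul_mem _ (ha i)), ?_⟩
    simp only [SetLike.mem_coe, LinearMap.mem_ker]
    rw [map_sub, map_smul, hsum, map_sum, sub_eq_zero]
    exact Finset.sum_congr rfl fun i _ => by rw [map_smul, has]
  have h2 := val_mem_fiber hx q
  have h3 : val q (δ • P - ∑ i, g i • a i) = evalAt q δ • val q P := by
    rw [map_sub, map_sum, val_smul, Finset.sum_eq_zero, sub_zero]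
    intro i _
    rw [val_smul, hg i, zero_smul]
  rw [h3] at h2
  exact (Submodule.smul_mem_iff _ hδ).1 h2

/-- Where the rank of `A ⊔ B` is constant, the values of `A ⊓ B` are the common values. -/
theorem fiber_inf {n : ℕ} {A B : Submodule (Smooth U) (Op U)} (hA : A ≤ ordLT (Smooth U) n)
    (hB : B ≤ ordLT (Smooth U) n) {q : U}
    (h : ∀ᶠ z in 𝓝 q, Module.finrank ℝ (fiber (A ⊔ B) z) ≤ Module.finrank ℝ (fiber (A ⊔ B) q)) :
    fiber (A ⊓ B) q = fiber A q ⊓ fiber B q := by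
  refine le_antisymm (le_inf (fiber_mono inf_le_left q) (fiber_mono inf_le_right q)) ?_
  rintro _ ⟨⟨a, ha, rfl⟩, ⟨b, hb, hab⟩⟩
  have hM : a - b ∈ A ⊔ B :=
    Submodule.sub_mem _ (Submodule.mem_sup_left ha) (Submodule.mem_sup_right hb)
  -- Since `a - b` vanishes at `q`, so do the coefficients `g i`. Splitting `s i = x i + y i` along
  -- `A` and `B` gives `δ a - ∑ g i x i = δ b + ∑ g i y i`, an element of both modules with value
  -- `δ(q) a(q)` at `q`.
  obtain ⟨t, s, g, δ, hs, hδ, hsum, hg⟩ := exists_smul_eq_sum le_rfl (sup_le hA hB) h hM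
  have hg := hg (by rw [map_sub, hab, sub_self])
  have hs' : ∀ i, ∃ a ∈ A, ∃ b ∈ B, a + b = s i := fun i => Submodule.mem_sup.1 (hs i)
  choose x hx y hy hxy using hs'
  have hsum' : δ • a - ∑ i, g i • x i = δ • b + ∑ i, g i • y i := by
    have h1 : ∑ i, g i • s i = ∑ i, g i • x i + ∑ i, g i • y i := by
      rw [← Finset.sum_add_distrib]
      exact Finset.sum_congr rfl fun i _ => by rw [← hxy, smul_add]
    rw [smul_sub, h1, sub_eq_iff_eq_add] at hsum
    rw [hsum]
    abel
  have hmem : δ • a - ∑ i, g i • x i ∈ A ⊓ B := by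
    refine ⟨A.sub_mem (A.smul_mem _ ha) (A.sum_mem fun i _ => A.smul_mem _ (hx i)), ?_⟩
    rw [hsum']
    exact B.add_mem (B.smul_mem _ hb) (B.sum_mem fun i _ => B.smul_mem _ (hy i))
  have h2 := val_mem_fiber hmem q
  have h3 : val q (δ • a - ∑ i, g i • x i) = evalAt q δ • val q a := by
    rw [map_sub, map_sum, val_smul, Finset.sum_eq_zero, sub_zero]
    intro i _
    rw [val_smul, hg i, zero_smul]
  rw [h3] at h2
  exact (Submodule.smul_mem_iff _ hδ).1 h2

theorem fiber_map_homogeneousComponent (I : Submodule (Smooth U) (Op U)) (k : ℕ) (q : U) :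
    fiber ((trunc I (k + 1)).map (homogeneousComponent k)) q =
      symbolSpace (I : Set (Op U)) k q := by
  ext σ
  rw [mem_symbolSpace]
  constructor
  · rintro ⟨_, ⟨P, hP, rfl⟩, rfl⟩
    exact ⟨P, hP, rfl⟩
  · rintro ⟨P, hP, rfl⟩
    exact ⟨_, ⟨P, hP, rfl⟩, rfl⟩

theorem map_homogeneousComponent_trunc_le (I : Submodule (Smooth U) (Op U)) (k : ℕ) :
    (trunc I (k + 1)).map (homogeneousComponent k) ≤ ordLT (Smooth U) (k + 1) := by
  rintro _ ⟨P, -, rfl⟩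
  exact IsHomogeneous.mem_ordLT (homogeneousComponent_isHomogeneous k P) (Nat.lt_succ_self _)

/-- Because the symbols of order `k` have constant rank, an element whose symbol vanishes only at
`q` can be replaced by one of order `< k` with the same value there. -/
theorem IsRegular.fiber_trunc_inf {I : Submodule (Smooth U) (Op U)} {h : ℕ → ℕ}
    (hI : IsRegular (I : Set (Op U)) h) (k : ℕ) (q : U) :
    fiber (trunc I (k + 1)) q ⊓ ordLT ℝ k = fiber (trunc I k) q := by
  refine le_antisymm ?_ (le_inf (fiber_mono (trunc_mono I (Nat.le_succ k)) q)
    (fiber_le_ordLT (trunc_le_ordLT I k) q))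
  rintro _ ⟨⟨P, hP, rfl⟩, hk⟩
  have h1 : ∀ z, Module.finrank ℝ (fiber ((trunc I (k + 1)).map (homogeneousComponent k)) z) =
      k + 1 - h k := fun z => by
    rw [fiber_map_homogeneousComponent, ← hI.finrank_symbolSpace k z, Nat.add_sub_cancel_left]
  have h2 := val_mem_fiber_ker (homogeneousComponent k) (map_homogeneousComponent_trunc_le I k)
    (q := q) (Eventually.of_forall fun z => by rw [h1, h1]) hP
    (by rw [map_homogeneousComponent]; exact homogeneousComponent_eq_zero_of_mem hk le_rfl)
  refine fiber_mono ?_ q h2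
  rintro Q ⟨hQ, hQ0⟩
  exact ⟨hQ.1, mem_ordLT_of_homogeneousComponent hQ.2 (LinearMap.mem_ker.1 hQ0)⟩

/-- The dimensions of the symbol spaces add up along the filtration by order. -/
theorem IsRegular.finrank_fiber_trunc {I : Submodule (Smooth U) (Op U)} {h : ℕ → ℕ}
    (hI : IsRegular (I : Set (Op U)) h) (n : ℕ) (q : U) :
    Module.finrank ℝ (fiber (trunc I n) q) + ∑ k ∈ Finset.range n, h k = tri n := by
  induction n with
  | zero =>
    have : fiber (trunc I 0) q = ⊥ := by
      rw [eq_bot_iff, ← ordLT_zero]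
      exact fiber_le_ordLT (trunc_le_ordLT I 0) q
    rw [this, finrank_bot, tri_zero]
    rfl
  | succ n ih =>
    have h1 := finrank_map_homogeneousComponent_add (fiber_le_ordLT (trunc_le_ordLT I (n + 1)) q)
    rw [hI.fiber_trunc_inf, ← symbolSpace_eq] at h1
    have h2 := hI.finrank_symbolSpace n q
    rw [Finset.sum_range_succ, tri_succ]
    omega

end LeftIdeal

/-! ## Division by a linear form -/

section Division

variable {R : Type*} [CommRing R]

/-- The linear form `a ξ₀ + b ξ₁`. -/
def linForm (a b : R) : MvPolynomial (Fin 2) R := C a * X 0 + C b * X 1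

theorem isHomogeneous_linForm (a b : R) : (linForm a b).IsHomogeneous 1 :=
  (isHomogeneous_C_mul_X a 0).add (isHomogeneous_C_mul_X b 1)

theorem linForm_mem_ordLT (a b : R) : linForm a b ∈ ordLT R 2 :=
  IsHomogeneous.mem_ordLT (isHomogeneous_linForm a b) (by norm_num)

theorem eval_linForm (a b : R) (p : Fin 2 → R) : eval p (linForm a b) = a * p 0 + b * p 1 := by
  simp [linForm]

theorem map_linForm {S : Type*} [CommRing S] (f : R →+* S) (a b : R) :
    MvPolynomial.map f (linForm a b) = linForm (f a) (f b) := by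
  simp [linForm]

theorem linForm_ne_zero [Nontrivial R] {a b : R} (h : a ≠ 0 ∨ b ≠ 0) : linForm a b ≠ 0 := by
  intro h0
  have h1 := congrArg (eval ![1, 0]) h0
  have h2 := congrArg (eval ![0, 1]) h0
  rw [eval_linForm, map_zero] at h1 h2
  simp at h1 h2
  tauto

/-- In the basis of linear forms `l = (a, b)` and `(-b, a)`, the variables are combinations with
denominator `a ^ 2 + b ^ 2`. Multiplying by its powers avoids division, so the identity holds over
any commutative ring, in particular `C^∞(U)`. -/
theorem exists_division_monomial (a b : R) (α : Fin 2 →₀ ℕ) :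
    ∃ g ∈ ordLT R α.degree, C ((a ^ 2 + b ^ 2) ^ α.degree) * monomial α 1 =
      C (eval ![-b, a] (monomial α 1)) * linForm (-b) a ^ α.degree + linForm a b * g := by
  induction α using exponent_induction with
  | zero =>
    refine ⟨0, Submodule.zero_mem _, ?_⟩
    have : (monomial 0 1 : MvPolynomial (Fin 2) R) = 1 := rfl
    simp [this]
  | step α i h =>
    obtain ⟨g, hg, h⟩ := h
    have h2 : (monomial (α + Finsupp.single i 1) 1 : MvPolynomial (Fin 2) R) =
        X i * monomial α 1 := by rw [X, monomial_mul, one_mul, add_comm]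
    have h3 : C (a ^ 2 + b ^ 2) * (X i : MvPolynomial (Fin 2) R) =
        C ((![-b, a] : Fin 2 → R) i) * linForm (-b) a +
          C ((![a, b] : Fin 2 → R) i) * linForm a b := by
      fin_cases i <;> simp [linForm] <;> ring
    have hd : (α + Finsupp.single i 1).degree = α.degree + 1 := by
      rw [map_add, Finsupp.degree_single]
    have hy : linForm (-b) a ^ α.degree ∈ ordLT R (α.degree + 1) :=
      IsHomogeneous.mem_ordLT ((isHomogeneous_linForm _ _).pow _) (by omega)
    refine ⟨C ((![a, b] : Fin 2 → R) i) * (C (eval ![-b, a] (monomial α 1)) *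
      linForm (-b) a ^ α.degree) + C (a ^ 2 + b ^ 2) * (X i * g), ?_, ?_⟩
    · rw [hd]
      refine Submodule.add_mem _ (C_mul_mem_ordLT _ (C_mul_mem_ordLT _ hy))
        (C_mul_mem_ordLT _ ?_)
      rw [add_comm]
      exact mul_mem_ordLT (X_mem_ordLT i) hg
    · rw [hd, h2, map_mul, eval_X, map_mul C, pow_succ (a ^ 2 + b ^ 2), pow_succ (linForm (-b) a),
        map_mul C]
      linear_combination (C (a ^ 2 + b ^ 2) * X i) * h + (C (eval ![-b, a] (monomial α 1)) *
        linForm (-b) a ^ α.degree) * h3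

theorem exists_division (a b : R) {n : ℕ} {σ : MvPolynomial (Fin 2) R} (hσ : σ.IsHomogeneous n) :
    ∃ g ∈ ordLT R n, C ((a ^ 2 + b ^ 2) ^ n) * σ =
      C (eval ![-b, a] σ) * linForm (-b) a ^ n + linForm a b * g := by
  choose g hg hgm using exists_division_monomial a b
  have hdeg : ∀ α ∈ σ.support, α.degree = n := fun α hα => by
    by_contra hc
    exact mem_support_iff.1 hα (hσ.coeff_eq_zero hc)
  refine ⟨∑ α ∈ σ.support, C (coeff α σ) * g α, Submodule.sum_mem _ fun α hα => ?_, ?_⟩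
  · rw [← hdeg α hα]
    exact C_mul_mem_ordLT _ (hg α)
  · have h1 : ∀ α ∈ σ.support, C ((a ^ 2 + b ^ 2) ^ n) * monomial α (coeff α σ) =
        C (eval ![-b, a] (monomial α (coeff α σ))) * linForm (-b) a ^ n +
          linForm a b * (C (coeff α σ) * g α) := by
      intro α hα
      have h2 : (monomial α (coeff α σ) : MvPolynomial (Fin 2) R) =
          C (coeff α σ) * monomial α 1 := by rw [C_mul_monomial, mul_one]
      have h3 := hgm α
      rw [hdeg α hα] at h3
      rw [h2, map_mul (eval _), eval_C, map_mul C (coeff α σ)]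
      linear_combination C (coeff α σ) * h3
    have h4 := Finset.sum_congr rfl h1
    rw [← Finset.mul_sum, ← σ.as_sum, Finset.sum_add_distrib, ← Finset.sum_mul, ← map_sum,
      ← map_sum, ← σ.as_sum, ← Finset.mul_sum] at h4
    exact h4

end Division

/-! ### Forms vanishing on the characteristic covectors -/

section RealDivision

theorem sq_add_sq_ne_zero {a b : ℝ} (h : a ≠ 0 ∨ b ≠ 0) : a ^ 2 + b ^ 2 ≠ 0 := by
  rcases h with h | h <;> positivity

theorem exists_eq_linForm_mul {a b : ℝ} (hab : a ≠ 0 ∨ b ≠ 0) {n : ℕ}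
    {σ : MvPolynomial (Fin 2) ℝ} (hσ : σ.IsHomogeneous (n + 1)) (h0 : eval ![-b, a] σ = 0) :
    ∃ g : MvPolynomial (Fin 2) ℝ, g.IsHomogeneous n ∧ σ = linForm a b * g := by
  obtain ⟨g, hg, h⟩ := exists_division a b hσ
  have hN := pow_ne_zero (n + 1) (sq_add_sq_ne_zero hab)
  rw [h0, map_zero, zero_mul, zero_add] at h
  have h1 : σ = linForm a b * (C ((a ^ 2 + b ^ 2) ^ (n + 1))⁻¹ * g) := by
    rw [mul_left_comm, ← h, ← mul_assoc, ← C_mul, inv_mul_cancel₀ hN, C_1, one_mul]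
  -- The division only bounds the degree of the quotient; its component of degree `n` is already
  -- enough, the other side being homogeneous.
  refine ⟨_, homogeneousComponent_isHomogeneous n (C ((a ^ 2 + b ^ 2) ^ (n + 1))⁻¹ * g), ?_⟩
  have h2 := homogeneousComponent_mul_of_mem (a := 1) (linForm_mem_ordLT a b)
    (C_mul_mem_ordLT ((a ^ 2 + b ^ 2) ^ (n + 1))⁻¹ hg)
  rw [← h1, add_comm 1 n, homogeneousComponent_eq_self hσ,
    homogeneousComponent_eq_self (isHomogeneous_linForm a b)] at h2
  exact h2

theorem eq_zero_of_isHomogeneous_zero {σ : MvPolynomial (Fin 2) ℝ} (hσ : σ.IsHomogeneous 0)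
    {p : Fin 2 → ℝ} (h0 : eval p σ = 0) : σ = 0 := by
  have h1 := homogeneousComponent_eq_self hσ
  rw [homogeneousComponent_zero] at h1
  rw [← h1, eval_C] at h0
  rw [← h1, h0, C_0]

/-- The product of the linear forms of three vectors. -/
def triForm (w : Fin 3 → Fin 2 → ℝ) : MvPolynomial (Fin 2) ℝ :=
  linForm (w 0 0) (w 0 1) * (linForm (w 1 0) (w 1 1) * linForm (w 2 0) (w 2 1))

/-- Pairwise linear independence of three vectors of the plane. -/
def PairIndep (w : Fin 3 → Fin 2 → ℝ) : Prop :=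
  ∀ i j, i ≠ j → w i 0 * w j 1 - w i 1 * w j 0 ≠ 0

variable {w : Fin 3 → Fin 2 → ℝ}

theorem PairIndep.ne_zero (hw : PairIndep w) (i : Fin 3) : w i 0 ≠ 0 ∨ w i 1 ≠ 0 := by
  by_contra! hc
  obtain ⟨j, hj⟩ := exists_ne i
  exact hw i j hj.symm (by rw [hc.1, hc.2]; ring)

theorem PairIndep.triForm_ne_zero (hw : PairIndep w) : triForm w ≠ 0 :=
  mul_ne_zero (linForm_ne_zero (hw.ne_zero 0))
    (mul_ne_zero (linForm_ne_zero (hw.ne_zero 1)) (linForm_ne_zero (hw.ne_zero 2)))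

theorem isHomogeneous_triForm (w : Fin 3 → Fin 2 → ℝ) : (triForm w).IsHomogeneous 3 :=
  (isHomogeneous_linForm _ _).mul ((isHomogeneous_linForm _ _).mul (isHomogeneous_linForm _ _))

theorem eval_triForm (w : Fin 3 → Fin 2 → ℝ) (i : Fin 3) :
    eval ![-w i 1, w i 0] (triForm w) = 0 := by
  fin_cases i <;> simp [triForm, linForm] <;> ring_nf <;> simp

theorem PairIndep.eval_linForm_ne_zero (hw : PairIndep w) {i j : Fin 3} (hij : i ≠ j) :
    eval ![-w i 1, w i 0] (linForm (w j 0) (w j 1)) ≠ 0 := by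
  rw [eval_linForm]
  have := hw i j hij
  simp only [Matrix.cons_val_zero, Matrix.cons_val_one]
  intro h
  apply this
  linarith

theorem PairIndep.eval_eq_zero_of_mul (hw : PairIndep w) {i j : Fin 3} (hij : i ≠ j)
    {g : MvPolynomial (Fin 2) ℝ}
    (h : eval ![-w i 1, w i 0] (linForm (w j 0) (w j 1) * g) = 0) :
    eval ![-w i 1, w i 0] g = 0 := by
  rw [map_mul] at h
  exact (mul_eq_zero.1 h).resolve_left (hw.eval_linForm_ne_zero hij)

/-- The linear factors are split off one at a time. By pairwise independence a factor already
removed does not vanish at the remaining covectors, so the quotient still does. -/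
theorem PairIndep.exists_eq_triForm_mul (hw : PairIndep w) {n : ℕ} {σ : MvPolynomial (Fin 2) ℝ}
    (hσ : σ.IsHomogeneous (n + 3)) (h0 : ∀ i, eval ![-w i 1, w i 0] σ = 0) :
    ∃ g : MvPolynomial (Fin 2) ℝ, g.IsHomogeneous n ∧ σ = triForm w * g := by
  obtain ⟨g, hg, rfl⟩ := exists_eq_linForm_mul (hw.ne_zero 0) (n := n + 2) hσ (h0 0)
  have h1 := fun i hi => hw.eval_eq_zero_of_mul (i := i) hi (h0 i)
  obtain ⟨g, hg', rfl⟩ := exists_eq_linForm_mul (hw.ne_zero 1) (n := n + 1) hg (h1 1 (by decide))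
  have h2 := hw.eval_eq_zero_of_mul (i := 2) (by decide) (h1 2 (by decide))
  obtain ⟨g, hg'', rfl⟩ := exists_eq_linForm_mul (hw.ne_zero 2) (n := n) hg' h2
  exact ⟨g, hg'', by rw [triForm]; ring⟩

/-- A nonzero binary form of degree less than three cannot vanish in three different directions. -/
theorem PairIndep.eq_zero_of_lt (hw : PairIndep w) {n : ℕ} (hn : n < 3)
    {σ : MvPolynomial (Fin 2) ℝ}
    (hσ : σ.IsHomogeneous n) (h0 : ∀ i, eval ![-w i 1, w i 0] σ = 0) : σ = 0 := by
  rcases n with _ | n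
  · exact eq_zero_of_isHomogeneous_zero hσ (h0 0)
  obtain ⟨g, hg, rfl⟩ := exists_eq_linForm_mul (hw.ne_zero 0) (n := n) hσ (h0 0)
  have h1 := fun i hi => hw.eval_eq_zero_of_mul (i := i) hi (h0 i)
  rcases n with _ | n
  · rw [eq_zero_of_isHomogeneous_zero hg (h1 1 (by decide)), mul_zero]
  obtain ⟨g, hg', rfl⟩ := exists_eq_linForm_mul (hw.ne_zero 1) (n := n) hg (h1 1 (by decide))
  have h2 := hw.eval_eq_zero_of_mul (i := 2) (by decide) (h1 2 (by decide))
  obtain rfl : n = 0 := by omega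
  rw [eq_zero_of_isHomogeneous_zero hg' h2, mul_zero, mul_zero]

/-- The multiples of `triForm w` of degree `n + 3`. -/
def triMul (w : Fin 3 → Fin 2 → ℝ) (n : ℕ) : Submodule ℝ (MvPolynomial (Fin 2) ℝ) :=
  (homogeneousSubmodule (Fin 2) ℝ n).map (LinearMap.mulLeft ℝ (triForm w))

theorem finrank_map_of_injective {V W : Type*} [AddCommGroup V] [Module ℝ V] [AddCommGroup W]
    [Module ℝ W] {f : V →ₗ[ℝ] W} (hf : Function.Injective f) (E : Submodule ℝ V) :
    Module.finrank ℝ (E.map f) = Module.finrank ℝ E :=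
  (Submodule.equivMapOfInjective f hf E).finrank_eq.symm

theorem finrank_map_mulLeft {f : MvPolynomial (Fin 2) ℝ} (hf : f ≠ 0)
    (E : Submodule ℝ (MvPolynomial (Fin 2) ℝ)) :
    Module.finrank ℝ (E.map (LinearMap.mulLeft ℝ f)) = Module.finrank ℝ E :=
  finrank_map_of_injective (fun _ _ h => mul_left_cancel₀ hf h) E

theorem PairIndep.finrank_triMul (hw : PairIndep w) (n : ℕ) :
    Module.finrank ℝ (triMul w n) = n + 1 := by
  rw [triMul, finrank_map_mulLeft hw.triForm_ne_zero, finrank_homogeneousSubmodule]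

end RealDivision

/-! ## Systems of class three: symbols -/

section ClassThree

variable {U : Opens (ℝ × ℝ)}

/-- The values at `q` of vector fields. -/
def vecAt {ι : Type*} (v : ι → Fin 2 → Smooth U) (q : U) : ι → Fin 2 → ℝ :=
  fun i j => evalAt q (v i j)

/-- The parts of the definition of class three that do not refer to generators. -/
structure ThreeChar (I : Submodule (Smooth U) (Op U)) (h : ℕ → ℕ)
    (v : Fin 3 → Fin 2 → Smooth U) : Prop where
  regular : IsRegular (I : Set (Op U)) h
  hasClass : HasClass h 3
  indep : ∀ q, PairIndep (vecAt v q)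
  char : ∀ i, IsCharacteristic (I : Set (Op U)) (v i)

theorem IsClassThree.threeChar {r : ℕ} {F : Fin r → Op U} {h : ℕ → ℕ}
    {v : Fin 3 → Fin 2 → Smooth U} (hF : IsClassThree F h v) : ThreeChar (systemMod F) h v :=
  ⟨hF.regular, hF.hasClass, fun q i j hij => hF.independent i j hij q, hF.characteristic⟩

variable {I : Submodule (Smooth U) (Op U)} {h : ℕ → ℕ} {v : Fin 3 → Fin 2 → Smooth U}

theorem ThreeChar.symbolSpace_le (hI : ThreeChar I h v) (n : ℕ) (q : U) :
    symbolSpace (I : Set (Op U)) (n + 3) q ≤ triMul (vecAt v q) n := by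
  intro σ hσ
  obtain ⟨g, hg, rfl⟩ := (hI.indep q).exists_eq_triForm_mul
    (PlanePDE.symbolSpace_le I (n + 3) q hσ) (fun i => hI.char i _ q σ hσ)
  exact ⟨g, hg, rfl⟩

theorem ThreeChar.symbolSpace_eq_bot (hI : ThreeChar I h v) {n : ℕ} (hn : n < 3) (q : U) :
    symbolSpace (I : Set (Op U)) n q = ⊥ := by
  refine eq_bot_iff.2 fun σ hσ => (Submodule.mem_bot ℝ).2 ?_
  exact (hI.indep q).eq_zero_of_lt hn (PlanePDE.symbolSpace_le I n q hσ)
    (fun i => hI.char i _ q σ hσ)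

/-- All symbols are multiples of the characteristic cubic, and these multiples have codimension
three. -/
theorem ThreeChar.three_le (hI : ThreeChar I h v) (n : ℕ) (q : U) : 3 ≤ h (n + 3) := by
  have h1 := hI.regular.finrank_symbolSpace (n + 3) q
  have : FiniteDimensional ℝ (triMul (vecAt v q) n) :=
    FiniteDimensional.of_finrank_pos (by rw [(hI.indep q).finrank_triMul]; omega)
  have h2 := Submodule.finrank_mono (hI.symbolSpace_le n q)
  rw [(hI.indep q).finrank_triMul] at h2
  omega

theorem ThreeChar.h_of_lt (hI : ThreeChar I h v) {n : ℕ} (hn : n < 3) (q : U) : h n = n + 1 := by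
  have h1 := hI.regular.finrank_symbolSpace n q
  rwa [hI.symbolSpace_eq_bot hn, finrank_bot, add_zero] at h1

/-- With codimension exactly three, the inclusion into the multiples of the cubic is an equality of
dimensions. -/
theorem ThreeChar.symbolSpace_eq (hI : ThreeChar I h v) {n : ℕ} (hn : h (n + 3) = 3) (q : U) :
    symbolSpace (I : Set (Op U)) (n + 3) q = triMul (vecAt v q) n := by
  have : FiniteDimensional ℝ (triMul (vecAt v q) n) :=
    FiniteDimensional.of_finrank_pos (by rw [(hI.indep q).finrank_triMul]; omega)
  refine Submodule.eq_of_le_of_finrank_le (hI.symbolSpace_le n q) ?_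
  have h1 := hI.regular.finrank_symbolSpace (n + 3) q
  rw [(hI.indep q).finrank_triMul]
  omega

/-- There are no nonzero symbols of degree less than three, so an element of order `≤ 2` loses its
leading part repeatedly until it is zero. -/
theorem ThreeChar.trunc_three (hI : ThreeChar I h v) {n : ℕ} (hn : n ≤ 3) : trunc I n = ⊥ := by
  induction n with
  | zero => exact eq_bot_iff.2 ((trunc_le_ordLT I 0).trans ordLT_zero.le)
  | succ n ih =>
    refine eq_bot_iff.2 fun P hP => ?_
    rw [← ih (by omega)]
    refine ⟨hP.1, mem_ordLT_of_homogeneousComponent hP.2 (op_ext fun q => ?_)⟩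
    have h1 : val q (homogeneousComponent n P) ∈ symbolSpace (I : Set (Op U)) n q :=
      mem_symbolSpace.2 ⟨P, hP, rfl⟩
    rw [hI.symbolSpace_eq_bot (by omega), Submodule.mem_bot] at h1
    rw [h1, map_zero]

end ClassThree

/-! ## The adapted gauge -/

section Gauge

variable {U : Opens (ℝ × ℝ)}

theorem smooth_inverse (f : Smooth U) (hf : ∀ q, evalAt q f ≠ 0) : ∃ g : Smooth U, f * g = 1 := by
  refine ⟨⟨fun q => (evalAt q f)⁻¹, ?_⟩, smooth_ext fun q => ?_⟩
  · have h : ContDiffOn ℝ ∞ (fun z => (zeroExt f.1 z)⁻¹) U := by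
      refine ContDiffOn.inv f.2 fun z hz => ?_
      rw [zeroExt_of_mem _ hz]
      exact hf ⟨z, hz⟩
    refine h.congr fun z hz => ?_
    rw [zeroExt_of_mem _ hz, zeroExt_of_mem _ hz, evalAt_apply]
  · rw [map_mul, map_one]
    exact mul_inv_cancel₀ (hf q)

/-- The value of the component of degree `k` on the covector annihilating `v`. -/
def top (v : Fin 2 → Smooth U) (k : ℕ) (P : Op U) : Smooth U :=
  eval ![-v 1, v 0] (homogeneousComponent k P)

theorem evalAt_top (v : Fin 2 → Smooth U) (k : ℕ) (P : Op U) (q : U) :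
    evalAt q (top v k P) =
      eval ![-evalAt q (v 1), evalAt q (v 0)] (homogeneousComponent k (val q P)) := by
  rw [top, ← map_homogeneousComponent, eval_map, eval, coe_eval₂Hom, eval₂_comp_left,
    RingHomCompTriple.comp_eq]
  congr 1
  funext i
  fin_cases i <;> simp

variable {v : Fin 2 → Smooth U}

theorem top_add (k : ℕ) (P Q : Op U) : top v k (P + Q) = top v k P + top v k Q := by
  simp only [top, map_add]

theorem top_sub (k : ℕ) (P Q : Op U) : top v k (P - Q) = top v k P - top v k Q := by
  simp only [top, map_sub]

theorem top_smul (k : ℕ) (c : Smooth U) (P : Op U) : top v k (c • P) = c * top v k P := by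
  rw [top, map_smul, smul_eq_C_mul, map_mul, eval_C, top]

theorem top_of_mem {k n : ℕ} {P : Op U} (hP : P ∈ ordLT (Smooth U) n) (h : n ≤ k) :
    top v k P = 0 := by
  rw [top, homogeneousComponent_eq_zero_of_mem hP h, map_zero]

theorem top_comp {a b : ℕ} {P Q : Op U} (hP : P ∈ ordLT (Smooth U) (a + 1))
    (hQ : Q ∈ ordLT (Smooth U) (b + 1)) :
    top v (a + b) (Op.comp P Q) = top v a P * top v b Q := by
  rw [top, homogeneousComponent_comp hP hQ, map_mul, top, top]

theorem firstOrder_eq (v : Fin 2 → Smooth U) (a : Smooth U) :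
    firstOrder v a = linForm (v 0) (v 1) + C a := rfl

theorem firstOrder_mem_ordLT (v : Fin 2 → Smooth U) (a : Smooth U) :
    firstOrder v a ∈ ordLT (Smooth U) 2 :=
  Submodule.add_mem _ (linForm_mem_ordLT _ _) (ordLT_mono (by norm_num) (C_mem_ordLT a))

theorem homogeneousComponent_firstOrder (v : Fin 2 → Smooth U) (a : Smooth U) :
    homogeneousComponent 1 (firstOrder v a) = linForm (v 0) (v 1) := by
  rw [firstOrder_eq, map_add, homogeneousComponent_eq_zero_of_mem (C_mem_ordLT a) le_rfl, add_zero,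
    homogeneousComponent_eq_self (isHomogeneous_linForm _ _)]

theorem firstOrder_eq_add (v : Fin 2 → Smooth U) (a : Smooth U) :
    firstOrder v a = firstOrder v 0 + C a := by
  rw [firstOrder_eq, firstOrder_eq, C_0, add_zero]

theorem top_firstOrder (a : Smooth U) : top v 1 (firstOrder v a) = 0 := by
  rw [top, homogeneousComponent_firstOrder, eval_linForm]
  simp
  ring

theorem val_homogeneousComponent_firstOrder_ne_zero (hv : ∀ q, evalAt q (v 0) ≠ 0 ∨ evalAt q (v 1) ≠ 0)
    (a : Smooth U) (q : U) : val q (homogeneousComponent 1 (firstOrder v a)) ≠ 0 := by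
  rw [homogeneousComponent_firstOrder, map_linForm]
  exact linForm_ne_zero (hv q)

/-- An operator whose leading part vanishes on the covector annihilating `v` is divisible by `v + a` up
to lower order. -/
theorem exists_sub_comp_mem (hv : ∀ q, evalAt q (v 0) ≠ 0 ∨ evalAt q (v 1) ≠ 0) (a : Smooth U) {m : ℕ}
    {P : Op U} (hP : P ∈ ordLT (Smooth U) (m + 1)) (h0 : top v m P = 0) :
    ∃ Q ∈ ordLT (Smooth U) m, P - Op.comp Q (firstOrder v a) ∈ ordLT (Smooth U) m := by
  obtain ⟨g, hg, h⟩ := exists_division (v 0) (v 1) (homogeneousComponent_isHomogeneous m P)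
  obtain ⟨c, hc⟩ := smooth_inverse ((v 0 ^ 2 + v 1 ^ 2) ^ m) fun q => by
    rw [map_pow, map_add, map_pow, map_pow]
    exact pow_ne_zero _ (sq_add_sq_ne_zero (hv q))
  have h1 : homogeneousComponent m P = (c • g) * linForm (v 0) (v 1) := by
    have h2 : eval ![-v 1, v 0] (homogeneousComponent m P) = 0 := h0
    rw [h2, C_0, zero_mul, zero_add] at h
    have h3 := congrArg (fun x => C c * x) h
    simp only [← mul_assoc, ← C_mul] at h3
    rw [mul_comm c, hc, C_1, one_mul] at h3
    rw [h3, smul_eq_C_mul]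
    ring
  have hg' : c • g ∈ ordLT (Smooth U) m := Submodule.smul_mem _ _ hg
  refine ⟨c • g, hg', ?_⟩
  cases m with
  | zero =>
    rw [ordLT_zero, Submodule.mem_bot] at hg'
    rw [hg', zero_comp, sub_zero]
    rw [hg', zero_mul] at h1
    exact mem_ordLT_of_homogeneousComponent hP h1
  | succ k =>
    have hL := firstOrder_mem_ordLT v a
    have hgL : Op.comp (c • g) (firstOrder v a) ∈ ordLT (Smooth U) (k + 1 + 1) :=
      comp_mem_ordLT (a := k) (b := 2) hg' hL
    refine mem_ordLT_of_homogeneousComponent (Submodule.sub_mem _ hP hgL) ?_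
    have h4 := homogeneousComponent_mul_of_mem hg' (linForm_mem_ordLT (v 0) (v 1))
    rw [← h1, homogeneousComponent_eq_self (homogeneousComponent_isHomogeneous _ P),
      homogeneousComponent_eq_self (isHomogeneous_linForm _ _)] at h4
    rw [map_sub, homogeneousComponent_comp hg' hL, homogeneousComponent_firstOrder, h4, sub_self]

/-- The leading coefficients `t` and `b` in the division `P = Q ∘ v + R` of an operator of order
`≤ m + 1`. -/
def Rem (v : Fin 2 → Smooth U) (m : ℕ) (P : Op U) (t b : Smooth U) : Prop :=
  ∃ Q ∈ ordLT (Smooth U) (m + 1), P - Op.comp Q (firstOrder v 0) ∈ ordLT (Smooth U) (m + 1) ∧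
    t = top v m Q ∧ b = top v m (P - Op.comp Q (firstOrder v 0))

theorem top_comp_firstOrder {m : ℕ} {Q : Op U} (hQ : Q ∈ ordLT (Smooth U) m) (a : Smooth U) :
    top v m (Op.comp Q (firstOrder v a)) = 0 := by
  cases m with
  | zero =>
    rw [ordLT_zero, Submodule.mem_bot] at hQ
    rw [hQ, zero_comp]
    exact top_of_mem (Submodule.zero_mem _) le_rfl
  | succ k => rw [top_comp hQ (firstOrder_mem_ordLT v a), top_firstOrder, mul_zero]

/-- If `(Q - Q') ∘ X` has order `≤ m` then `Q - Q'` has order `< m`. So the leading values of `Q`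
and `Q'` agree, and the remainders differ by a right multiple of `X`, whose symbol of order `m`
vanishes on the covector. -/
theorem Rem.unique (hv : ∀ q, evalAt q (v 0) ≠ 0 ∨ evalAt q (v 1) ≠ 0) {m : ℕ} {P : Op U}
    {t b t' b' : Smooth U} (h : Rem v m P t b) (h' : Rem v m P t' b') : t = t' ∧ b = b' := by
  obtain ⟨Q, hQ, hR, rfl, rfl⟩ := h
  obtain ⟨Q', hQ', hR', rfl, rfl⟩ := h'
  have h1 : Op.comp (Q - Q') (firstOrder v 0) ∈ ordLT (Smooth U) (m + 1) := by
    have h2 := Submodule.sub_mem _ hR' hR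
    rw [sub_comp]
    convert h2 using 1
    abel
  have h2 : Q - Q' ∈ ordLT (Smooth U) m := mem_ordLT_of_comp (firstOrder_mem_ordLT v 0)
    (val_homogeneousComponent_firstOrder_ne_zero hv 0) h1
  have h3 := top_comp_firstOrder (v := v) h2 0
  have h4 := top_of_mem (v := v) h2 le_rfl
  rw [top_sub, sub_eq_zero] at h4
  rw [sub_comp, top_sub, sub_eq_zero] at h3
  exact ⟨h4, by rw [top_sub, top_sub, h3]⟩

theorem exists_rem (hv : ∀ q, evalAt q (v 0) ≠ 0 ∨ evalAt q (v 1) ≠ 0) {m : ℕ} {P : Op U}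
    (hP : P ∈ ordLT (Smooth U) (m + 2)) (h0 : top v (m + 1) P = 0) : ∃ t b, Rem v m P t b := by
  obtain ⟨Q, hQ, hR⟩ := exists_sub_comp_mem hv 0 hP h0
  exact ⟨_, _, Q, hQ, hR, rfl, rfl⟩

theorem Rem.smul_sub_smul {m : ℕ} {P P' : Op U} {t b t' b' : Smooth U} (h : Rem v m P t b)
    (h' : Rem v m P' t' b') (c c' : Smooth U) :
    Rem v m (c • P - c' • P') (c * t - c' * t') (c * b - c' * b') := by
  obtain ⟨Q, hQ, hR, rfl, rfl⟩ := h
  obtain ⟨Q', hQ', hR', rfl, rfl⟩ := h'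
  have h1 : c • P - c' • P' - Op.comp (c • Q - c' • Q') (firstOrder v 0) =
      c • (P - Op.comp Q (firstOrder v 0)) - c' • (P' - Op.comp Q' (firstOrder v 0)) := by
    rw [sub_comp, smul_comp, smul_comp, smul_sub, smul_sub]
    abel
  refine ⟨c • Q - c' • Q', Submodule.sub_mem _ (Submodule.smul_mem _ _ hQ)
    (Submodule.smul_mem _ _ hQ'), ?_, ?_, ?_⟩
  · rw [h1]
    exact Submodule.sub_mem _ (Submodule.smul_mem _ _ hR) (Submodule.smul_mem _ _ hR')
  · rw [top_sub, top_smul, top_smul]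
  · rw [h1, top_sub m (c • _), top_smul, top_smul]

/-- The operator `v₀ ∂₁ - v₁ ∂₀`, complementary to `v`. -/
def rotated (v : Fin 2 → Smooth U) : Op U := firstOrder ![-v 1, v 0] 0

theorem top_rotated : top v 1 (rotated v) = v 0 ^ 2 + v 1 ^ 2 := by
  rw [top, rotated, homogeneousComponent_firstOrder, eval_linForm]
  simp
  ring

/-- Left composition with the complementary field multiplies `t` and `b` by the same nowhere
vanishing function when `v ≠ 0`. The ratio is unchanged, so elements of different orders can be
compared. -/
theorem Rem.raise {m : ℕ} {P : Op U} {t b : Smooth U} (h : Rem v m P t b) :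
    Rem v (m + 1) (Op.comp (rotated v) P) ((v 0 ^ 2 + v 1 ^ 2) * t) ((v 0 ^ 2 + v 1 ^ 2) * b) := by
  obtain ⟨Q, hQ, hR, rfl, rfl⟩ := h
  have hY : rotated v ∈ ordLT (Smooth U) (1 + 1) := firstOrder_mem_ordLT _ _
  have h1 : Op.comp (rotated v) P - Op.comp (Op.comp (rotated v) Q) (firstOrder v 0) =
      Op.comp (rotated v) (P - Op.comp Q (firstOrder v 0)) := by rw [comp_assoc, comp_sub]
  refine ⟨Op.comp (rotated v) Q, ?_, ?_, ?_, ?_⟩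
  · have := comp_mem_ordLT hY hQ
    rwa [add_comm 1] at this
  · rw [h1]
    have := comp_mem_ordLT hY hR
    rwa [add_comm 1] at this
  · rw [add_comm m 1, top_comp hY hQ, top_rotated]
  · rw [h1, add_comm m 1, top_comp hY hR, top_rotated]

theorem Rem.exists_raise {I : Submodule (Smooth U) (Op U)} (hI : IsLeft I) {m : ℕ} {P : Op U}
    (hP : P ∈ trunc I (m + 2)) {t b : Smooth U} (h : Rem v m P t b) (j : ℕ) :
    ∃ P' ∈ trunc I (m + j + 2),
      Rem v (m + j) P' ((v 0 ^ 2 + v 1 ^ 2) ^ j * t) ((v 0 ^ 2 + v 1 ^ 2) ^ j * b) := by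
  induction j with
  | zero => exact ⟨P, hP, by simpa using h⟩
  | succ j ih =>
    obtain ⟨P', hP', h'⟩ := ih
    refine ⟨Op.comp (rotated v) P', ⟨hI.comp_mem _ hP'.1, ?_⟩, ?_⟩
    rotate_left
    · have h2 := h'.raise
      rw [← mul_assoc, ← mul_assoc, ← pow_succ'] at h2
      exact h2
    · have := comp_mem_ordLT (a := 1) (firstOrder_mem_ordLT ![-v 1, v 0] 0) hP'.2
      refine ordLT_mono ?_ this
      omega

/-- An operator lies in `D_{m-1} ∘ (v + a) + D_{m-2}` if and only if `b = t a`. -/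
theorem Rem.adapted_iff (hv : ∀ q, evalAt q (v 0) ≠ 0 ∨ evalAt q (v 1) ≠ 0) {m : ℕ} {P : Op U}
    {t b : Smooth U} (h : Rem v m P t b) (a : Smooth U) :
    (∃ Q ∈ ordLT (Smooth U) (m + 1), P - Op.comp Q (firstOrder v a) ∈ ordLT (Smooth U) m) ↔
      b = t * a := by
  have hsplit : ∀ Q : Op U, Op.comp Q (firstOrder v a) =
      Op.comp Q (firstOrder v 0) + Op.comp Q (C a) := fun Q => by
    rw [firstOrder_eq_add, comp_add]
  -- Passing from `v` to `v + a` subtracts `Q ∘ a` from the remainder. Its leading value is `t a`,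
  -- so the coefficient that has to disappear is `b - t a`.
  have hCa : ∀ Q ∈ ordLT (Smooth U) (m + 1), Op.comp Q (C a) ∈ ordLT (Smooth U) (m + 1) ∧
      top v m (Op.comp Q (C a)) = top v m Q * a := fun Q hQ => by
    refine ⟨comp_mem_ordLT hQ (C_mem_ordLT a), ?_⟩
    have := top_comp (v := v) (b := 0) hQ (C_mem_ordLT a)
    rw [add_zero] at this
    rw [this, top, top, homogeneousComponent_zero, coeff_C, if_pos rfl, eval_C]
  constructor
  · rintro ⟨Q, hQ, hR⟩
    have h1 : P - Op.comp Q (firstOrder v 0) =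
        (P - Op.comp Q (firstOrder v a)) + Op.comp Q (C a) := by rw [hsplit]; abel
    have h2 : Rem v m P (top v m Q) (top v m Q * a) := by
      refine ⟨Q, hQ, ?_, rfl, ?_⟩
      · rw [h1]
        exact Submodule.add_mem _ (ordLT_mono (Nat.le_succ m) hR) (hCa Q hQ).1
      · rw [h1, top_add, (hCa Q hQ).2, top_of_mem hR le_rfl, zero_add]
    obtain ⟨h3, h4⟩ := h.unique hv h2
    rw [h3, h4]
  · intro hb
    obtain ⟨Q, hQ, hR, ht, hb'⟩ := h
    have h1 : P - Op.comp Q (firstOrder v a) =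
        (P - Op.comp Q (firstOrder v 0)) - Op.comp Q (C a) := by rw [hsplit]; abel
    obtain ⟨Q', hQ', hR'⟩ := exists_sub_comp_mem hv a (P := P - Op.comp Q (firstOrder v a))
      (by rw [h1]; exact Submodule.sub_mem _ hR (hCa Q hQ).1)
      (by rw [h1, top_sub, (hCa Q hQ).2, ← hb', hb, ht, sub_self])
    refine ⟨Q + Q', Submodule.add_mem _ hQ (ordLT_mono (Nat.le_succ m) hQ'), ?_⟩
    rwa [add_comp, ← sub_sub]

theorem isAdapted_iff {I : Submodule (Smooth U) (Op U)} {L : Op U} :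
    IsAdapted (I : Set (Op U)) L ↔ ∀ k, ∀ P ∈ trunc I (k + 3),
      ∃ Q ∈ ordLT (Smooth U) (k + 2), P - Op.comp Q L ∈ ordLT (Smooth U) (k + 1) := by
  refine forall_congr' fun k => ⟨fun h P hP => ?_, fun h P hP hk => ?_⟩
  · obtain ⟨Q, R, hQ, hR, hPQ⟩ := h P hP.1 (totalDegree_le_iff.2 hP.2)
    refine ⟨Q, totalDegree_le_iff.1 hQ, ?_⟩
    rw [hPQ, add_sub_cancel_left]
    exact totalDegree_le_iff.1 hR
  · obtain ⟨Q, hQ, hR⟩ := h P ⟨hP, totalDegree_le_iff.1 hk⟩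
    exact ⟨Q, _, totalDegree_le_iff.2 hQ, totalDegree_le_iff.2 hR, (add_sub_cancel _ _).symm⟩

end Gauge

/-! ### Existence and uniqueness of the adapted gauge -/

section GaugeExistence

variable {U : Opens (ℝ × ℝ)} {I : Submodule (Smooth U) (Op U)} {h : ℕ → ℕ}

/-- Up to a local factor, an operator whose symbol lies pointwise in the symbol spaces of a regular
system has the symbol of an element of the system. -/
theorem IsRegular.exists_smul_homogeneousComponent (hI : IsRegular (I : Set (Op U)) h) {k : ℕ}
    (N : Op U)
    (hN : ∀ z, val z (homogeneousComponent k N) ∈ symbolSpace (I : Set (Op U)) k z) (q : U) :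
    ∃ (δ : Smooth U), ∃ P ∈ trunc I (k + 1), evalAt q δ ≠ 0 ∧
      homogeneousComponent k P = δ • homogeneousComponent k N := by
  set A : Submodule (Smooth U) (Op U) := (trunc I (k + 1)).map (homogeneousComponent k) with hA
  -- Adjoining the symbol of `N` does not enlarge any symbol space, so the constant rank argument
  -- applies to `M` and expresses that symbol through `A` near `q`.
  set M : Submodule (Smooth U) (Op U) :=
    A ⊔ Submodule.span (Smooth U) {homogeneousComponent k N} with hM
  have hM1 : M ≤ ordLT (Smooth U) (k + 1) := by
    refine sup_le (map_homogeneousComponent_trunc_le I k) (Submodule.span_le.2 ?_)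
    rintro _ rfl
    exact IsHomogeneous.mem_ordLT (homogeneousComponent_isHomogeneous k N) (Nat.lt_succ_self _)
  have hM2 : ∀ z, fiber M z ≤ symbolSpace (I : Set (Op U)) k z := by
    intro z
    rw [hM, fiber_sup, fiber_map_homogeneousComponent]
    refine sup_le le_rfl ?_
    rintro _ ⟨P, hP, rfl⟩
    obtain ⟨c, rfl⟩ := Submodule.mem_span_singleton.1 hP
    rw [val_smul]
    exact Submodule.smul_mem _ _ (hN z)
  obtain ⟨t, s, g, δ, hs, hδ, hsum, -⟩ := exists_smul_eq_sum (A := A) (M := M) (q := q)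
    (P := homogeneousComponent k N) le_sup_left hM1 (Filter.Eventually.of_forall fun z => by
      rw [fiber_map_homogeneousComponent]
      have h1 := Submodule.finrank_mono (hM2 z)
      have h2 := hI.finrank_symbolSpace k z
      have h3 := hI.finrank_symbolSpace k q
      omega) (Submodule.mem_sup_right (Submodule.mem_span_singleton_self _))
  have h4 : δ • homogeneousComponent k N ∈ A := by
    rw [hsum]
    exact Submodule.sum_mem _ fun i _ => Submodule.smul_mem _ _ (hs i)
  obtain ⟨P, hP, hPN⟩ := h4
  exact ⟨δ, P, hP, hδ, hPN⟩

variable {v : Fin 3 → Fin 2 → Smooth U}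

theorem ThreeChar.vec_ne_zero (hI : ThreeChar I h v) (i : Fin 3) (q : U) :
    evalAt q (v i 0) ≠ 0 ∨ evalAt q (v i 1) ≠ 0 := (hI.indep q).ne_zero i

theorem ThreeChar.top_eq_zero (hI : ThreeChar I h v) (i : Fin 3) {k : ℕ} {P : Op U}
    (hP : P ∈ trunc I (k + 1)) : top (v i) k P = 0 := by
  refine smooth_ext fun q => ?_
  rw [evalAt_top, map_zero, ← map_homogeneousComponent]
  exact hI.char i k q _ (mem_symbolSpace.2 ⟨P, hP, rfl⟩)

theorem ThreeChar.exists_rem (hI : ThreeChar I h v) (i : Fin 3) {m : ℕ} {P : Op U}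
    (hP : P ∈ trunc I (m + 2)) : ∃ t b, Rem (v i) m P t b :=
  PlanePDE.exists_rem (hI.vec_ne_zero i) hP.2 (hI.top_eq_zero i hP)

theorem linForm_dvd_triForm (w : Fin 3 → Fin 2 → ℝ) (hw : PairIndep w) (i : Fin 3) :
    ∃ f, triForm w = linForm (w i 0) (w i 1) * f ∧ eval ![-w i 1, w i 0] f ≠ 0 ∧
      f.IsHomogeneous 2 := by
  have hp : ∀ j k, j ≠ i → k ≠ i → eval ![-w i 1, w i 0]
      (linForm (w j 0) (w j 1) * linForm (w k 0) (w k 1)) ≠ 0 := fun j k hj hk => by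
    rw [map_mul]
    exact mul_ne_zero (hw.eval_linForm_ne_zero hj.symm) (hw.eval_linForm_ne_zero hk.symm)
  have hm : ∀ j k, (linForm (w j 0) (w j 1) * linForm (w k 0) (w k 1)).IsHomogeneous 2 :=
    fun j k => (isHomogeneous_linForm _ _).mul (isHomogeneous_linForm _ _)
  fin_cases i
  · exact ⟨_, rfl, hp 1 2 (by decide) (by decide), hm 1 2⟩
  · exact ⟨_, by rw [triForm]; exact mul_left_comm _ _ _, hp 0 2 (by decide) (by decide), hm 0 2⟩
  · exact ⟨_, by rw [triForm, ← mul_assoc, mul_comm]; rfl, hp 0 1 (by decide) (by decide), hm 0 1⟩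

theorem homogeneousComponent_eq_of_sub_mem {k : ℕ} {P Q : Op U}
    (hPQ : P - Q ∈ ordLT (Smooth U) k) : homogeneousComponent k P = homogeneousComponent k Q := by
  have := homogeneousComponent_eq_zero_of_mem hPQ le_rfl
  rwa [map_sub, sub_eq_zero] at this

/-- In an order where every multiple of the cubic is a symbol, take the cubic times a power of the
form complementary to the `i`-th one. After division by the `i`-th form no factor vanishes on its
covector, because the characteristics are distinct. -/
theorem ThreeChar.exists_rem_ne_zero (hI : ThreeChar I h v) (i : Fin 3) (q : U) :
    ∃ k, ∃ P ∈ trunc I (k + 3), ∃ t b, Rem (v i) (k + 1) P t b ∧ evalAt q t ≠ 0 := by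
  obtain ⟨n, hn⟩ := eventually_atTop.1 hI.hasClass
  have hn3 := hn (n + 3) (by omega)
  obtain ⟨f, hf, hf0, -⟩ := linForm_dvd_triForm (vecAt v q) (hI.indep q) i
  set y := linForm (-vecAt v q i 1) (vecAt v q i 0) with hy
  have hσ : triForm (vecAt v q) * y ^ n ∈ symbolSpace (I : Set (Op U)) (n + 3) q := by
    rw [hI.symbolSpace_eq hn3]
    refine ⟨y ^ n, ?_, rfl⟩
    have := (isHomogeneous_linForm (-vecAt v q i 1) (vecAt v q i 0)).pow n
    rwa [one_mul] at this
  obtain ⟨P, hP, hPσ⟩ := mem_symbolSpace.1 hσ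
  obtain ⟨t, b, hR⟩ := hI.exists_rem i (m := n + 2) hP
  refine ⟨n + 1, P, hP, t, b, hR, ?_⟩
  obtain ⟨Q, hQ, hQR, rfl, -⟩ := hR
  have h1 := homogeneousComponent_eq_of_sub_mem hQR
  have h2 := homogeneousComponent_comp hQ (firstOrder_mem_ordLT (v i) 0)
  rw [homogeneousComponent_firstOrder] at h2
  have h2' : homogeneousComponent (n + 3) (Op.comp Q (firstOrder (v i) 0)) = _ := h2
  have h1' : homogeneousComponent (n + 3) P = _ := h1
  rw [h1', h2', map_mul, map_linForm, hf, mul_comm, mul_assoc] at hPσ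
  have h3 := mul_left_cancel₀ (linForm_ne_zero ((hI.indep q).ne_zero i)) hPσ
  rw [evalAt_top, ← map_homogeneousComponent]
  change eval ![-vecAt v q i 1, vecAt v q i 0] (val q (homogeneousComponent (n + 2) Q)) ≠ 0
  rw [h3, map_mul, map_pow, hy, eval_linForm]
  refine mul_ne_zero hf0 (pow_ne_zero _ ?_)
  have := sq_add_sq_ne_zero ((hI.indep q).ne_zero i)
  simp only [Matrix.cons_val_zero, Matrix.cons_val_one]
  intro h0
  apply this
  linarith

/-- If the leading coefficient `t` vanishes then so does `b`. -/
theorem ThreeChar.rem_eq_zero (hI : ThreeChar I h v) (hl : IsLeft I) (i : Fin 3) {k : ℕ}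
    (hk : h (k + 3) = 3) {P : Op U} (hP : P ∈ trunc I (k + 5)) {b : Smooth U}
    (hR : Rem (v i) (k + 3) P 0 b) : b = 0 := by
  obtain ⟨Q, hQ, hQR, hQ0, rfl⟩ := hR
  set X := firstOrder (v i) 0 with hX
  have hX1 : X ∈ ordLT (Smooth U) (1 + 1) := firstOrder_mem_ordLT _ _
  have hXc : homogeneousComponent 1 X = linForm (v i 0) (v i 1) := homogeneousComponent_firstOrder _ _
  -- As `t = 0`, the quotient `Q` is again divisible by `X` up to lower order, and the symbol of `P`
  -- contains the square of the characteristic form `l`.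
  obtain ⟨G, hG, hGQ⟩ := exists_sub_comp_mem (hI.vec_ne_zero i) 0 hQ hQ0.symm
  have hGX : Op.comp G X ∈ ordLT (Smooth U) (k + 2 + 2) := comp_mem_ordLT hG hX1
  have hQX : homogeneousComponent (k + 3) Q = homogeneousComponent (k + 3) (Op.comp G X) :=
    homogeneousComponent_eq_of_sub_mem hGQ
  have hPc : homogeneousComponent (k + 4) P =
      homogeneousComponent (k + 3) (Op.comp G X) * linForm (v i 0) (v i 1) := by
    have h1 := homogeneousComponent_eq_of_sub_mem hQR
    have h2 : homogeneousComponent (k + 3 + 1) (Op.comp Q X) = _ := homogeneousComponent_comp hQ hX1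
    rw [h1, h2, hQX, hXc]
  have hGc : homogeneousComponent (k + 3) (Op.comp G X) =
      homogeneousComponent (k + 2) G * linForm (v i 0) (v i 1) := by
    have h2 : homogeneousComponent (k + 2 + 1) (Op.comp G X) = _ := homogeneousComponent_comp hG hX1
    rw [h2, hXc]
  -- The symbol of `P` is the cubic times some `u`. The other two factors of the cubic do not vanish
  -- on the line `l = 0`, so `l` divides `u`; hence the symbol of `G ∘ X` is the cubic times `u /
  -- l`, which is a symbol of `I` in order `k + 3` because `h (k + 3) = 3`.
  have hmem : ∀ z, val z (homogeneousComponent (k + 3) (Op.comp G X)) ∈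
      symbolSpace (I : Set (Op U)) (k + 3) z := by
    intro z
    have h1 : val z (homogeneousComponent (k + 4) P) ∈ triMul (vecAt v z) (k + 1) :=
      hI.symbolSpace_le (k + 1) z (mem_symbolSpace.2 ⟨P, hP, rfl⟩)
    rw [hI.symbolSpace_eq hk]
    obtain ⟨u, hu, hu'⟩ := h1
    obtain ⟨f, hf, hf0, -⟩ := linForm_dvd_triForm (vecAt v z) (hI.indep z) i
    have hl0 := linForm_ne_zero ((hI.indep z).ne_zero i)
    rw [LinearMap.mulLeft_apply, hf, hPc, hGc, map_mul, map_mul, map_linForm, mul_comm _ (linForm _ _),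
      mul_assoc] at hu'
    have h2 := mul_left_cancel₀ hl0 hu'
    have h3 : eval ![-vecAt v z i 1, vecAt v z i 0] u = 0 := by
      have h4 := congrArg (eval ![-vecAt v z i 1, vecAt v z i 0]) h2
      rw [map_mul, map_mul _ (val z _), eval_linForm] at h4
      have h5 : eval ![-vecAt v z i 1, vecAt v z i 0] f *
          eval ![-vecAt v z i 1, vecAt v z i 0] u = 0 := by
        rw [h4]
        simp only [vecAt, Matrix.cons_val_zero, Matrix.cons_val_one]
        ring
      exact (mul_eq_zero.1 h5).resolve_left hf0
    obtain ⟨g, hg, rfl⟩ := exists_eq_linForm_mul ((hI.indep z).ne_zero i) hu h3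
    refine ⟨g, hg, ?_⟩
    rw [LinearMap.mulLeft_apply, hGc, map_mul, map_linForm]
    rw [mul_left_comm, mul_comm (val z _)] at h2
    have h6 := mul_left_cancel₀ hl0 h2
    rw [hf, mul_assoc, h6, mul_comm]
    rfl
  refine smooth_ext fun q => ?_
  obtain ⟨δ, P₃, hP₃, hδ, hc⟩ := hI.regular.exists_smul_homogeneousComponent _ hmem q
  have hS1 : Op.comp X P₃ ∈ ordLT (Smooth U) (k + 5) :=
    ordLT_mono (by omega) (comp_mem_ordLT hX1 hP₃.2)
  -- Both terms have the same symbol of order `k + 4`, so their difference is an element of `I` of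
  -- smaller order.
  have hS : δ • P - Op.comp X P₃ ∈ trunc I (k + 4) := by
    refine ⟨Submodule.sub_mem _ (Submodule.smul_mem _ _ hP.1) (hl.comp_mem _ hP₃.1),
      mem_ordLT_of_homogeneousComponent (Submodule.sub_mem _ (Submodule.smul_mem _ _ hP.2) hS1) ?_⟩
    have h2 := homogeneousComponent_comp hX1 hP₃.2
    rw [hXc, hc, show 1 + (k + 3) = k + 4 by omega] at h2
    rw [map_sub, map_smul, h2, hPc, mul_comm, mul_smul_comm, sub_self]
  have hδG : δ • G ∈ ordLT (Smooth U) (k + 2 + 1) := Submodule.smul_mem _ _ hG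
  have hcomm : Op.comp (δ • G) X - Op.comp X (δ • G) ∈ ordLT (Smooth U) (k + 3) := by
    have h1 := comp_sub_mul_mem hδG hX1
    have h2 := comp_sub_mul_mem hX1 hδG
    rw [add_comm 1] at h2
    have h3 := Submodule.sub_mem _ h1 h2
    rw [mul_comm X, sub_sub_sub_cancel_right] at h3
    exact h3
  have hlow : P₃ - Op.comp (δ • G) X ∈ ordLT (Smooth U) (k + 3) := by
    refine mem_ordLT_of_homogeneousComponent (Submodule.sub_mem _ hP₃.2 ?_) ?_
    · rw [smul_comp]
      exact Submodule.smul_mem _ _ hGX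
    · rw [map_sub, hc, smul_comp, map_smul, sub_self]
  -- On the covector annihilating `X`, a right multiple of `X` by an operator of order `< k + 3` and
  -- a left composition with `X` have leading value zero. Only `δ (P - Q ∘ X)` survives, so `δ b` is
  -- the leading value of an element of `I`, hence zero.
  have hdec : δ • P - Op.comp X P₃ = δ • (P - Op.comp Q X) + Op.comp (δ • (Q - Op.comp G X)) X +
      Op.comp (Op.comp (δ • G) X - Op.comp X (δ • G)) X -
      Op.comp X (P₃ - Op.comp (δ • G) X) := by
    simp only [comp_sub, sub_comp, smul_comp, smul_sub, comp_assoc]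
    abel
  have h1 := hI.top_eq_zero i hS
  have h2 : top (v i) (k + 3) (Op.comp X (P₃ - Op.comp (δ • G) X)) = 0 := by
    have := top_comp (v := v i) hX1 hlow
    rw [top_firstOrder, zero_mul, add_comm 1] at this
    exact this
  rw [hdec, top_sub, top_add, top_add, top_smul, h2,
    top_comp_firstOrder (Submodule.smul_mem _ _ hGQ), top_comp_firstOrder hcomm, add_zero, add_zero,
    sub_zero] at h1
  have h3 := congrArg (evalAt q) h1
  rw [map_mul, map_zero] at h3
  rw [map_zero]
  exact (mul_eq_zero.1 h3).resolve_left hδ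

theorem ThreeChar.rem_mul_eq (hI : ThreeChar I h v) (hl : IsLeft I) (i : Fin 3) {m m' : ℕ}
    {P P' : Op U} (hP : P ∈ trunc I (m + 2)) (hP' : P' ∈ trunc I (m' + 2)) {t b t' b' : Smooth U}
    (hR : Rem (v i) m P t b) (hR' : Rem (v i) m' P' t' b') : t' * b = t * b' := by
  obtain ⟨n, hn⟩ := eventually_atTop.1 hI.hasClass
  obtain ⟨P₁, hP₁, h1⟩ := hR.exists_raise hl hP (m' + n + 3)
  obtain ⟨P₂, hP₂, h2⟩ := hR'.exists_raise hl hP' (m + n + 3)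
  rw [show m' + (m + n + 3) = m + m' + n + 3 by omega] at hP₂ h2
  rw [show m + (m' + n + 3) = m + m' + n + 3 by omega] at hP₁ h1
  set x := v i 0 ^ 2 + v i 1 ^ 2 with hx
  -- Both elements have been raised to the common index `m + m' + n + 3`, in the range where `h =
  -- 3`. These multipliers cancel the two values of `t`, and `ThreeChar.rem_eq_zero` then kills the
  -- combination of `b` and `b'`.
  have h3 := h1.smul_sub_smul h2 (x ^ (m + n + 3) * t') (x ^ (m' + n + 3) * t)
  rw [show x ^ (m + n + 3) * t' * (x ^ (m' + n + 3) * t) - x ^ (m' + n + 3) * t * (x ^ (m + n + 3) * t')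
    = 0 by ring] at h3
  have h4 := hI.rem_eq_zero hl i (k := m + m' + n) (hn _ (by omega)) (P := _) (b := _)
    (Submodule.sub_mem _ (Submodule.smul_mem _ _ hP₁) (Submodule.smul_mem _ _ hP₂)) h3
  refine smooth_ext fun q => ?_
  have h5 := congrArg (evalAt q) h4
  have hx0 : evalAt q x ≠ 0 := by
    rw [hx, map_add, map_pow, map_pow]
    exact sq_add_sq_ne_zero (hI.vec_ne_zero i q)
  simp only [map_sub, map_mul, map_pow, map_zero] at h5 ⊢
  have h6 : evalAt q x ^ (m + n + 3) * evalAt q x ^ (m' + n + 3) *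
      (evalAt q t' * evalAt q b - evalAt q t * evalAt q b') = 0 := by linear_combination h5
  exact sub_eq_zero.1 ((mul_eq_zero.1 h6).resolve_left
    (mul_ne_zero (pow_ne_zero _ hx0) (pow_ne_zero _ hx0)))

theorem ThreeChar.isAdapted_iff (hI : ThreeChar I h v) (i : Fin 3) (a : Smooth U) :
    IsAdapted (I : Set (Op U)) (firstOrder (v i) a) ↔
      ∀ k, ∀ P ∈ trunc I (k + 3), ∀ t b, Rem (v i) (k + 1) P t b → b = t * a := by
  rw [PlanePDE.isAdapted_iff]
  refine forall_congr' fun k => forall₂_congr fun P hP => ⟨fun hQ t b hR => ?_, fun hQ => ?_⟩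
  · exact (hR.adapted_iff (hI.vec_ne_zero i) a).1 hQ
  · obtain ⟨t, b, hR⟩ := hI.exists_rem i (m := k + 1) hP
    exact (hR.adapted_iff (hI.vec_ne_zero i) a).2 (hQ t b hR)

/-- Each characteristic of a system of class three has exactly one adapted gauge. -/
theorem ThreeChar.existsUnique_isAdapted (hI : ThreeChar I h v) (hl : IsLeft I) (i : Fin 3) :
    ∃! a : Smooth U, IsAdapted (I : Set (Op U)) (firstOrder (v i) a) := by
  choose k P hP t b hR ht using hI.exists_rem_ne_zero i
  have key : ∀ q z, evalAt z (t q) ≠ 0 →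
      evalAt z (b z) / evalAt z (t z) = evalAt z (b q) / evalAt z (t q) := by
    intro q z hz
    have h1 := congrArg (evalAt z) (hI.rem_mul_eq hl i (hP q) (hP z) (hR q) (hR z))
    rw [map_mul, map_mul] at h1
    rw [div_eq_div_iff (ht z) hz]
    linear_combination -h1
  -- At each point the quotient `b / t` uses an element chosen for that point. By proportionality it
  -- agrees near `q` with the smooth quotient for the element chosen at `q`.
  let a : Smooth U := ⟨fun z => evalAt z (b z) / evalAt z (t z), by
    intro z hz
    refine ContDiffAt.contDiffWithinAt ?_
    set q : U := ⟨z, hz⟩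
    have h1 : ContDiffAt ℝ ∞ (fun y => zeroExt (b q).1 y / zeroExt (t q).1 y) z :=
      (contDiffAt_zeroExt _ hz).div (contDiffAt_zeroExt _ hz) (by
        rw [zeroExt_of_mem _ hz]; exact ht q)
    refine h1.congr_of_eventuallyEq ?_
    have h2 := (contDiffAt_zeroExt (t q) hz).continuousAt.eventually_ne
      (y := 0) (by rw [zeroExt_of_mem _ hz]; exact ht q)
    filter_upwards [h2, U.isOpen.mem_nhds hz] with y hy hyU
    rw [zeroExt_of_mem _ hyU] at hy
    rw [zeroExt_of_mem _ hyU, zeroExt_of_mem _ hyU, zeroExt_of_mem _ hyU]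
    exact key q ⟨y, hyU⟩ hy⟩
  have ha : ∀ z, evalAt z a = evalAt z (b z) / evalAt z (t z) := fun z => rfl
  refine ⟨a, (hI.isAdapted_iff i a).2 fun k' P' hP' t' b' hR' => smooth_ext fun z => ?_, ?_⟩
  · have h1 := congrArg (evalAt z) (hI.rem_mul_eq hl i (hP z) hP' (hR z) hR')
    rw [map_mul, map_mul] at h1
    rw [map_mul, ha, mul_div_assoc', eq_div_iff (ht z)]
    linear_combination -h1
  · intro a' ha'
    refine smooth_ext fun z => ?_
    have h1 := congrArg (evalAt z) ((hI.isAdapted_iff i a').1 ha' _ _ (hP z) _ _ (hR z))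
    rw [map_mul] at h1
    rw [ha, eq_div_iff (ht z), h1, mul_comm]

end GaugeExistence

/-! ## Ranks of the Laplace transform -/

section LaplaceRank

variable {U : Opens (ℝ × ℝ)} {I : Submodule (Smooth U) (Op U)} {h h' : ℕ → ℕ} {L : Op U}

/-- Operators of order one whose symbol vanishes nowhere. -/
structure IsNondegenerate (L : Op U) : Prop where
  mem : L ∈ ordLT (Smooth U) (1 + 1)
  ne_zero : ∀ q, val q (homogeneousComponent 1 L) ≠ 0

theorem isNondegenerate_firstOrder {v : Fin 2 → Smooth U}
    (hv : ∀ q, evalAt q (v 0) ≠ 0 ∨ evalAt q (v 1) ≠ 0) (a : Smooth U) :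
    IsNondegenerate (firstOrder v a) :=
  ⟨firstOrder_mem_ordLT v a, val_homogeneousComponent_firstOrder_ne_zero hv a⟩

theorem IsNondegenerate.finrank_map_compVal (hL : IsNondegenerate L) (q : U)
    (E : Submodule ℝ (MvPolynomial (Fin 2) ℝ)) :
    Module.finrank ℝ (E.map (compVal L q)) = Module.finrank ℝ E :=
  finrank_map_of_injective (compVal_injective hL.mem (hL.ne_zero q)) E

theorem fiber_map_compR (A : Submodule (Smooth U) (Op U)) (L : Op U) (q : U) :
    fiber (A.map (compR L)) q = (fiber A q).map (compVal L q) := by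
  ext u
  constructor
  · rintro ⟨_, ⟨Q, hQ, rfl⟩, rfl⟩
    exact ⟨_, val_mem_fiber hQ q, by rw [← comp_eq, val_comp]⟩
  · rintro ⟨_, ⟨Q, hQ, rfl⟩, rfl⟩
    exact ⟨_, ⟨Q, hQ, rfl⟩, by rw [← comp_eq, val_comp]⟩

theorem IsNondegenerate.map_compR_le (hL : IsNondegenerate L) (n : ℕ) :
    (ordLT (Smooth U) n).map (compR L) ≤ ordLT (Smooth U) (n + 1) := by
  rintro _ ⟨Q, hQ, rfl⟩
  rw [← comp_eq]
  exact comp_mem_ordLT' hQ hL.mem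

/-- The elements of order `≤ n` of `I + D ∘ L`, as far as they are seen in this order. -/
def lapSum (I : Submodule (Smooth U) (Op U)) (L : Op U) (n : ℕ) : Submodule (Smooth U) (Op U) :=
  trunc I (n + 1) ⊔ (ordLT (Smooth U) n).map (compR L)

/-- The dimension of the values at `q` of `lapSum`. -/
def lapRank (I : Submodule (Smooth U) (Op U)) (L : Op U) (n : ℕ) (q : U) : ℕ :=
  Module.finrank ℝ (fiber (lapSum I L n) q)

theorem IsNondegenerate.lapSum_le (hL : IsNondegenerate L) (n : ℕ) :
    lapSum I L n ≤ ordLT (Smooth U) (n + 1) :=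
  sup_le (trunc_le_ordLT I _) (hL.map_compR_le n)

theorem fiber_lapSum (I : Submodule (Smooth U) (Op U)) (L : Op U) (n : ℕ) (q : U) :
    fiber (lapSum I L n) q = fiber (trunc I (n + 1)) q ⊔ (ordLT ℝ n).map (compVal L q) := by
  rw [lapSum, fiber_sup, fiber_map_compR, fiber_ordLT]

/-- By definition of the transform, the elements of `I` that are right multiples of `L` are exactly
`J ∘ L`. Composition with `L` raises the order by one, which explains the shift of the truncations.
-/
theorem IsNondegenerate.trunc_inf_map (hL : IsNondegenerate L) (n : ℕ) :
    trunc I (n + 1) ⊓ (ordLT (Smooth U) n).map (compR L) =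
      (trunc (laplaceMod I L) n).map (compR L) := by
  ext P
  constructor
  · rintro ⟨hP, ⟨Q, hQ, rfl⟩⟩
    exact ⟨Q, ⟨hP.1, hQ⟩, rfl⟩
  · rintro ⟨Q, hQ, rfl⟩
    exact ⟨⟨hQ.1, hL.map_compR_le n ⟨Q, hQ.2, rfl⟩⟩, ⟨Q, hQ.2, rfl⟩⟩

theorem IsNondegenerate.map_fiber_laplace_le (hL : IsNondegenerate L) (n : ℕ) (q : U) :
    (fiber (trunc (laplaceMod I L) n) q).map (compVal L q) ≤
      fiber (trunc I (n + 1)) q ⊓ (ordLT ℝ n).map (compVal L q) := by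
  rw [← fiber_map_compR, ← hL.trunc_inf_map]
  refine le_inf (fiber_mono inf_le_left q) ?_
  rw [← fiber_ordLT n q, ← fiber_map_compR]
  exact fiber_mono inf_le_right q

/-- Taking values commutes with intersections only where the rank of the sum does not jump; without
the hypothesis only the inclusion `IsNondegenerate.map_fiber_laplace_le` is available. -/
theorem IsNondegenerate.map_fiber_laplace (hL : IsNondegenerate L) {n : ℕ} {q : U}
    (hq : ∀ᶠ z in 𝓝 q, lapRank I L n z ≤ lapRank I L n q) :
    (fiber (trunc (laplaceMod I L) n) q).map (compVal L q) =
      fiber (trunc I (n + 1)) q ⊓ (ordLT ℝ n).map (compVal L q) := by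
  rw [← fiber_map_compR, ← hL.trunc_inf_map, fiber_inf (trunc_le_ordLT I _) (hL.map_compR_le n) hq,
    fiber_map_compR, fiber_ordLT]

/-- The dimension formula for a sum and an intersection, with composition by `L` injective on
values. -/
theorem IsNondegenerate.finrank_inf_add (hL : IsNondegenerate L) (n : ℕ) (q : U) :
    Module.finrank ℝ (fiber (trunc I (n + 1)) q ⊓ (ordLT ℝ n).map (compVal L q) :
      Submodule ℝ (MvPolynomial (Fin 2) ℝ)) + lapRank I L n q =
      Module.finrank ℝ (fiber (trunc I (n + 1)) q) + tri n := by
  have := finiteDimensional_of_le_ordLT (fiber_le_ordLT (trunc_le_ordLT I (n + 1)) q)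
  rw [lapRank, fiber_lapSum, add_comm, Submodule.finrank_sup_add_finrank_inf_eq,
    hL.finrank_map_compVal, finrank_ordLT]

theorem IsNondegenerate.finrank_laplace_add_le (hL : IsNondegenerate L) (n : ℕ) (q : U) :
    Module.finrank ℝ (fiber (trunc (laplaceMod I L) n) q) + lapRank I L n q ≤
      Module.finrank ℝ (fiber (trunc I (n + 1)) q) + tri n := by
  rw [← hL.finrank_inf_add, ← hL.finrank_map_compVal q]
  have := finiteDimensional_of_le_ordLT (fiber_le_ordLT (trunc_le_ordLT I (n + 1)) q)
  exact Nat.add_le_add_right (Submodule.finrank_mono (hL.map_fiber_laplace_le n q)) _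

theorem IsNondegenerate.finrank_laplace_add (hL : IsNondegenerate L) {n : ℕ} {q : U}
    (hq : ∀ᶠ z in 𝓝 q, lapRank I L n z ≤ lapRank I L n q) :
    Module.finrank ℝ (fiber (trunc (laplaceMod I L) n) q) + lapRank I L n q =
      Module.finrank ℝ (fiber (trunc I (n + 1)) q) + tri n := by
  rw [← hL.finrank_inf_add, ← hL.map_fiber_laplace hq, hL.finrank_map_compVal q]

theorem IsNondegenerate.lapRank_le (hL : IsNondegenerate L) (n : ℕ) (q : U) :
    lapRank I L n q ≤ tri (n + 1) := by
  rw [← finrank_ordLT]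
  exact Submodule.finrank_mono (fiber_le_ordLT (hL.lapSum_le n) q)

theorem IsNondegenerate.eventually_le_lapRank (hL : IsNondegenerate L) (n : ℕ) (q : U) :
    ∀ᶠ z in 𝓝 q, lapRank I L n q ≤ lapRank I L n z :=
  eventually_finrank_fiber_le (hL.lapSum_le n) q

theorem IsNondegenerate.sum_laplace (hL : IsNondegenerate L) (hI : IsRegular (I : Set (Op U)) h)
    (hJ : IsRegular (laplaceMod I L : Set (Op U)) h') {n : ℕ} {q : U}
    (hq : ∀ᶠ z in 𝓝 q, lapRank I L n z ≤ lapRank I L n q) :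
    ∑ k ∈ Finset.range n, h' k + tri (n + 1) =
      lapRank I L n q + ∑ k ∈ Finset.range (n + 1), h k := by
  have h1 := hL.finrank_laplace_add hq
  have h2 := hI.finrank_fiber_trunc (n + 1) q
  have h3 := hJ.finrank_fiber_trunc n q
  omega

/-- An operator of order `≤ n` that is a right multiple of `L` has quotient of order `< n`. So to
the `tri (n + 2)` dimensions of multiples of `L` only the pure powers `Y^0, …, Y^n` are added. -/
theorem IsNondegenerate.finrank_ordLT_sup (hL : IsNondegenerate L) (n : ℕ) (q : U) :
    Module.finrank ℝ (ordLT ℝ (n + 1) ⊔ (ordLT ℝ (n + 2)).map (compVal L q) :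
      Submodule ℝ (MvPolynomial (Fin 2) ℝ)) = tri (n + 2) + (n + 1) := by
  have h1 : ordLT ℝ (n + 1) ⊓ (ordLT ℝ (n + 2)).map (compVal L q) =
      (ordLT ℝ n).map (compVal L q) := by
    refine le_antisymm ?_ (le_inf ?_ (Submodule.map_mono (ordLT_mono (by omega))))
    · rintro _ ⟨hu, ⟨u, -, rfl⟩⟩
      exact ⟨u, mem_ordLT_of_compVal hL.mem (hL.ne_zero q) hu, rfl⟩
    · rintro _ ⟨u, hu, rfl⟩
      exact compVal_mem_ordLT hL.mem q hu
  have h2 := Submodule.finrank_sup_add_finrank_inf_eq (ordLT ℝ (n + 1))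
    ((ordLT ℝ (n + 2)).map (compVal L q))
  rw [h1, hL.finrank_map_compVal, hL.finrank_map_compVal, finrank_ordLT, finrank_ordLT,
    finrank_ordLT, tri_succ n] at h2
  omega

theorem lapSum_le_of_isAdapted (hI : IsAdapted (I : Set (Op U)) L) (n : ℕ) :
    lapSum I L (n + 2) ≤ ordLT (Smooth U) (n + 1) ⊔ (ordLT (Smooth U) (n + 2)).map (compR L) := by
  refine sup_le ?_ le_sup_right
  intro P hP
  obtain ⟨Q, hQ, hR⟩ := PlanePDE.isAdapted_iff.1 hI n P hP
  rw [← sub_add_cancel P (Op.comp Q L)]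
  exact Submodule.add_mem_sup hR ⟨Q, hQ, by rw [comp_eq]⟩

theorem fiber_ordLT_sup (L : Op U) (m n : ℕ) (q : U) :
    fiber (U := U) (ordLT (Smooth U) m ⊔ (ordLT (Smooth U) n).map (compR L)) q =
      ordLT ℝ m ⊔ (ordLT ℝ n).map (compVal L q) := by
  rw [fiber_sup, fiber_map_compR, fiber_ordLT, fiber_ordLT]

theorem IsNondegenerate.lapRank_le_of_isAdapted (hL : IsNondegenerate L)
    (hI : IsAdapted (I : Set (Op U)) L) (n : ℕ) (q : U) :
    lapRank I L (n + 2) q ≤ tri (n + 2) + (n + 1) := by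
  rw [← hL.finrank_ordLT_sup n q, ← fiber_ordLT_sup]
  have hle : (ordLT (Smooth U) (n + 1) ⊔ (ordLT (Smooth U) (n + 2)).map (compR L) :
      Submodule (Smooth U) (Op U)) ≤ ordLT (Smooth U) (n + 2 + 1) :=
    sup_le (ordLT_mono (by omega)) (hL.map_compR_le _)
  have := finiteDimensional_of_le_ordLT (fiber_le_ordLT hle q)
  exact Submodule.finrank_mono (fiber_mono (lapSum_le_of_isAdapted hI n) q)

/-- At maximal rank the inclusion given by adaptedness is an equality of fibers, so all values of
order `≤ n` occur. -/
theorem IsNondegenerate.ordLT_le_fiber (hL : IsNondegenerate L)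
    (hI : IsAdapted (I : Set (Op U)) L) {n : ℕ} {q : U}
    (hq : tri (n + 2) + (n + 1) ≤ lapRank I L (n + 2) q) :
    ordLT ℝ (n + 1) ≤ fiber (lapSum I L (n + 2)) q := by
  have hle : (ordLT (Smooth U) (n + 1) ⊔ (ordLT (Smooth U) (n + 2)).map (compR L) :
      Submodule (Smooth U) (Op U)) ≤ ordLT (Smooth U) (n + 2 + 1) :=
    sup_le (ordLT_mono (by omega)) (hL.map_compR_le _)
  have := finiteDimensional_of_le_ordLT (fiber_le_ordLT hle q)
  rw [Submodule.eq_of_le_of_finrank_le (fiber_mono (lapSum_le_of_isAdapted hI n) q)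
    (by rw [fiber_ordLT_sup, hL.finrank_ordLT_sup]; exact hq), fiber_ordLT_sup]
  exact le_sup_left

theorem leftD_mem_lapSum (hI : IsLeft I) (i : Fin 2) {n : ℕ} {P : Op U} (hP : P ∈ lapSum I L n) :
    Op.leftD i P ∈ lapSum I L (n + 1) := by
  obtain ⟨A, hA, _, ⟨Q, hQ, rfl⟩, rfl⟩ := Submodule.mem_sup.1 hP
  rw [leftD_add, ← comp_eq, ← leftD_comp]
  exact Submodule.add_mem_sup (hI.leftD_mem_trunc i hA)
    ⟨Op.leftD i Q, leftD_mem_ordLT i hQ, by rw [comp_eq]⟩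

theorem val_leftD_smul_cst (i : Fin 2) (δ : Smooth U) (u : MvPolynomial (Fin 2) ℝ) (q : U) :
    val q (Op.leftD i (δ • cst U u)) = evalAt q (partialD i δ) • u + evalAt q δ • (X i * u) := by
  rw [smul_eq_C_mul, leftD_C_mul, leftD_cst, ← smul_eq_C_mul, ← smul_eq_C_mul, map_add, val_smul,
    val_smul, map_mul, map_X, val_cst, add_comm]

/-- At maximal rank a constant coefficient operator `u` of order `≤ n` lies in `lapSum` after
multiplication by some `δ` with `δ(q) ≠ 0`. Applying `∂ᵢ` gives the value `(∂ᵢ δ) u + δ X_i u`,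
whose first term is already available; so `X_i u` is reached in the next order, and all values of
order `≤ n + 1` with it. -/
theorem IsNondegenerate.le_lapRank_succ (hL : IsNondegenerate L) (hl : IsLeft I)
    (hI : IsAdapted (I : Set (Op U)) L) {n : ℕ} {q : U}
    (hq : tri (n + 2) + (n + 1) ≤ lapRank I L (n + 2) q) :
    tri (n + 3) + (n + 2) ≤ lapRank I L (n + 3) q := by
  have hle : (ordLT (Smooth U) (n + 1) ⊔ (ordLT (Smooth U) (n + 2)).map (compR L) :
      Submodule (Smooth U) (Op U)) ≤ ordLT (Smooth U) (n + 2 + 1) :=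
    sup_le (ordLT_mono (by omega)) (hL.map_compR_le _)
  have hful := hL.ordLT_le_fiber hI hq
  have hmono : lapSum I L (n + 2) ≤ lapSum I L (n + 3) :=
    sup_le_sup (trunc_mono I (by omega)) (Submodule.map_mono (ordLT_mono (by omega)))
  have hX : ∀ i, ∀ u ∈ ordLT ℝ (n + 1), X i * u ∈ fiber (lapSum I L (n + 3)) q := by
    intro i u hu
    obtain ⟨t, s, g, δ, hs, hδ, hsum, -⟩ := exists_smul_eq_sum (lapSum_le_of_isAdapted hI n) hle
      (q := q) (P := cst U u) (Eventually.of_forall fun z => by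
        rw [fiber_ordLT_sup, hL.finrank_ordLT_sup]
        exact hq) (Submodule.mem_sup_left (cst_mem_ordLT hu))
    have h1 : δ • cst U u ∈ lapSum I L (n + 2) := by
      rw [hsum]
      exact Submodule.sum_mem _ fun i _ => Submodule.smul_mem _ _ (hs i)
    have h2 := val_mem_fiber (leftD_mem_lapSum hl i h1) q
    rw [val_leftD_smul_cst] at h2
    have h3 : evalAt q (partialD i δ) • u ∈ fiber (lapSum I L (n + 3)) q :=
      Submodule.smul_mem _ _ (fiber_mono hmono q (hful hu))
    exact (Submodule.smul_mem_iff _ hδ).1 ((Submodule.add_mem_iff_right _ h3).1 h2)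
  have hfull : ordLT ℝ (n + 2) ≤ fiber (lapSum I L (n + 3)) q := by
    rw [ordLT_eq_span]
    refine Submodule.span_le.2 ?_
    rintro _ ⟨α, hα, rfl⟩
    revert hα
    induction α using exponent_induction with
    | zero =>
      intro _
      exact fiber_mono hmono q (hful (monomial_mem_ordLT (by rw [map_zero]; omega) 1))
    | step α i _ =>
      intro hα
      have h2 : (monomial (α + Finsupp.single i 1) 1 : MvPolynomial (Fin 2) ℝ) =
          X i * monomial α 1 := by rw [X, monomial_mul, one_mul, add_comm]
      simp only [Set.mem_ofPred_eq, map_add, Finsupp.degree_single] at hα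
      change monomial (α + Finsupp.single i 1) 1 ∈ _
      rw [h2]
      exact hX i _ (monomial_mem_ordLT (by omega) 1)
  have hsup : ordLT ℝ (n + 2) ⊔ (ordLT ℝ (n + 3)).map (compVal L q) ≤
      fiber (lapSum I L (n + 3)) q := by
    refine sup_le hfull ?_
    rw [fiber_lapSum]
    exact le_sup_right
  have := finiteDimensional_of_le_ordLT (fiber_le_ordLT (hL.lapSum_le (I := I) (n + 3)) q)
  have h5 := Submodule.finrank_mono hsup
  rwa [hL.finrank_ordLT_sup (n + 1) q] at h5

theorem IsNondegenerate.le_lapRank_of_le (hL : IsNondegenerate L) (hl : IsLeft I)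
    (hI : IsAdapted (I : Set (Op U)) L) {m n : ℕ} (hmn : m ≤ n) {q : U}
    (hq : tri (m + 2) + (m + 1) ≤ lapRank I L (m + 2) q) :
    tri (n + 2) + (n + 1) ≤ lapRank I L (n + 2) q := by
  induction n, hmn using Nat.le_induction with
  | base => exact hq
  | succ n _ ih => exact hL.le_lapRank_succ hl hI ih

end LaplaceRank

/-! ## Class and complexity of the Laplace transform -/

section LaplaceClass

theorem eventually_complexity_eq {h : ℕ → ℕ} {w : ℕ} (hw : HasClass h w) :
    ∀ᶠ n in atTop, complexity h w =
      (∑ k ∈ Finset.range n, h k : ℕ) - (n : ℤ) * w + (w : ℤ) * ((w : ℤ) - 1) / 2 := by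
  obtain ⟨m, hm⟩ := eventually_atTop.1 hw
  refine eventually_atTop.2 ⟨m, fun n hn => ?_⟩
  have h1 : ∑ᶠ i : ℕ, ((h i : ℤ) - (w : ℤ)) = ∑ i ∈ Finset.range n, ((h i : ℤ) - (w : ℤ)) := by
    refine finsum_eq_sum_of_support_subset _ fun i hi => ?_
    by_contra hc
    simp only [Finset.coe_range, Set.mem_Iio, not_lt] at hc
    refine hi ?_
    change (h i : ℤ) - w = 0
    rw [hm i (hn.trans hc), sub_self]
  rw [complexity, h1, Finset.sum_sub_distrib, Finset.sum_const, Finset.card_range, nsmul_eq_mul]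
  push_cast
  ring

variable {U : Opens (ℝ × ℝ)}

/-- A nonzero space of forms generates in the next degree a space of larger dimension. -/
theorem finrank_lt_of_X_mul_mem {n : ℕ} {E E' : Submodule ℝ (MvPolynomial (Fin 2) ℝ)}
    (hE : E ≤ homogeneousSubmodule (Fin 2) ℝ n) (h0 : E ≠ ⊥) [FiniteDimensional ℝ E']
    (h : ∀ i, ∀ u ∈ E, X i * u ∈ E') : Module.finrank ℝ E < Module.finrank ℝ E' := by
  have hX : (X 0 : MvPolynomial (Fin 2) ℝ) ≠ 0 := X_ne_zero 0
  have hle : E.map (LinearMap.mulLeft ℝ (X 0)) ≤ E' := by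
    rintro _ ⟨u, hu, rfl⟩
    exact h 0 u hu
  rw [← finrank_map_mulLeft hX E]
  refine Submodule.finrank_lt_finrank_of_lt (lt_of_le_of_ne hle fun heq => h0 ?_)
  -- If the dimension did not grow, `E'` would equal `X 0 * E`, so `X 1 * u ∈ X 0 * E` for every `u
  -- ∈ E`. By induction every element of `E` would be divisible by all powers of `X 0`.
  have hdvd : ∀ m : ℕ, ∀ u ∈ E, X 0 ^ m ∣ u := by
    intro m
    induction m with
    | zero => intro u _; rw [pow_zero]; exact one_dvd u
    | succ m ih =>
      intro u hu
      have h1 := h 1 u hu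
      rw [← heq] at h1
      obtain ⟨w, hw, hwu⟩ := h1
      rw [LinearMap.mulLeft_apply] at hwu
      have h2 : X 0 ^ (m + 1) ∣ X 1 * u := by
        rw [← hwu, pow_succ']
        exact mul_dvd_mul_left _ (ih w hw)
      refine (Prime.pow_dvd_of_dvd_mul_left (X_prime) _ ?_ h2)
      intro h3
      obtain ⟨c, hc⟩ := h3
      have h4 := congrArg (eval ![0, 1]) hc
      simp at h4
  refine (Submodule.eq_bot_iff _).2 fun u hu => ?_
  obtain ⟨c, hc⟩ := hdvd (n + 1) u hu
  by_contra hu0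
  have hc0 : c ≠ 0 := fun h => hu0 (by rw [hc, h, mul_zero])
  have h5 : u.totalDegree = n := (hE hu : u.IsHomogeneous n).totalDegree hu0
  rw [hc, totalDegree_mul_of_isDomain (pow_ne_zero _ hX) hc0, totalDegree_X_pow] at h5
  omega

/-- As soon as a nonzero symbol exists, the dimension of the symbols grows by at least one per
order, so `h` is nonincreasing from there on and becomes constant. -/
theorem IsRegular.exists_hasClass {I : Submodule (Smooth U) (Op U)} {h : ℕ → ℕ}
    (hI : IsRegular (I : Set (Op U)) h) (hl : IsLeft I) {k : ℕ} (hk : h k < k + 1) (q : U) :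
    ∃ w, HasClass h w := by
  have h1 : ∀ n ≥ k, h (n + 1) ≤ h n ∧ h n < n + 1 := by
    intro n hn
    induction n, hn using Nat.le_induction with
    | base =>
      refine ⟨?_, hk⟩
      have h2 := hI.finrank_symbolSpace k q
      have h3 := hI.finrank_symbolSpace (k + 1) q
      have := finrank_lt_of_X_mul_mem (symbolSpace_le I k q) (fun h0 => by
        rw [h0, finrank_bot] at h2; omega) (fun i u hu => hl.X_mul_mem_symbolSpace i hu)
      omega
    | succ n _ ih =>
      have h2 := hI.finrank_symbolSpace (n + 1) q
      have h3 := hI.finrank_symbolSpace (n + 1 + 1) q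
      have := finrank_lt_of_X_mul_mem (symbolSpace_le I (n + 1) q) (fun h0 => by
        rw [h0, finrank_bot] at h2; omega) (fun i u hu => hl.X_mul_mem_symbolSpace i hu)
      omega
  have hanti : Antitone fun n => h (n + k) := antitone_nat_of_succ_le fun n => by
    have := (h1 (n + k) (Nat.le_add_left _ _)).1
    rwa [add_right_comm] at this
  obtain ⟨n, hn⟩ : ∃ n, ∀ m, h (n + k) ≤ h (m + k) :=
    ⟨_, fun m => Function.argmin_le (fun n => h (n + k)) m⟩
  refine ⟨h (n + k), eventually_atTop.2 ⟨n + k, fun m hm => ?_⟩⟩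
  have h2 := le_antisymm (hanti (show n ≤ m - k by omega)) (hn (m - k))
  simp only [Nat.sub_add_cancel (show k ≤ m by omega)] at h2
  exact h2

/-- A bounded function with values in `ℕ` attains its maximum without any compactness. Points of
maximal rank are obtained in this way. -/
theorem exists_maximum {T : Type*} [Nonempty T] (f : T → ℕ) (B : ℕ) (hB : ∀ x, f x ≤ B) :
    ∃ x, ∀ y, f y ≤ f x := by
  obtain ⟨x, hx⟩ := ((Set.finite_Iic B).subset (t := Set.range f)
    (by rintro _ ⟨x, rfl⟩; exact hB x)).exists_maximal (Set.range_nonempty f)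
  obtain ⟨⟨x, rfl⟩, hx⟩ := hx
  refine ⟨x, fun y => ?_⟩
  rcases le_total (f y) (f x) with h | h
  · exact h
  · exact hx ⟨y, rfl⟩ h

variable {I : Submodule (Smooth U) (Op U)} {h h' : ℕ → ℕ} {L : Op U}

/-- The dimension formula is exact at a point of maximal rank, and regularity makes both sums
independent of the point. The `2` is `tri (n + 3) - (tri (n + 2) + (n + 1))`, the codimension forced
by adaptedness. -/
theorem IsNondegenerate.sum_laplace_le (hL : IsNondegenerate L) (hI : IsRegular (I : Set (Op U)) h)
    (hJ : IsRegular (laplaceMod I L : Set (Op U)) h') (hA : IsAdapted (I : Set (Op U)) L)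
    [Nonempty U] (n : ℕ) :
    ∑ k ∈ Finset.range (n + 2), h' k + 2 ≤ ∑ k ∈ Finset.range (n + 3), h k := by
  obtain ⟨q, hq⟩ := exists_maximum (lapRank I L (n + 2)) _ (hL.lapRank_le (n + 2))
  have h1 := hL.sum_laplace hI hJ (n := n + 2) (q := q) (Eventually.of_forall hq)
  have h2 := hL.lapRank_le_of_isAdapted hA n q
  rw [tri_succ (n + 2), show n + 2 + 1 = n + 3 from rfl] at h1
  omega

theorem sum_range_hasClass {h : ℕ → ℕ} {w : ℕ} (hw : HasClass h w) :
    ∃ (C : ℤ) (m : ℕ), ∀ n ≥ m, ((∑ k ∈ Finset.range n, h k : ℕ) : ℤ) = n * w + C := by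
  obtain ⟨m, hm⟩ := eventually_atTop.1 (eventually_complexity_eq hw)
  exact ⟨complexity h w - (w : ℤ) * ((w : ℤ) - 1) / 2, m, fun n hn => by rw [hm n hn]; ring⟩

/-- The partial sums of `h'` and `h` grow like `w n` and `3 n`, so the inequality between them
excludes `w > 3`. For `w = 3` the shift of the summation range contributes `3` and the codimension
`-2`, whence the bound `+ 1`. -/
theorem IsNondegenerate.laplace_class (hL : IsNondegenerate L) (hI : IsRegular (I : Set (Op U)) h)
    (hl : IsLeft I) (hh : HasClass h 3)
    (hJ : IsRegular (laplaceMod I L : Set (Op U)) h') (hA : IsAdapted (I : Set (Op U)) L)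
    [hU : Nonempty U] :
    (∃ w < 3, HasClass h' w) ∨ (HasClass h' 3 ∧ complexity h' 3 ≤ complexity h 3 + 1) := by
  have hle := hL.sum_laplace_le hI hJ hA
  obtain ⟨C, m, hC⟩ := sum_range_hasClass hh
  obtain ⟨w, hw⟩ : ∃ w, HasClass h' w := by
    obtain ⟨q⟩ := hU
    -- If no class exists, the transform has no equations in any order, so `h' k ≥ k + 1` and the
    -- partial sums grow faster than `3 n`.
    by_contra hc
    have h1 : ∀ k, k + 1 ≤ h' k := fun k => by
      by_contra hk
      exact hc (hJ.exists_hasClass (isLeft_laplaceMod hl L) (not_le.1 hk) q)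
    -- A crude linear bound of slope larger than `3` suffices; the `10` absorbs the first three
    -- terms.
    have h2 : ∀ n, 4 * n ≤ ∑ k ∈ Finset.range n, h' k + 10 := fun n => by
      induction n with
      | zero => simp
      | succ n ih =>
        rw [Finset.sum_range_succ]
        by_cases hn : n < 3
        · have h3 := h1 n
          interval_cases n <;> omega
        · have := h1 n
          omega
    have h3 := h2 (m + C.natAbs + 20 + 2)
    have h4 := hle (m + C.natAbs + 20)
    have h5 := hC (m + C.natAbs + 20 + 3) (by omega)
    have h6 : C ≤ (C.natAbs : ℤ) := Int.le_natAbs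
    generalize C.natAbs = c at *
    zify at h3 h4
    push_cast at h5
    omega
  obtain ⟨C', m', hC'⟩ := sum_range_hasClass hw
  rcases lt_trichotomy w 3 with h3 | rfl | h3
  · exact Or.inl ⟨w, h3, hw⟩
  · refine Or.inr ⟨hw, ?_⟩
    obtain ⟨n₁, h1⟩ := eventually_atTop.1 (eventually_complexity_eq hw)
    obtain ⟨n₂, h2⟩ := eventually_atTop.1 (eventually_complexity_eq hh)
    have h4 := h1 (n₁ + n₂ + 2) (by omega)
    have h5 := h2 (n₁ + n₂ + 3) (by omega)
    have h6 := hle (n₁ + n₂)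
    push_cast at h4 h5
    zify at h6
    omega
  · exfalso
    set n := m + m' + C.natAbs + C'.natAbs + 20 with hn
    have h4 := hle n
    have h5 := hC (n + 3) (by omega)
    have h6 := hC' (n + 2) (by omega)
    have h7 : ((n + 2 : ℕ) : ℤ) * 4 ≤ ((n + 2 : ℕ) : ℤ) * w := by
      apply mul_le_mul_of_nonneg_left _ (by positivity)
      exact_mod_cast h3
    push_cast at h5 h6 h7
    zify at h4
    omega

/-- At maximal rank the inequality of partial sums is an equality. Differences of consecutive orders
give `h' (k + 2) = h (k + 3)` eventually, and the sums themselves give the complexity. -/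
theorem IsNondegenerate.laplace_class_eq (hL : IsNondegenerate L)
    (hI : IsRegular (I : Set (Op U)) h) (hh : HasClass h 3)
    (hJ : IsRegular (laplaceMod I L : Set (Op U)) h') {q : U} {n₀ : ℕ}
    (hq : ∀ n ≥ n₀, ∀ᶠ z in 𝓝 q, lapRank I L (n + 2) z ≤ lapRank I L (n + 2) q)
    (hq' : ∀ n ≥ n₀, lapRank I L (n + 2) q = tri (n + 2) + (n + 1)) :
    HasClass h' 3 ∧ complexity h' 3 = complexity h 3 + 1 := by
  have hsum : ∀ n ≥ n₀, ∑ k ∈ Finset.range (n + 2), h' k + 2 = ∑ k ∈ Finset.range (n + 3), h k := by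
    intro n hn
    have h1 := hL.sum_laplace hI hJ (hq n hn)
    rw [tri_succ (n + 2), hq' n hn, show n + 2 + 1 = n + 3 from rfl] at h1
    omega
  have hw : HasClass h' 3 := by
    obtain ⟨m, hm⟩ := eventually_atTop.1 hh
    refine eventually_atTop.2 ⟨n₀ + m + 2, fun n hn => ?_⟩
    obtain ⟨k, rfl⟩ : ∃ k, n = k + 2 := ⟨n - 2, by omega⟩
    have h1 := hsum k (by omega)
    have h2 := hsum (k + 1) (by omega)
    rw [Finset.sum_range_succ, Finset.sum_range_succ _ (k + 3)] at h2
    have h3 := hm (k + 3) (by omega)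
    have h4 : h' (k + 2) = h (k + 3) := by omega
    rw [h4, h3]
  refine ⟨hw, ?_⟩
  obtain ⟨n₁, h1⟩ := eventually_atTop.1 (eventually_complexity_eq hw)
  obtain ⟨n₂, h2⟩ := eventually_atTop.1 (eventually_complexity_eq hh)
  have h4 := h1 (n₀ + n₁ + n₂ + 2) (by omega)
  have h5 := h2 (n₀ + n₁ + n₂ + 3) (by omega)
  have h6 := hsum (n₀ + n₁ + n₂) (by omega)
  push_cast at h4 h5
  zify at h6
  omega

/-- If `I` begins in order `c` with as many equations as a type prescribes, then a transform for which
`lapRank` is large in order `c + 1` is not of this type. -/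
theorem IsNondegenerate.not_hasType (hL : IsNondegenerate L)
    (hI : IsRegular (I : Set (Op U)) h) {r : ℕ} {d : Fin r → ℕ} {c : ℕ} (hc : ∀ k < c, h k = k + 1)
    (hcd : (Finset.univ.filter fun j => d j = c).card + h c = c + 1) {q : U}
    (hq : tri (c + 1) + (c + 2 - h (c + 1)) + 1 ≤ lapRank I L (c + 1) q) :
    ¬ HasType (laplaceMod I L : Set (Op U)) d := by
  intro ht
  have h1 := hL.finrank_laplace_add_le (I := I) (c + 1) q
  have h2 := hI.finrank_fiber_trunc (c + 1 + 1) q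
  have h3 : ∑ k ∈ Finset.range c, h k = tri c := Finset.sum_congr rfl fun k hk =>
    hc k (Finset.mem_range.1 hk)
  rw [Finset.sum_range_succ, Finset.sum_range_succ, h3, tri_succ (c + 1), tri_succ c] at h2
  -- The type would require `c + 1 - h c` new equations of order `c`, whereas the rank hypothesis
  -- leaves fewer dimensions than that to all elements of `J` of order `≤ c`.
  have h4 := ht c q
  have h5 : newEquations (laplaceMod I L : Set (Op U)) c q ≤
      Module.finrank ℝ (symbolSpace (laplaceMod I L : Set (Op U)) c q) :=
    Submodule.finrank_quotient_le _
  have h6 : Module.finrank ℝ (symbolSpace (laplaceMod I L : Set (Op U)) c q) ≤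
      Module.finrank ℝ (fiber (trunc (laplaceMod I L) (c + 1)) q) := by
    rw [symbolSpace_eq]
    have := finiteDimensional_of_le_ordLT
      (fiber_le_ordLT (trunc_le_ordLT (laplaceMod I L) (c + 1)) q)
    exact Submodule.finrank_map_le _ _
  have h7 := hI.finrank_symbolSpace (c + 1) q
  rw [tri_succ c] at h1 hq
  omega

/-- The transform is regular where all the ranks are constant. -/
theorem IsNondegenerate.exists_isRegular_laplace (hL : IsNondegenerate L)
    (hI : IsRegular (I : Set (Op U)) h) (hc : ∀ n z z', lapRank I L n z = lapRank I L n z')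
    [hU : Nonempty U] : ∃ h', IsRegular (laplaceMod I L : Set (Op U)) h' := by
  obtain ⟨q⟩ := hU
  have hmax : ∀ n z, ∀ᶠ y in 𝓝 z, lapRank I L n y ≤ lapRank I L n z := fun n z =>
    Eventually.of_forall fun y => (hc n y z).le
  have hdim : ∀ n z, Module.finrank ℝ (fiber (trunc (laplaceMod I L) n) z) =
      Module.finrank ℝ (fiber (trunc (laplaceMod I L) n) q) := fun n z => by
    have h1 := hL.finrank_laplace_add (hmax n z)
    have h2 := hL.finrank_laplace_add (hmax n q)
    have h3 := hI.finrank_fiber_trunc (n + 1) z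
    have h4 := hI.finrank_fiber_trunc (n + 1) q
    have h5 := hc n z q
    omega
  -- A value of `J` of smaller degree becomes, after composition with `L`, a value of `I` of smaller
  -- degree. Regularity of `I` lifts it in the lower order, and the constant ranks bring it back to
  -- `J`.
  have hinf : ∀ n z, fiber (trunc (laplaceMod I L) (n + 1)) z ⊓ ordLT ℝ n =
      fiber (trunc (laplaceMod I L) n) z := fun n z => by
    refine le_antisymm ?_ (le_inf (fiber_mono (trunc_mono _ (Nat.le_succ n)) z)
      (fiber_le_ordLT (trunc_le_ordLT _ n) z))
    rintro u ⟨hu, hun⟩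
    have h1 := hL.map_fiber_laplace (hmax n z)
    have h2 := hL.map_fiber_laplace_le (I := I) (n + 1) z ⟨u, hu, rfl⟩
    have h3 : compVal L z u ∈ fiber (trunc I (n + 1)) z := by
      rw [← hI.fiber_trunc_inf]
      exact ⟨h2.1, compVal_mem_ordLT hL.mem z hun⟩
    have h4 : compVal L z u ∈ (fiber (trunc (laplaceMod I L) n) z).map (compVal L z) := by
      rw [h1]
      exact ⟨h3, ⟨u, hun, rfl⟩⟩
    obtain ⟨w, hw, hwu⟩ := h4
    rwa [← compVal_injective hL.mem (hL.ne_zero z) hwu]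
  refine ⟨fun n => n + 1 - Module.finrank ℝ (symbolSpace (laplaceMod I L : Set (Op U)) n q),
    isRegular_iff.2 fun n z => ?_⟩
  have h1 : ∀ z, Module.finrank ℝ (symbolSpace (laplaceMod I L : Set (Op U)) n z) +
      Module.finrank ℝ (fiber (trunc (laplaceMod I L) n) z) =
      Module.finrank ℝ (fiber (trunc (laplaceMod I L) (n + 1)) z) := fun z => by
    have := finrank_map_homogeneousComponent_add
      (fiber_le_ordLT (trunc_le_ordLT (laplaceMod I L) (n + 1)) z)
    rwa [hinf, ← symbolSpace_eq] at this
  have h2 := h1 z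
  have h3 := h1 q
  have h4 := hdim n z
  have h5 := hdim (n + 1) z
  have h6 := finrank_gSymbol_add (laplaceMod I L) n q
  omega

end LaplaceClass

/-! ## Restriction to smaller open sets -/

section Restriction

variable {U W : Opens (ℝ × ℝ)} (hWU : W ≤ U)

/-- The inclusion of a smaller open set. -/
def incl (z : W) : U := ⟨z.1, hWU z.2⟩

theorem evalAt_restrictFun (f : Smooth U) (z : W) :
    evalAt z (restrictFun hWU f) = evalAt (incl hWU z) f := rfl

theorem partialD_restrictFun (i : Fin 2) (f : Smooth U) :
    partialD i (restrictFun hWU f) = restrictFun hWU (partialD i f) := by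
  refine smooth_ext fun z => ?_
  rw [evalAt_restrictFun, evalAt_partialD, evalAt_partialD]
  have h : zeroExt (restrictFun hWU f).1 =ᶠ[𝓝 (z : ℝ × ℝ)] zeroExt f.1 := by
    filter_upwards [W.isOpen.mem_nhds z.2] with y hy
    rw [zeroExt_of_mem _ hy, zeroExt_of_mem _ (hWU hy)]
    rfl
  rw [h.fderiv_eq]
  rfl

theorem val_restrict (P : Op U) (z : W) : val z (P.restrict hWU) = val (incl hWU z) P := by
  rw [Op.restrict, val, MvPolynomial.map_map]
  rfl

theorem leftD_restrict (i : Fin 2) (P : Op U) :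
    Op.leftD i (P.restrict hWU) = (Op.leftD i P).restrict hWU := by
  induction P using MvPolynomial.induction_on' with
  | monomial α c =>
    have h : ∀ {V : Opens (ℝ × ℝ)} (f : Smooth V), Op.leftD i (monomial α f) =
        monomial α (partialD i f) + X i * monomial α f := fun {V} f => by
      have h1 := leftD_C_mul i f (cst V (monomial α 1))
      rw [leftD_cst, cst, map_monomial, map_one, C_mul_monomial, C_mul_monomial, mul_one, mul_one]
        at h1
      rw [h1, add_comm, mul_left_comm, C_mul_monomial, mul_one]
    rw [Op.restrict, map_monomial, h, h, Op.restrict, map_add, map_monomial, map_mul, map_X,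
      map_monomial, partialD_restrictFun]
  | add p q hp hq =>
    rw [Op.restrict, map_add, leftD_add, leftD_add, Op.restrict, map_add]
    exact congrArg₂ _ hp hq

theorem leftDPow_restrict (α : Fin 2 →₀ ℕ) (P : Op U) :
    Op.leftDPow α (P.restrict hWU) = (Op.leftDPow α P).restrict hWU := by
  induction α using exponent_induction with
  | zero => rfl
  | step α i h => rw [leftDPow_add_single, leftDPow_add_single, h, leftD_restrict]

theorem restrict_mem_ordLT {n : ℕ} {P : Op U} (hP : P ∈ ordLT (Smooth U) n) :
    P.restrict hWU ∈ ordLT (Smooth W) n := map_mem_ordLT _ hP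

theorem compVal_restrict (L : Op U) (z : W) :
    compVal (L.restrict hWU) z = compVal L (incl hWU z) := by
  refine MvPolynomial.linearMap_ext fun α => LinearMap.ext fun c => ?_
  simp only [LinearMap.comp_apply]
  rw [compVal_monomial, compVal_monomial, leftDPow_restrict, val_restrict]

variable {r : ℕ} (F : Fin r → Op U)

theorem restrict_mem_systemMod {P : Op U} (hP : P ∈ systemMod F) :
    P.restrict hWU ∈ systemMod fun j => (F j).restrict hWU := by
  refine Submodule.span_induction
    (p := fun P _ => P.restrict hWU ∈ systemMod fun j => (F j).restrict hWU) ?_ ?_ ?_ ?_ hP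
  · rintro _ ⟨⟨j, α⟩, rfl⟩
    change (Op.leftDPow α (F j)).restrict hWU ∈ _
    rw [← leftDPow_restrict]
    exact leftDPow_mem_systemMod (fun j => (F j).restrict hWU) j α
  · rw [Op.restrict, map_zero]
    exact Submodule.zero_mem _
  · intro P Q _ _ hP hQ
    rw [Op.restrict, map_add]
    exact Submodule.add_mem _ hP hQ
  · intro c P _ hP
    rw [Op.restrict, smul_eq_C_mul, map_mul, map_C, ← smul_eq_C_mul]
    exact Submodule.smul_mem _ _ hP

/-- Fibers are local: an element over `W` is multiplied by a bump function equal to one at `z`, and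
its coefficients with respect to the generators are extended by zero. Off `W` the result vanishes,
so the bound on the order is preserved. -/
theorem fiber_trunc_restrict (n : ℕ) (z : W) :
    fiber (trunc (systemMod fun j => (F j).restrict hWU) n) z =
      fiber (trunc (systemMod F) n) (incl hWU z) := by
  refine le_antisymm ?_ ?_
  · rintro _ ⟨P, hP, rfl⟩
    obtain ⟨χ, hχ, hχ1, hχs⟩ := exists_bump_plane (q := z) (p := fun _ => True)
      (Eventually.of_forall fun _ => trivial)
    obtain ⟨c, hc⟩ := (Finsupp.mem_span_range_iff_exists_finsupp).1 hP.1
    have hext := fun f : Smooth W =>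
      exists_extension (U := U) χ hχ (fun y hy => (hχs y hy).1) f
    choose g hg hg0 using hext
    set P' : Op U := c.sum fun jα a => g a • Op.leftDPow jα.2 (F jα.1) with hP'
    have hin : ∀ y : U, ∀ hy : (y : ℝ × ℝ) ∈ W, val y P' = χ y • val (⟨y, hy⟩ : W) P := by
      intro y hy
      rw [← hc, hP', Finsupp.sum, Finsupp.sum, map_sum, map_sum, Finset.smul_sum]
      refine Finset.sum_congr rfl fun jα _ => ?_
      rw [val_smul, val_smul, hg _ y hy, leftDPow_restrict, val_restrict, smul_smul]
      rfl
    have hout : ∀ y : U, (y : ℝ × ℝ) ∉ W → val y P' = 0 := by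
      intro y hy
      rw [hP', Finsupp.sum, map_sum]
      refine Finset.sum_eq_zero fun jα _ => ?_
      rw [val_smul, hg0 _ y hy, zero_smul]
    refine ⟨P', ⟨?_, mem_ordLT_iff_val.2 fun y => ?_⟩, ?_⟩
    · exact Submodule.sum_mem _ fun jα _ => Submodule.smul_mem _ _ (leftDPow_mem_systemMod F _ _)
    · by_cases hy : (y : ℝ × ℝ) ∈ W
      · rw [hin y hy]
        exact Submodule.smul_mem _ _ (map_mem_ordLT _ hP.2)
      · rw [hout y hy]
        exact Submodule.zero_mem _
    · rw [hin (incl hWU z) z.2]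
      change χ z • val z P = _
      rw [hχ1, one_smul]
  · rintro _ ⟨P, hP, rfl⟩
    exact ⟨_, ⟨restrict_mem_systemMod hWU F hP.1, restrict_mem_ordLT hWU hP.2⟩, val_restrict hWU P z⟩

theorem IsRegular.restrict {h : ℕ → ℕ} (hF : IsRegular (systemMod F : Set (Op U)) h) :
    IsRegular (systemMod fun j => (F j).restrict hWU : Set (Op W)) h := by
  refine isRegular_iff.2 fun k z => ?_
  rw [← hF.finrank_symbolSpace k (incl hWU z), symbolSpace_eq, symbolSpace_eq, fiber_trunc_restrict]

theorem lapRank_restrict (L : Op U) (n : ℕ) (z : W) :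
    lapRank (systemMod fun j => (F j).restrict hWU) (L.restrict hWU) n z =
      lapRank (systemMod F) L n (incl hWU z) := by
  rw [lapRank, lapRank, fiber_lapSum, fiber_lapSum, fiber_trunc_restrict, compVal_restrict]

theorem IsNondegenerate.restrict {L : Op U} (hL : IsNondegenerate L) :
    IsNondegenerate (L.restrict hWU) :=
  ⟨restrict_mem_ordLT hWU hL.mem, fun z => by
    rw [map_homogeneousComponent, val_restrict, ← map_homogeneousComponent]
    exact hL.ne_zero _⟩

end Restriction

/-! ## The generic behaviour -/

section Generic

variable {U : Opens (ℝ × ℝ)} {h : ℕ → ℕ} {L : Op U} {r : ℕ} {F : Fin r → Op U}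

theorem exists_opens_of_eventually {q : U} {p : U → Prop} (h : ∀ᶠ z in 𝓝 q, p z) :
    ∃ (W : Opens (ℝ × ℝ)) (hWU : W ≤ U), (q : ℝ × ℝ) ∈ W ∧ ∀ z : W, p (incl hWU z) := by
  obtain ⟨t, ht, hto, hqt⟩ := eventually_nhds_iff.1 h
  refine ⟨⟨Subtype.val '' t, U.isOpen.isOpenMap_subtype_val t hto⟩, ?_, ⟨q, hqt, rfl⟩, ?_⟩
  · rintro _ ⟨y, -, rfl⟩
    exact y.2
  · rintro ⟨_, ⟨y, hy, rfl⟩⟩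
    exact ht y hy

/-- Near a point there is an open set on which finitely many of the ranks are constant, provided a
condition that is open holds at the point. -/
theorem IsNondegenerate.exists_opens_lapRank_const {I : Submodule (Smooth U) (Op U)}
    (hL : IsNondegenerate L) (N : ℕ) {p : U → Prop}
    (hp : ∀ z, p z → ∀ᶠ y in 𝓝 z, p y) {q : U} (hq : p q) :
    ∃ (W : Opens (ℝ × ℝ)) (hWU : W ≤ U), (W : Set (ℝ × ℝ)).Nonempty ∧ (∀ z : W, p (incl hWU z)) ∧
      ∀ n < N, ∀ z z' : W, lapRank I L n (incl hWU z) = lapRank I L n (incl hWU z') := by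
  have : Nonempty {z // p z} := ⟨⟨q, hq⟩⟩
  -- Where the sum of the ranks is maximal, lower semicontinuity prevents each rank from dropping
  -- nearby and maximality prevents the sum from rising, so every rank is locally constant.
  obtain ⟨⟨q', hq'⟩, hmax⟩ := exists_maximum
    (fun z : {z // p z} => ∑ n ∈ Finset.range N, lapRank I L n z.1)
    (∑ n ∈ Finset.range N, tri (n + 1)) fun z => Finset.sum_le_sum fun n _ => hL.lapRank_le n z.1
  have h1 : ∀ᶠ z in 𝓝 q', ∀ n ∈ Finset.range N, lapRank I L n q' ≤ lapRank I L n z :=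
    (Filter.eventually_all_finset _).2 fun n _ => hL.eventually_le_lapRank n q'
  obtain ⟨W, hWU, hqW, hW⟩ := exists_opens_of_eventually (h1.and (hp q' hq'))
  have h2 : ∀ n < N, ∀ z : W, lapRank I L n (incl hWU z) = lapRank I L n q' := by
    intro n hn z
    have h3 := hmax ⟨incl hWU z, (hW z).2⟩
    exact (((Finset.sum_eq_sum_iff_of_le (hW z).1).1
      (le_antisymm (Finset.sum_le_sum (hW z).1) h3)) n (Finset.mem_range.2 hn)).symm
  exact ⟨W, hWU, ⟨_, hqW⟩, fun z => (hW z).2, fun n hn z z' => by rw [h2 n hn, h2 n hn]⟩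

/-- The first rank condition settles all orders from `m + 2` on, so regularity of the transform on a
smaller open set needs only finitely many ranks to be made constant. The second condition excludes
the old type. -/
theorem IsNondegenerate.generic (hL : IsNondegenerate L)
    (hI : IsRegular (systemMod F : Set (Op U)) h) (hh : HasClass h 3)
    (hA : IsAdapted (systemMod F : Set (Op U)) L) {d : Fin r → ℕ} {c m : ℕ}
    (hc : ∀ k < c, h k = k + 1)
    (hcd : (Finset.univ.filter fun j => d j = c).card + h c = c + 1) {q : U}
    (hq : tri (m + 2) + (m + 1) ≤ lapRank (systemMod F) L (m + 2) q)
    (hq' : tri (c + 1) + (c + 2 - h (c + 1)) + 1 ≤ lapRank (systemMod F) L (c + 1) q) :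
    (∀ h' : ℕ → ℕ, IsRegular (laplace (systemIdeal F) L) h' →
      HasClass h' 3 ∧ complexity h' 3 = complexity h 3 + 1 ∧
      ¬ HasType (laplace (systemIdeal F) L) d) ∧
    (∀ V : Opens (ℝ × ℝ), (q : ℝ × ℝ) ∈ V →
      ∃ (W : Opens (ℝ × ℝ)) (hWU : W ≤ U) (h' : ℕ → ℕ),
        W ≤ V ∧ (W : Set (ℝ × ℝ)).Nonempty ∧
        IsRegular (laplace (systemIdeal fun j => (F j).restrict hWU) (L.restrict hWU)) h' ∧
        HasClass h' 3 ∧ complexity h' 3 = complexity h 3 + 1 ∧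
        ¬ HasType (laplace (systemIdeal fun j => (F j).restrict hWU) (L.restrict hWU)) d) := by
  have hl := isLeft_systemMod F
  have hrank : ∀ z, tri (m + 2) + (m + 1) ≤ lapRank (systemMod F) L (m + 2) z → ∀ n ≥ m,
      lapRank (systemMod F) L (n + 2) z = tri (n + 2) + (n + 1) := fun z hz n hn =>
    le_antisymm (hL.lapRank_le_of_isAdapted hA n z) (hL.le_lapRank_of_le hl hA hn hz)
  simp only [← coe_systemMod, ← coe_laplaceMod]
  constructor
  · intro h' hJ
    obtain ⟨h1, h2⟩ := hL.laplace_class_eq hI hh hJ (q := q) (n₀ := m)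
      (fun n hn => Eventually.of_forall fun z => by
        rw [hrank q hq n hn]
        exact hL.lapRank_le_of_isAdapted hA n z) (hrank q hq)
    exact ⟨h1, h2, hL.not_hasType hI hc hcd hq'⟩
  · intro V hqV
    obtain ⟨W, hWU, ⟨y, hy⟩, hW, hconst⟩ := hL.exists_opens_lapRank_const (I := systemMod F) (m + 2)
      (p := fun z => (z : ℝ × ℝ) ∈ V ∧ tri (m + 2) + (m + 1) ≤ lapRank (systemMod F) L (m + 2) z ∧
        tri (c + 1) + (c + 2 - h (c + 1)) + 1 ≤ lapRank (systemMod F) L (c + 1) z)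
      (fun z hz => (continuous_subtype_val.continuousAt.eventually (V.isOpen.mem_nhds hz.1)).and
        (((hL.eventually_le_lapRank (m + 2) z).mono fun _ h => hz.2.1.trans h).and
        ((hL.eventually_le_lapRank (c + 1) z).mono fun _ h => hz.2.2.trans h)))
      (q := q) ⟨hqV, hq, hq'⟩
    set y' : W := ⟨y, hy⟩
    have : Nonempty W := ⟨y'⟩
    have hLW := hL.restrict hWU
    have hIW := hI.restrict hWU
    have hc' : ∀ n z z', lapRank (systemMod fun j => (F j).restrict hWU) (L.restrict hWU) n z =
        lapRank (systemMod fun j => (F j).restrict hWU) (L.restrict hWU) n z' := by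
      intro n z z'
      rw [lapRank_restrict, lapRank_restrict]
      rcases Nat.lt_or_ge n (m + 2) with hn | hn
      · exact hconst n hn z z'
      · obtain ⟨k, rfl⟩ : ∃ k, n = k + 2 := ⟨n - 2, by omega⟩
        rw [hrank _ (hW z).2.1 k (by omega), hrank _ (hW z').2.1 k (by omega)]
    obtain ⟨h', hJ⟩ := hLW.exists_isRegular_laplace hIW hc'
    obtain ⟨h1, h2⟩ := hLW.laplace_class_eq hIW hh hJ (q := y') (n₀ := m)
      (fun n _ => Eventually.of_forall fun z => (hc' _ z y').le)
      (fun n hn => by rw [lapRank_restrict, hrank _ (hW y').2.1 n hn])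
    refine ⟨W, hWU, h', fun z hz => (hW ⟨z, hz⟩).1, ⟨y, hy⟩, hJ, h1, h2, ?_⟩
    refine hLW.not_hasType hIW hc hcd (q := y') ?_
    rw [lapRank_restrict]
    exact (hW y').2.2

end Generic

/-! ## Rank conditions as differential polynomials -/

section DifferentialPolynomials

variable {r : ℕ}

/-- The total derivative of differential polynomials. -/
def totalD (i : Fin 2) : Derivation ℝ (DiffPoly r) (DiffPoly r) :=
  mkDerivation ℝ fun x => X (x.1, x.2.1, x.2.2 + Finsupp.single i 1)

variable {U : Opens (ℝ × ℝ)} (F : Fin r → Op U) (L : Op U)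

theorem DiffPoly.value_X (x : Option (Fin r) × (Fin 2 →₀ ℕ) × (Fin 2 →₀ ℕ)) :
    DiffPoly.value (X x) F L =
      (partialD 0)^[x.2.2 0] ((partialD 1)^[x.2.2 1] (coeff x.2.1 (x.1.elim L F))) := by
  rw [DiffPoly.value, aeval_X]

/-- Total derivative and partial derivative both satisfy the Leibniz rule, and they agree on the
variables. -/
theorem DiffPoly.value_totalD (i : Fin 2) (Δ : DiffPoly r) :
    (totalD i Δ).value F L = partialD i (Δ.value F L) := by
  induction Δ using MvPolynomial.induction_on with
  | C c =>
    have h1 : (C c : DiffPoly r) = algebraMap ℝ _ c := rfl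
    rw [h1, Derivation.map_algebraMap]
    simp only [DiffPoly.value, map_zero, AlgHom.commutes, partialD_algebraMap]
  | add p q hp hq =>
    simp only [DiffPoly.value, map_add] at hp hq ⊢
    rw [hp, hq, partialD_add]
  | mul_X p x hp =>
    have h1 : (totalD i (X x : DiffPoly r)).value F L = partialD i (DiffPoly.value (X x) F L) := by
      rw [totalD, mkDerivation_X, DiffPoly.value_X, DiffPoly.value_X]
      fin_cases i
      · simp [Function.iterate_succ_apply']
      · simp only [Finsupp.coe_add, Pi.add_apply]
        have h2 : Function.Commute (partialD (U := U) 1) ((partialD 0)^[x.2.2 0]) :=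
          Function.Commute.iterate_right (fun f => partialD_comm 1 0 f) _
        simp [Function.iterate_succ_apply', h2.eq]
    simp only [DiffPoly.value, Derivation.leibniz, map_add, smul_eq_mul, map_mul] at hp h1 ⊢
    rw [hp, h1, partialD_mul]
    ring

/-- By the Leibniz rule, coefficients of derivatives of an operator are universal expressions in
derivatives of its coefficients; the polynomial is chosen before the domain and the operators. -/
theorem exists_value_eq_coeff (j : Option (Fin r)) (α β : Fin 2 →₀ ℕ) :
    ∃ Δ : DiffPoly r, ∀ (U : Opens (ℝ × ℝ)) (F : Fin r → Op U) (L : Op U),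
      Δ.value F L = coeff β (Op.leftDPow α (j.elim L F)) := by
  induction α using exponent_induction generalizing β with
  | zero => exact ⟨X (j, β, 0), fun U F L => by rw [DiffPoly.value_X]; rfl⟩
  | step α i h =>
    obtain ⟨Δ, hΔ⟩ := h β
    obtain ⟨Δ', hΔ'⟩ := h (β - Finsupp.single i 1)
    refine ⟨totalD i Δ + if i ∈ β.support then Δ' else 0, fun U F L => ?_⟩
    have h1 : DiffPoly.value (totalD i Δ + if i ∈ β.support then Δ' else 0) F L =
        DiffPoly.value (totalD i Δ) F L +
          DiffPoly.value (if i ∈ β.support then Δ' else 0) F L := map_add _ _ _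
    rw [h1, DiffPoly.value_totalD, hΔ, leftDPow_add_single, coeff_leftD, coeff_X_mul']
    congr 1
    split_ifs
    · exact hΔ' U F L
    · exact map_zero _

/-- The differential polynomial whose value is the coefficient at `∂^β` of `∂^α ∘ F_j`. -/
def coeffPoly (j : Option (Fin r)) (α β : Fin 2 →₀ ℕ) : DiffPoly r :=
  (exists_value_eq_coeff j α β).choose

theorem value_coeffPoly (j : Option (Fin r)) (α β : Fin 2 →₀ ℕ) :
    (coeffPoly j α β).value F L = coeff β (Op.leftDPow α (j.elim L F)) :=
  (exists_value_eq_coeff j α β).choose_spec U F L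

/-- The exponents of degree `≤ n`. -/
def exponents (n : ℕ) : Finset (Fin 2 →₀ ℕ) := (Finsupp.finite_of_degree_le (σ := Fin 2) n).toFinset

theorem mem_exponents {n : ℕ} {α : Fin 2 →₀ ℕ} : α ∈ exponents n ↔ α.degree ≤ n := by
  rw [exponents, Set.Finite.mem_toFinset]
  rfl

/-- The derivatives of `F_j` and `L` of order `≤ n`, where `F_j` has order `d_j` and `L` order one. -/
def rowSet (d : Fin r → ℕ) (n : ℕ) : Finset (Option (Fin r) × (Fin 2 →₀ ℕ)) :=
  (Finset.univ ×ˢ exponents n).filter fun x => x.2.degree + x.1.elim 1 d ≤ n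

theorem mem_rowSet {d : Fin r → ℕ} {n : ℕ} {x : Option (Fin r) × (Fin 2 →₀ ℕ)} :
    x ∈ rowSet d n ↔ x.2.degree + x.1.elim 1 d ≤ n := by
  rw [rowSet, Finset.mem_filter, Finset.mem_product, mem_exponents]
  constructor
  · exact fun h => h.2
  · exact fun h => ⟨⟨Finset.mem_univ _, by omega⟩, h⟩

/-- The values at `q` of the derivatives of `F_j` and `L` of order `≤ n`. -/
def rowSpan (d : Fin r → ℕ) (n : ℕ) (q : U) : Submodule ℝ (MvPolynomial (Fin 2) ℝ) :=
  Submodule.span ℝ ((fun x : Option (Fin r) × (Fin 2 →₀ ℕ) =>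
    val q (Op.leftDPow x.2 (x.1.elim L F))) '' rowSet d n)

/-- The Gram determinant of `k` rows. -/
def gramPoly (n : ℕ) {k : ℕ} (ρ : Fin k → Option (Fin r) × (Fin 2 →₀ ℕ)) : DiffPoly r :=
  (Matrix.of fun a b : Fin k => ∑ β ∈ exponents n,
    coeffPoly (ρ a).1 (ρ a).2 β * coeffPoly (ρ b).1 (ρ b).2 β).det

/-- A differential polynomial expressing that the rank of the derivatives of order `≤ n` is at
least `k`. -/
def rankPoly (d : Fin r → ℕ) (n k : ℕ) : DiffPoly r :=
  ∑ ρ ∈ Fintype.piFinset fun _ : Fin k => rowSet d n, gramPoly n ρ ^ 2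

theorem evalAt_gramPoly (n : ℕ) {k : ℕ} (ρ : Fin k → Option (Fin r) × (Fin 2 →₀ ℕ)) (q : U) :
    evalAt q ((gramPoly n ρ).value F L) =
      (Matrix.of fun a b : Fin k => ∑ β ∈ exponents n,
        coeff β (val q (Op.leftDPow (ρ a).2 ((ρ a).1.elim L F))) *
        coeff β (val q (Op.leftDPow (ρ b).2 ((ρ b).1.elim L F)))).det := by
  rw [gramPoly, DiffPoly.value, AlgHom.map_det, RingHom.map_det]
  congr 1
  ext a b
  simp only [AlgHom.mapMatrix_apply, RingHom.mapMatrix_apply, Matrix.map_apply, Matrix.of_apply,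
    map_sum, map_mul]
  refine Finset.sum_congr rfl fun β _ => ?_
  have h := fun j α => value_coeffPoly F L j α β
  simp only [DiffPoly.value] at h
  rw [h, h, coeff_map, coeff_map]

/-- The sum over `exponents n` is a positive definite form on polynomials of degree `≤ n`: a null
vector of the Gram matrix gives a combination whose squared coefficients sum to zero. -/
theorem gram_det_ne_zero {n k : ℕ} {x : Fin k → MvPolynomial (Fin 2) ℝ}
    (hx : ∀ a, x a ∈ ordLT ℝ (n + 1)) :
    (Matrix.of fun a b : Fin k => ∑ β ∈ exponents n, coeff β (x a) * coeff β (x b)).det ≠ 0 ↔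
      LinearIndependent ℝ x := by
  have hvec : ∀ (c : Fin k → ℝ) (b : Fin k), Matrix.vecMul c
      (Matrix.of fun a b : Fin k => ∑ β ∈ exponents n, coeff β (x a) * coeff β (x b)) b =
      ∑ β ∈ exponents n, coeff β (∑ a, c a • x a) * coeff β (x b) := by
    intro c b
    simp only [Matrix.vecMul, dotProduct, Matrix.of_apply, coeff_sum, coeff_smul, smul_eq_mul,
      Finset.sum_mul, Finset.mul_sum]
    rw [Finset.sum_comm]
    exact Finset.sum_congr rfl fun β _ => Finset.sum_congr rfl fun a _ => by ring
  constructor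
  · intro h
    refine Fintype.linearIndependent_iff.2 fun c hc => ?_
    refine congrFun (Matrix.eq_zero_of_vecMul_eq_zero h (funext fun b => ?_))
    rw [hvec, hc]
    simp
  · intro h h0
    obtain ⟨c, hc, hc0⟩ := Matrix.exists_vecMul_eq_zero_iff.2 h0
    refine hc (funext fun a => Fintype.linearIndependent_iff.1 h c ?_ a)
    set u := ∑ a, c a • x a with hu
    have h1 : ∑ β ∈ exponents n, coeff β u * coeff β u = 0 := by
      have h2 : ∑ b, c b * ∑ β ∈ exponents n, coeff β u * coeff β (x b) = 0 :=
        Finset.sum_eq_zero fun b _ => by rw [← hvec, hc0, Pi.zero_apply, mul_zero]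
      rw [← h2]
      conv_lhs => enter [2, β, 2]; rw [hu]
      simp only [coeff_sum, coeff_smul, smul_eq_mul, Finset.mul_sum]
      rw [Finset.sum_comm]
      exact Finset.sum_congr rfl fun β _ => Finset.sum_congr rfl fun a _ => by ring
    have hmem : u ∈ ordLT ℝ (n + 1) :=
      Submodule.sum_mem _ fun a _ => Submodule.smul_mem _ _ (hx a)
    ext β
    rw [coeff_zero]
    by_cases hβ : β.degree ≤ n
    · exact mul_self_eq_zero.1 ((Finset.sum_eq_zero_iff_of_nonneg fun β _ => mul_self_nonneg _).1 h1 β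
        (mem_exponents.2 hβ))
    · exact mem_ordLT.1 hmem β (by omega)

variable {F L} {d : Fin r → ℕ}

theorem leftDPow_elim_mem_ordLT (hF : ∀ j, F j ∈ ordLT (Smooth U) (d j + 1))
    (hL : L ∈ ordLT (Smooth U) 2) {n : ℕ} {x : Option (Fin r) × (Fin 2 →₀ ℕ)}
    (hx : x ∈ rowSet d n) : Op.leftDPow x.2 (x.1.elim L F) ∈ ordLT (Smooth U) (n + 1) := by
  have h1 : x.1.elim L F ∈ ordLT (Smooth U) (x.1.elim 1 d + 1) := by
    cases x.1 with
    | none => exact hL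
    | some j => exact hF j
  have h2 := mem_rowSet.1 hx
  exact ordLT_mono (by omega) (leftDPow_mem_ordLT x.2 h1)

/-- Over the reals a sum of squares is nonzero exactly when one term is, that is, when some `k` rows
are independent. One differential polynomial thus expresses a rank condition. -/
theorem evalAt_rankPoly_ne_zero (hF : ∀ j, F j ∈ ordLT (Smooth U) (d j + 1))
    (hL : L ∈ ordLT (Smooth U) 2) {n k : ℕ} {q : U} :
    evalAt q ((rankPoly d n k).value F L) ≠ 0 ↔ k ≤ Module.finrank ℝ (rowSpan F L d n q) := by
  have h1 : evalAt q ((rankPoly d n k).value F L) =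
      ∑ ρ ∈ Fintype.piFinset fun _ : Fin k => rowSet d n,
        evalAt q ((gramPoly n ρ).value F L) ^ 2 := by
    simp only [rankPoly, DiffPoly.value, map_sum, map_pow]
  have hle : rowSpan F L d n q ≤ ordLT ℝ (n + 1) := by
    refine Submodule.span_le.2 ?_
    rintro _ ⟨x, hx, rfl⟩
    exact map_mem_ordLT _ (leftDPow_elim_mem_ordLT hF hL hx)
  have hfd := finiteDimensional_of_le_ordLT hle
  rw [h1, Ne, Finset.sum_eq_zero_iff_of_nonneg fun ρ _ => sq_nonneg _]
  have hrow : ∀ ρ ∈ Fintype.piFinset fun _ : Fin k => rowSet d n,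
      evalAt q ((gramPoly n ρ).value F L) ≠ 0 ↔
        LinearIndependent ℝ fun a => val q (Op.leftDPow (ρ a).2 ((ρ a).1.elim L F)) := fun ρ hρ => by
    rw [evalAt_gramPoly]
    exact gram_det_ne_zero fun a =>
      map_mem_ordLT _ (leftDPow_elim_mem_ordLT hF hL (Fintype.mem_piFinset.1 hρ a))
  constructor
  · intro h
    push Not at h
    obtain ⟨ρ, hρ, hne⟩ := h
    have hli := (hrow ρ hρ).1 fun h0 => hne (by rw [h0]; norm_num)
    have h2 := finrank_span_eq_card hli
    rw [Fintype.card_fin] at h2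
    rw [← h2]
    refine Submodule.finrank_mono (Submodule.span_mono ?_)
    rintro _ ⟨a, rfl⟩
    exact ⟨ρ a, Fintype.mem_piFinset.1 hρ a, rfl⟩
  · intro h h0
    obtain ⟨b, hb, hspan, hli⟩ := exists_linearIndependent ℝ
      ((fun x : Option (Fin r) × (Fin 2 →₀ ℕ) =>
        val q (Op.leftDPow x.2 (x.1.elim L F))) '' rowSet d n)
    have hfin : b.Finite := ((rowSet d n).finite_toSet.image _).subset hb
    have := hfin.fintype
    have h2 := finrank_span_set_eq_card hli
    rw [hspan] at h2
    change Module.finrank ℝ (rowSpan F L d n q) = _ at h2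
    rw [h2, Set.toFinset_card] at h
    obtain ⟨e⟩ := Function.Embedding.nonempty_of_card_le
      (α := Fin k) (β := b) (by rwa [Fintype.card_fin])
    choose ρ hρ hρe using fun a => hb (e a).2
    have hρ' : ρ ∈ Fintype.piFinset fun _ : Fin k => rowSet d n := Fintype.mem_piFinset.2 hρ
    refine (hrow ρ hρ').2 ?_ (pow_eq_zero_iff (two_ne_zero) |>.1 (h0 ρ hρ'))
    have h3 : (fun a => val q (Op.leftDPow (ρ a).2 ((ρ a).1.elim L F))) =
        fun a => ((e a : b) : MvPolynomial (Fin 2) ℝ) := funext hρe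
    rw [h3]
    exact hli.comp _ e.injective

/-- Only an inclusion: combinations of higher derivatives may drop in order and give further
elements of `I`. A nonzero `rankPoly` is therefore a sufficient condition for a large `lapRank`. -/
theorem rowSpan_le_fiber (hF : ∀ j, F j ∈ ordLT (Smooth U) (d j + 1)) (hL : L ∈ ordLT (Smooth U) 2)
    (n : ℕ) (q : U) : rowSpan F L d n q ≤ fiber (lapSum (systemMod F) L n) q := by
  refine Submodule.span_le.2 ?_
  rintro _ ⟨⟨j, α⟩, hx, rfl⟩
  refine val_mem_fiber ?_ q
  cases j with
  | none =>
    refine Submodule.mem_sup_right ⟨monomial α 1, monomial_mem_ordLT ?_ 1, ?_⟩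
    · have := mem_rowSet.1 hx
      simp only [Option.elim_none] at this
      omega
    · rw [← comp_eq, comp_monomial, C_1, one_mul]
      rfl
  | some j =>
    exact Submodule.mem_sup_left
      ⟨leftDPow_mem_systemMod F j α, leftDPow_elim_mem_ordLT hF hL hx⟩

theorem le_lapRank_of_rankPoly (hF : ∀ j, F j ∈ ordLT (Smooth U) (d j + 1))
    (hL : IsNondegenerate L) {n k : ℕ} {q : U} (h : evalAt q ((rankPoly d n k).value F L) ≠ 0) :
    k ≤ lapRank (systemMod F) L n q := by
  refine ((evalAt_rankPoly_ne_zero hF hL.mem).1 h).trans ?_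
  have := finiteDimensional_of_le_ordLT (fiber_le_ordLT (hL.lapSum_le (I := systemMod F) n) q)
  exact Submodule.finrank_mono (rowSpan_le_fiber hF hL.mem n q)

/-- The values of the derivatives of `L` fill the values of `D ∘ L`. -/
theorem map_compVal_le_rowSpan (F : Fin r → Op U) (L : Op U) (d : Fin r → ℕ) (n : ℕ) (q : U) :
    (ordLT ℝ n).map (compVal L q) ≤ rowSpan F L d n q := by
  rw [ordLT_eq_span, Submodule.map_span]
  refine Submodule.span_le.2 ?_
  rintro _ ⟨_, ⟨α, hα, rfl⟩, rfl⟩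
  refine Submodule.subset_span ⟨(none, α), mem_rowSet.2 ?_, ?_⟩
  · simp only [Set.mem_ofPred_eq] at hα
    simp only [Option.elim_none]
    omega
  · simp only [compVal_monomial, one_smul, Option.elim_none]

end DifferentialPolynomials

/-! ## Generators of the symbols -/

section Generators

/-- The forms of degree `k` in the ideal generated by forms `f_j` of degrees `d_j`. -/
def genSpan {r : ℕ} (d : Fin r → ℕ) (f : Fin r → MvPolynomial (Fin 2) ℝ) (k : ℕ) :
    Submodule ℝ (MvPolynomial (Fin 2) ℝ) :=
  Submodule.span ℝ {u | ∃ j, ∃ α : Fin 2 →₀ ℕ, α.degree + d j = k ∧ u = monomial α 1 * f j}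

variable {r : ℕ} {d : Fin r → ℕ} {f : Fin r → MvPolynomial (Fin 2) ℝ}

theorem monomial_mul_mem_genSpan (d : Fin r → ℕ) (f : Fin r → MvPolynomial (Fin 2) ℝ) (j : Fin r)
    {α : Fin 2 →₀ ℕ} {k : ℕ} (h : α.degree + d j = k) : monomial α 1 * f j ∈ genSpan d f k :=
  Submodule.subset_span ⟨j, α, h, rfl⟩

theorem genSpan_map_mulLeft (σ : MvPolynomial (Fin 2) ℝ) (k : ℕ) :
    (genSpan d f k).map (LinearMap.mulLeft ℝ σ) = genSpan d (fun j => σ * f j) k := by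
  rw [genSpan, Submodule.map_span, genSpan]
  congr 1
  ext u
  constructor
  · rintro ⟨_, ⟨j, α, h, rfl⟩, rfl⟩
    exact ⟨j, α, h, mul_left_comm _ _ _⟩
  · rintro ⟨j, α, h, rfl⟩
    exact ⟨_, ⟨j, α, h, rfl⟩, mul_left_comm _ _ _⟩

theorem X_mul_mem_genSpan (i : Fin 2) {k : ℕ} {u : MvPolynomial (Fin 2) ℝ}
    (hu : u ∈ genSpan d f k) : X i * u ∈ genSpan d f (k + 1) := by
  have hle : genSpan d f k ≤ (genSpan d f (k + 1)).comap (LinearMap.mulLeft ℝ (X i)) := by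
    refine Submodule.span_le.2 ?_
    rintro _ ⟨j, α, h, rfl⟩
    refine Submodule.subset_span ⟨j, α + Finsupp.single i 1, ?_, ?_⟩
    · rw [map_add, Finsupp.degree_single]
      omega
    · rw [LinearMap.mulLeft_apply, ← mul_assoc, X, monomial_mul, one_mul, add_comm]
  exact hle hu

theorem genSpan_le_homogeneousSubmodule (hf : ∀ j, (f j).IsHomogeneous (d j)) (k : ℕ) :
    genSpan d f k ≤ homogeneousSubmodule (Fin 2) ℝ k := by
  refine Submodule.span_le.2 ?_
  rintro _ ⟨j, α, rfl, rfl⟩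
  exact (isHomogeneous_monomial 1 rfl).mul (hf j)

variable {U : Opens (ℝ × ℝ)}

/-- The symbols of a system of type `∑ E_{d_j}` are generated by symbols of orders `d_j`. -/
theorem exists_symbolSpace_eq_genSpan {I : Submodule (Smooth U) (Op U)} (hI : IsLeft I)
    (ht : HasType (I : Set (Op U)) d) (q : U) :
    ∃ f : Fin r → MvPolynomial (Fin 2) ℝ, (∀ j, f j ∈ symbolSpace (I : Set (Op U)) (d j) q) ∧
      ∀ k, symbolSpace (I : Set (Op U)) k q = genSpan d f k := by
  -- The type says that the symbols modulo prolongations have a basis indexed by the `j` with `d j =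
  -- k`; lifts of this basis are the generators of degree `k`.
  have hgen : ∀ k, ∃ g : {j // d j = k} → symbolSpace (I : Set (Op U)) k q,
      Submodule.span ℝ (Set.range g) ⊔
        (prolongedSymbols (I : Set (Op U)) k q).comap
          (symbolSpace (I : Set (Op U)) k q).subtype = ⊤ := by
    intro k
    set P := (prolongedSymbols (I : Set (Op U)) k q).comap (symbolSpace (I : Set (Op U)) k q).subtype
      with hP
    have h1 : Module.finrank ℝ (symbolSpace (I : Set (Op U)) k q ⧸ P) =
        Fintype.card {j // d j = k} := by
      rw [Fintype.card_subtype]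
      exact ht k q
    let b := (Module.finBasisOfFinrankEq ℝ _ h1).reindex (Fintype.equivFin _).symm
    choose g hg using fun j => P.mkQ_surjective (b j)
    refine ⟨g, ?_⟩
    have h2 : (Submodule.span ℝ (Set.range g)).map P.mkQ = ⊤ := by
      rw [Submodule.map_span, ← Set.range_comp, ← b.span_eq]
      congr 2
      exact funext hg
    have h3 := Submodule.comap_map_eq P.mkQ (Submodule.span ℝ (Set.range g))
    rw [h2, Submodule.comap_top, Submodule.ker_mkQ] at h3
    exact h3.symm
  choose g hg using hgen
  have hf : ∀ j, (g (d j) ⟨j, rfl⟩ : MvPolynomial (Fin 2) ℝ) ∈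
      symbolSpace (I : Set (Op U)) (d j) q := fun j => (g (d j) ⟨j, rfl⟩).2
  have h4 : ∀ j m (hm : d j = m),
      (g m ⟨j, hm⟩ : MvPolynomial (Fin 2) ℝ) = g (d j) ⟨j, rfl⟩ := by
    rintro j _ rfl
    rfl
  refine ⟨fun j => g (d j) ⟨j, rfl⟩, hf, fun k => le_antisymm ?_ ?_⟩
  · induction k with
    | zero =>
      intro u hu
      have h1 : (⟨u, hu⟩ : symbolSpace (I : Set (Op U)) 0 q) ∈ (⊤ : Submodule ℝ _) := trivial
      rw [← hg 0] at h1
      obtain ⟨x, hx, y, hy, hxy⟩ := Submodule.mem_sup.1 h1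
      have hxy' : (x : MvPolynomial (Fin 2) ℝ) + y = u := congrArg Subtype.val hxy
      rw [← hxy']
      refine Submodule.add_mem _ ?_ ?_
      · have h2 := Submodule.mem_map_of_mem (f := Submodule.subtype _) hx
        rw [Submodule.map_span] at h2
        refine Submodule.span_mono ?_ h2
        rintro _ ⟨_, ⟨⟨j, hj⟩, rfl⟩, rfl⟩
        refine ⟨j, 0, by rw [map_zero, zero_add, hj], ?_⟩
        exact (h4 j 0 hj).trans (one_mul _).symm
      · have h2 : (y : MvPolynomial (Fin 2) ℝ) ∈ (⊥ : Submodule ℝ (MvPolynomial (Fin 2) ℝ)) := hy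
        rw [(Submodule.mem_bot ℝ).1 h2]
        exact Submodule.zero_mem _
    | succ k ih =>
      intro u hu
      have h1 : (⟨u, hu⟩ : symbolSpace (I : Set (Op U)) (k + 1) q) ∈ (⊤ : Submodule ℝ _) := trivial
      rw [← hg (k + 1)] at h1
      obtain ⟨x, hx, y, hy, hxy⟩ := Submodule.mem_sup.1 h1
      have hxy' : (x : MvPolynomial (Fin 2) ℝ) + y = u := congrArg Subtype.val hxy
      rw [← hxy']
      refine Submodule.add_mem _ ?_ ?_
      · have h2 := Submodule.mem_map_of_mem (f := Submodule.subtype _) hx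
        rw [Submodule.map_span] at h2
        refine Submodule.span_mono ?_ h2
        rintro _ ⟨_, ⟨⟨j, hj⟩, rfl⟩, rfl⟩
        refine ⟨j, 0, by rw [map_zero, zero_add, hj], ?_⟩
        exact (h4 j (k + 1) hj).trans (one_mul _).symm
      · have h2 : (y : MvPolynomial (Fin 2) ℝ) ∈
          ⨆ i : Fin 2, (symbolSpace (I : Set (Op U)) k q).map (LinearMap.mulLeft ℝ (X i)) := hy
        refine (iSup_le fun i => ?_ : _ ≤ genSpan d _ (k + 1)) h2
        rintro _ ⟨z, hz, rfl⟩
        exact X_mul_mem_genSpan i (ih hz)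
  · refine Submodule.span_le.2 ?_
    rintro _ ⟨j, α, rfl, rfl⟩
    clear hg
    induction α using exponent_induction with
    | zero =>
      rw [map_zero, zero_add]
      change 1 * _ ∈ _
      rw [one_mul]
      exact hf j
    | step α i h =>
      have h2 : (monomial (α + Finsupp.single i 1) 1 : MvPolynomial (Fin 2) ℝ) =
          X i * monomial α 1 := by rw [X, monomial_mul, one_mul, add_comm]
      rw [h2, mul_assoc, map_add, Finsupp.degree_single, add_right_comm]
      exact hI.X_mul_mem_symbolSpace i h

end Generators

/-! ## Systems of left multiples of one operator -/

section LeftMultiples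

variable {U : Opens (ℝ × ℝ)} {r : ℕ} {e : Fin r → ℕ} {w : Fin r → MvPolynomial (Fin 2) ℝ} {N : Op U}

/-- The system `w_j(∂) ∘ N = 0`. -/
def multiples (w : Fin r → MvPolynomial (Fin 2) ℝ) (N : Op U) : Fin r → Op U :=
  fun j => Op.comp (cst U (w j)) N

theorem leftDPow_multiples (w : Fin r → MvPolynomial (Fin 2) ℝ) (N : Op U) (α : Fin 2 →₀ ℕ)
    (j : Fin r) : Op.leftDPow α (multiples w N j) = Op.comp (cst U (monomial α 1 * w j)) N := by
  rw [multiples, ← leftDPow_comp, leftDPow_cst]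

theorem exists_comp_eq_of_mem_multiples {P : Op U} (hP : P ∈ systemMod (multiples w N)) :
    ∃ c : Fin r × (Fin 2 →₀ ℕ) →₀ Smooth U,
      P = Op.comp (c.sum fun jα a => a • cst U (monomial jα.2 1 * w jα.1)) N := by
  obtain ⟨c, rfl⟩ := Finsupp.mem_span_range_iff_exists_finsupp.1 hP
  refine ⟨c, ?_⟩
  rw [comp_eq, Finsupp.sum, Finsupp.sum, map_sum]
  refine Finset.sum_congr rfl fun jα _ => ?_
  rw [leftDPow_multiples, map_smul, comp_eq]

/-- The symbol of `N` vanishes nowhere, so `Q ∘ N` drops in order only if `Q` does. As the `w_j` are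
homogeneous with constant coefficients, the leading part of `Q` is again a combination of their
multiples. Hence there are no hidden compatibility conditions. -/
theorem symbolSpace_multiples {b : ℕ} (hN : N ∈ ordLT (Smooth U) (b + 1))
    (hN0 : ∀ q, val q (homogeneousComponent b N) ≠ 0) (hw : ∀ j, (w j).IsHomogeneous (e j))
    (k : ℕ) (q : U) :
    symbolSpace (systemMod (multiples w N) : Set (Op U)) k q =
      genSpan (fun j => e j + b) (fun j => val q (homogeneousComponent b N) * w j) k := by
  have hhom : ∀ (α : Fin 2 →₀ ℕ) (j : Fin r),
      (monomial α 1 * w j : MvPolynomial (Fin 2) ℝ).IsHomogeneous (α.degree + e j) :=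
    fun α j => (isHomogeneous_monomial 1 rfl).mul (hw j)
  refine le_antisymm ?_ (Submodule.span_le.2 ?_)
  · intro σ hσ
    obtain ⟨P, hP, rfl⟩ := mem_symbolSpace.1 hσ
    obtain ⟨c, hc⟩ := exists_comp_eq_of_mem_multiples hP.1
    set Q := c.sum fun jα a => a • cst U (monomial jα.2 1 * w jα.1) with hQ
    rcases Nat.lt_or_ge k b with hk | hk
    · have h1 : P ∈ ordLT (Smooth U) (0 + b) := ordLT_mono (by omega) hP.2
      have h2 : Q = 0 := by
        rw [hc] at h1
        have h2 := mem_ordLT_of_comp hN hN0 h1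
        rwa [ordLT_zero, Submodule.mem_bot] at h2
      rw [hc, h2, zero_comp, map_zero, map_zero]
      exact Submodule.zero_mem _
    · obtain ⟨m, rfl⟩ : ∃ m, k = m + b := ⟨k - b, by omega⟩
      have h1 : P ∈ ordLT (Smooth U) (m + 1 + b) := ordLT_mono (by omega) hP.2
      rw [hc] at h1 ⊢
      rw [homogeneousComponent_comp (mem_ordLT_of_comp hN hN0 h1) hN, map_mul,
        show val q (homogeneousComponent m Q) = homogeneousComponent m (val q Q) from
          map_homogeneousComponent _ _ _, hQ, Finsupp.sum, map_sum, map_sum, Finset.sum_mul]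
      refine Submodule.sum_mem _ fun jα _ => ?_
      rw [val_smul, val_cst, map_smul, smul_mul_assoc]
      refine Submodule.smul_mem _ _ ?_
      by_cases h2 : jα.2.degree + e jα.1 = m
      · have h3 := hhom jα.2 jα.1
        rw [h2] at h3
        rw [homogeneousComponent_eq_self h3, mul_assoc, mul_comm (w jα.1)]
        exact monomial_mul_mem_genSpan _ (fun j => val q (homogeneousComponent b N) * w j) _
          (by omega)
      · rw [homogeneousComponent_of_mem (hhom jα.2 jα.1), if_neg (Ne.symm h2), zero_mul]
        exact Submodule.zero_mem _
  · rintro _ ⟨j, α, (h : α.degree + (e j + b) = k), rfl⟩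
    have h1 : cst U (monomial α 1 * w j) ∈ ordLT (Smooth U) (α.degree + e j + 1) :=
      cst_mem_ordLT (IsHomogeneous.mem_ordLT (hhom α j) (Nat.lt_succ_self _))
    refine mem_symbolSpace.2 ⟨Op.leftDPow α (multiples w N j),
      ⟨leftDPow_mem_systemMod _ _ _, ?_⟩, ?_⟩
    · rw [leftDPow_multiples]
      exact ordLT_mono (by omega) (comp_mem_ordLT h1 hN)
    · rw [leftDPow_multiples, ← h, ← add_assoc, homogeneousComponent_comp h1 hN, map_mul,
        show val q (homogeneousComponent (α.degree + e j) (cst U (monomial α 1 * w j))) =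
          homogeneousComponent (α.degree + e j) (val q (cst U (monomial α 1 * w j))) from
          map_homogeneousComponent _ _ _, val_cst, homogeneousComponent_eq_self (hhom α j), mul_assoc,
        mul_comm (w j)]

theorem multiples_mem_ordLT {b : ℕ} (hN : N ∈ ordLT (Smooth U) (b + 1))
    (hw : ∀ j, (w j).IsHomogeneous (e j)) (j : Fin r) :
    multiples w N j ∈ ordLT (Smooth U) (e j + b + 1) :=
  comp_mem_ordLT (a := e j) (b := b + 1)
    (cst_mem_ordLT (IsHomogeneous.mem_ordLT (hw j) (Nat.lt_succ_self _))) hN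

/-- If the elements of `I` are left multiples of `N = G ∘ L + R` with `R` of order `≤ 1`, then `L` is
adapted. -/
theorem isAdapted_of_comp {I : Submodule (Smooth U) (Op U)} {L G : Op U}
    (hN : N ∈ ordLT (Smooth U) (3 + 1)) (hN0 : ∀ q, val q (homogeneousComponent 3 N) ≠ 0)
    (hI : ∀ P ∈ I, ∃ Q, P = Op.comp Q N) (hG : G ∈ ordLT (Smooth U) (2 + 1))
    (hR : N - Op.comp G L ∈ ordLT (Smooth U) (1 + 1)) : IsAdapted (I : Set (Op U)) L := by
  refine PlanePDE.isAdapted_iff.2 fun k P hP => ?_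
  obtain ⟨Q, rfl⟩ := hI P hP.1
  have hQ : Q ∈ ordLT (Smooth U) k := mem_ordLT_of_comp hN hN0 hP.2
  refine ⟨Op.comp Q G, comp_mem_ordLT' hQ hG, ?_⟩
  rw [comp_assoc, ← comp_sub]
  exact comp_mem_ordLT' hQ hR

theorem multiples_isAdapted {L G : Op U}
    (hN : N ∈ ordLT (Smooth U) (3 + 1)) (hN0 : ∀ q, val q (homogeneousComponent 3 N) ≠ 0)
    (hG : G ∈ ordLT (Smooth U) (2 + 1)) (hR : N - Op.comp G L ∈ ordLT (Smooth U) (1 + 1)) :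
    IsAdapted (systemMod (multiples w N) : Set (Op U)) L :=
  isAdapted_of_comp hN hN0 (fun _ hP => by
    obtain ⟨c, hc⟩ := exists_comp_eq_of_mem_multiples hP
    exact ⟨_, hc⟩) hG hR

end LeftMultiples

/-! ## Systems with prescribed symbols -/

section SameSymbols

variable {U U₀ : Opens (ℝ × ℝ)} {r : ℕ} {d : Fin r → ℕ} {h : ℕ → ℕ}

theorem newEquations_congr {I : Set (Op U)} {I₀ : Set (Op U₀)} {q : U} {q₀ : U₀}
    (hS : ∀ k, symbolSpace I k q = symbolSpace I₀ k q₀) (k : ℕ) :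
    newEquations I k q = newEquations I₀ k q₀ := by
  have hP : prolongedSymbols I k q = prolongedSymbols I₀ k q₀ := by
    cases k with
    | zero => rfl
    | succ k => simp only [prolongedSymbols, hS]
  have key : ∀ S S' P P' : Submodule ℝ (MvPolynomial (Fin 2) ℝ), S = S' → P = P' →
      Module.finrank ℝ (S ⧸ P.comap S.subtype) = Module.finrank ℝ (S' ⧸ P'.comap S'.subtype) := by
    rintro S _ P _ rfl rfl
    rfl
  exact key _ _ _ _ (hS k) hP

theorem gSymbol_congr {I : Set (Op U)} {I₀ : Set (Op U₀)} {q : U} {q₀ : U₀} {k : ℕ}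
    (hS : symbolSpace I k q = symbolSpace I₀ k q₀) : gSymbol I k q = gSymbol I₀ k q₀ := by
  rw [gSymbol, gSymbol, hS]

/-- A system with the symbols of a system of class three is such a system itself. -/
theorem IsClassThreeOfType.of_symbolSpace_eq {F₀ : Fin r → Op U₀} {v₀ : Fin 3 → Fin 2 → Smooth U₀}
    (h₀ : IsClassThreeOfType d h F₀ v₀) {F : Fin r → Op U} {v : Fin 3 → Fin 2 → Smooth U}
    (hF : ∀ j, F j ∈ ordLT (Smooth U) (d j + 1))
    (hS : ∀ q : U, ∃ q₀ : U₀, (∀ i j, evalAt q (v i j) = evalAt q₀ (v₀ i j)) ∧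
      ∀ k, symbolSpace (systemIdeal F) k q = symbolSpace (systemIdeal F₀) k q₀) :
    IsClassThreeOfType d h F v where
  regular k q := by
    obtain ⟨q₀, -, hq⟩ := hS q
    rw [gSymbol_congr (hq k)]
    exact h₀.regular k q₀
  hasClass := h₀.hasClass
  independent i j hij q := by
    obtain ⟨q₀, hv, -⟩ := hS q
    rw [hv, hv, hv, hv]
    exact h₀.independent i j hij q₀
  characteristic i k q σ hσ := by
    obtain ⟨q₀, hv, hq⟩ := hS q
    rw [hv, hv]
    rw [hq] at hσ
    exact h₀.characteristic i k q₀ σ hσ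
  order_le j := totalDegree_le_iff.2 (hF j)
  hasType k q := by
    obtain ⟨q₀, -, hq⟩ := hS q
    rw [newEquations_congr hq]
    exact h₀.hasType k q₀

end SameSymbols

/-! ## Independence of families depending on a parameter -/

section Parameter

theorem exists_dual_functionals {V : Type*} [AddCommGroup V] [Module ℝ V] {k : ℕ} {u : Fin k → V}
    (hu : LinearIndependent ℝ u) : ∃ φ : Fin k → V →ₗ[ℝ] ℝ, ∀ a b, φ b (u a) = if a = b then 1 else 0 := by
  obtain ⟨f, hf⟩ := LinearMap.exists_leftInverse_of_injective
    (Fintype.linearCombination ℝ u) (LinearMap.ker_eq_bot.2 hu.fintypeLinearCombination_injective)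
  refine ⟨fun b => LinearMap.proj b ∘ₗ f, fun a b => ?_⟩
  have h1 := LinearMap.congr_fun hf (Pi.single a 1)
  rw [LinearMap.comp_apply, Fintype.linearCombination_apply_single, one_smul] at h1
  rw [LinearMap.comp_apply, h1, LinearMap.id_apply, LinearMap.proj_apply, Pi.single_apply]
  simp only [eq_comm]

/-- Tested against `φ`, independence fails only at roots of a determinant that is a polynomial in
`t`. -/
theorem finite_not_linearIndependent {V : Type*} [AddCommGroup V] [Module ℝ V] {k : ℕ}
    (u x : Fin k → V) (φ : Fin k → V →ₗ[ℝ] ℝ)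
    (h : ((Polynomial.X : Polynomial ℝ) • (Matrix.of fun a b => φ b (x a)).map Polynomial.C +
      (Matrix.of fun a b => φ b (u a)).map Polynomial.C).det ≠ 0) :
    {t : ℝ | ¬ LinearIndependent ℝ fun a => u a + t • x a}.Finite := by
  refine (Polynomial.finite_setOfPred_isRoot h).subset fun t ht => ?_
  by_contra hc
  refine ht (linearIndependent_of_det _ φ fun h0 => hc ?_)
  have h1 : Polynomial.evalRingHom t ((Polynomial.X : Polynomial ℝ) •
      (Matrix.of fun a b => φ b (x a)).map Polynomial.C +
      (Matrix.of fun a b => φ b (u a)).map Polynomial.C).det = 0 := by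
    rw [RingHom.map_det, ← h0]
    congr 1
    ext a b
    simp [add_comm]
    exact mul_comm _ _
  exact h1

/-- An affine family that is independent for one value of the parameter is so for almost all. -/
theorem finite_not_linearIndependent_of_left {V : Type*} [AddCommGroup V] [Module ℝ V] {k : ℕ}
    {u : Fin k → V} (hu : LinearIndependent ℝ u) (x : Fin k → V) :
    {t : ℝ | ¬ LinearIndependent ℝ fun a => u a + t • x a}.Finite := by
  obtain ⟨φ, hφ⟩ := exists_dual_functionals hu
  refine finite_not_linearIndependent u x φ fun h0 => ?_
  -- With `φ` dual to `u`, the constant term of the determinant is one.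
  have h1 := Polynomial.coeff_det_X_add_C_zero (Matrix.of fun a b => φ b (x a))
    (Matrix.of fun a b => φ b (u a))
  have h2 : (Matrix.of fun a b => φ b (u a)) = 1 := by
    ext a b
    simp [hφ, Matrix.one_apply]
  rw [h0, h2, Matrix.det_one, Polynomial.coeff_zero] at h1
  exact zero_ne_one h1

theorem finite_not_linearIndependent_of_right {V : Type*} [AddCommGroup V] [Module ℝ V] {k : ℕ}
    (u : Fin k → V) {x : Fin k → V} (hx : LinearIndependent ℝ x) :
    {t : ℝ | ¬ LinearIndependent ℝ fun a => u a + t • x a}.Finite := by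
  obtain ⟨φ, hφ⟩ := exists_dual_functionals hx
  refine finite_not_linearIndependent u x φ fun h0 => ?_
  -- With `φ` dual to `x`, the coefficient of `t ^ k` in the determinant is one.
  have h1 := Polynomial.coeff_det_X_add_C_card (Matrix.of fun a b => φ b (x a))
    (Matrix.of fun a b => φ b (u a))
  have h2 : (Matrix.of fun a b => φ b (x a)) = 1 := by
    ext a b
    simp [hφ, Matrix.one_apply]
  rw [h0, h2, Matrix.det_one, Polynomial.coeff_zero] at h1
  exact zero_ne_one h1

theorem le_finrank_of_linearIndependent {V : Type*} [AddCommGroup V] [Module ℝ V] {k : ℕ}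
    {x : Fin k → V} (hx : LinearIndependent ℝ x) {E : Submodule ℝ V} [FiniteDimensional ℝ E]
    (h : ∀ a, x a ∈ E) : k ≤ Module.finrank ℝ E := by
  have h1 := finrank_span_eq_card hx
  rw [Fintype.card_fin] at h1
  rw [← h1]
  refine Submodule.finrank_mono (Submodule.span_le.2 ?_)
  rintro _ ⟨a, rfl⟩
  exact h a

theorem finrank_map_add_le {V W : Type*} [AddCommGroup V] [Module ℝ V] [AddCommGroup W] [Module ℝ W]
    (f : V →ₗ[ℝ] W) {A E : Submodule ℝ V} [FiniteDimensional ℝ E] (hA : A ≤ E)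
    (h0 : ∀ u ∈ A, f u = 0) :
    Module.finrank ℝ A + Module.finrank ℝ (E.map f) ≤ Module.finrank ℝ E := by
  have h1 := LinearMap.finrank_range_add_finrank_ker (f.domRestrict E)
  rw [LinearMap.range_domRestrict] at h1
  have h2 : A ≤ (LinearMap.ker (f.domRestrict E)).map E.subtype := fun u hu =>
    ⟨⟨u, hA hu⟩, LinearMap.mem_ker.2 (h0 u hu), rfl⟩
  have h3 := Submodule.finrank_mono h2
  rw [Submodule.finrank_map_subtype_eq] at h3
  omega

end Parameter

/-! ## Translations and restriction to lines -/

section Lines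

/-- The translation of polynomials by `μ`. -/
def shift (μ : Fin 2 → ℝ) : MvPolynomial (Fin 2) ℝ →ₐ[ℝ] MvPolynomial (Fin 2) ℝ :=
  aeval fun i => X i + C (μ i)

/-- The restriction of polynomials to the line spanned by `p`. -/
def line (p : Fin 2 → ℝ) : MvPolynomial (Fin 2) ℝ →ₐ[ℝ] Polynomial ℝ :=
  aeval fun i => Polynomial.C (p i) * Polynomial.X

theorem shift_X (μ : Fin 2 → ℝ) (i : Fin 2) : shift μ (X i) = X i + C (μ i) := aeval_X _ _

theorem shift_linForm (μ : Fin 2 → ℝ) (a b : ℝ) :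
    shift μ (linForm a b) = linForm a b + C (eval μ (linForm a b)) := by
  rw [eval_linForm, linForm, map_add, map_mul, map_mul, shift_X, shift_X]
  have : ∀ c, shift μ (C c) = C c := fun c => (shift μ).commutes c
  rw [this, this, map_add, map_mul, map_mul]
  ring

theorem line_C (p : Fin 2 → ℝ) (c : ℝ) : line p (C c) = Polynomial.C c := (line p).commutes c

theorem line_linForm (p : Fin 2 → ℝ) (a b : ℝ) :
    line p (linForm a b) = Polynomial.C (eval p (linForm a b)) * Polynomial.X := by
  rw [eval_linForm, linForm, map_add, map_mul, map_mul, line_C, line_C, line, aeval_X, aeval_X,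
    map_add, map_mul, map_mul]
  ring

theorem line_linForm_self (a b : ℝ) : line ![-b, a] (linForm a b) = 0 := by
  rw [line_linForm, eval_linForm]
  have : a * (![-b, a] : Fin 2 → ℝ) 0 + b * (![-b, a] : Fin 2 → ℝ) 1 = 0 := by
    simp only [Matrix.cons_val_zero, Matrix.cons_val_one]
    ring
  rw [this, map_zero, zero_mul]

theorem eval_line (p : Fin 2 → ℝ) (y : ℝ) (u : MvPolynomial (Fin 2) ℝ) :
    (line p u).eval y = eval (fun i => p i * y) u := by
  induction u using MvPolynomial.induction_on with
  | C c => rw [line_C, Polynomial.eval_C, eval_C]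
  | add p q hp hq => rw [map_add, map_add, Polynomial.eval_add, hp, hq]
  | mul_X u i hu =>
    rw [map_mul, map_mul, Polynomial.eval_mul, hu, line, aeval_X, eval_X, Polynomial.eval_mul,
      Polynomial.eval_C, Polynomial.eval_X]

theorem eval_shift (μ x : Fin 2 → ℝ) (u : MvPolynomial (Fin 2) ℝ) :
    eval x (shift μ u) = eval (x + μ) u := by
  induction u using MvPolynomial.induction_on with
  | C c => rw [show shift μ (C c) = C c from (shift μ).commutes c, eval_C, eval_C]
  | add p q hp hq => rw [map_add, map_add, map_add, hp, hq]
  | mul_X u i hu =>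
    rw [map_mul, map_mul, map_mul, hu, shift_X, eval_X, map_add, eval_X, eval_C, Pi.add_apply]

theorem eval_smul_of_isHomogeneous {u : MvPolynomial (Fin 2) ℝ} {n : ℕ} (hu : u.IsHomogeneous n)
    (s : ℝ) (x : Fin 2 → ℝ) : eval (s • x) u = s ^ n * eval x u := by
  rw [eval_eq, eval_eq, Finset.mul_sum]
  refine Finset.sum_congr rfl fun α hα => ?_
  have h1 : α.degree = n := by
    by_contra hc
    exact mem_support_iff.1 hα (hu.coeff_eq_zero hc)
  have h2 : ∏ i ∈ α.support, (s • x) i ^ α i = s ^ n * ∏ i ∈ α.support, x i ^ α i := by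
    simp only [Pi.smul_apply, smul_eq_mul, mul_pow]
    rw [Finset.prod_mul_distrib, Finset.prod_pow_eq_pow_sum, ← h1]
    rfl
  rw [h2]
  ring

/-- A form that vanishes on a line not through the origin is zero. -/
theorem eq_zero_of_line_shift {a b : ℝ} {μ : Fin 2 → ℝ} (hμ : eval μ (linForm a b) ≠ 0)
    (hab : a ≠ 0 ∨ b ≠ 0) {n : ℕ} {u : MvPolynomial (Fin 2) ℝ} (hu : u.IsHomogeneous n)
    (h : line ![-b, a] (shift μ u) = 0) : u = 0 := by
  have hl := linForm_ne_zero (R := ℝ) hab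
  refine (mul_eq_zero.1 (?_ : linForm a b * u = 0)).resolve_left hl
  refine MvPolynomial.funext fun z => ?_
  rw [map_mul, map_zero]
  by_cases hz : eval z (linForm a b) = 0
  · rw [hz, zero_mul]
  have hc := sq_add_sq_ne_zero hab
  have hsl : eval z (linForm a b) / eval μ (linForm a b) ≠ 0 := div_ne_zero hz hμ
  have hs : eval z (linForm a b) / eval μ (linForm a b) * eval μ (linForm a b) =
    eval z (linForm a b) := div_mul_cancel₀ _ hμ
  set s := eval z (linForm a b) / eval μ (linForm a b) with hsdef
  rw [eval_linForm, eval_linForm] at hs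
  -- A point `z` off the line `l = 0`, with `l` the form `(a, b)`, is a multiple of a point of the
  -- translated line through `μ`: `s` matches the values of `l`, and `y` is the coordinate along the
  -- line. Homogeneity then carries the vanishing from the line to `z`.
  set y := (a * (z 1 - s * μ 1) - b * (z 0 - s * μ 0)) / (a ^ 2 + b ^ 2) / s with hy
  have hys : s * y * (a ^ 2 + b ^ 2) = a * (z 1 - s * μ 1) - b * (z 0 - s * μ 0) := by
    rw [hy]
    field_simp
  clear_value s y
  have hzs : z = s • ((fun i => (![-b, a] : Fin 2 → ℝ) i * y) + μ) := by
    funext i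
    refine mul_right_cancel₀ hc ?_
    fin_cases i
    · change z 0 * (a ^ 2 + b ^ 2) = s * (-b * y + μ 0) * (a ^ 2 + b ^ 2)
      linear_combination -a * hs + b * hys
    · change z 1 * (a ^ 2 + b ^ 2) = s * (a * y + μ 1) * (a ^ 2 + b ^ 2)
      linear_combination -b * hs - a * hys
  rw [hzs, eval_smul_of_isHomogeneous hu, ← eval_shift, ← eval_line, h, Polynomial.eval_zero,
    mul_zero, mul_zero]

/-- Polynomials of degrees `0, …, m - 1` span a space of dimension `≥ m`. -/
theorem le_finrank_of_natDegree {E : Submodule ℝ (Polynomial ℝ)} [FiniteDimensional ℝ E] {m : ℕ}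
    (h : ∀ k < m, ∃ p ∈ E, p ≠ 0 ∧ p.natDegree = k) : m ≤ Module.finrank ℝ E := by
  have h' : ∀ k, ∃ p : Polynomial ℝ, (k < m → p ∈ E) ∧ p.degree = k := fun k => by
    by_cases hk : k < m
    · obtain ⟨p, hp, hp0, hpk⟩ := h k hk
      exact ⟨p, fun _ => hp, by rw [Polynomial.degree_eq_natDegree hp0, hpk]⟩
    · exact ⟨Polynomial.X ^ k, fun hk' => absurd hk' hk, Polynomial.degree_X_pow k⟩
  choose p hp hpk using h'
  let S : Polynomial.Sequence ℝ := ⟨p, hpk⟩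
  have hli : LinearIndependent ℝ fun k : Fin m => p k :=
    S.linearIndependent.comp (fun k : Fin m => (k : ℕ)) Fin.val_injective
  exact le_finrank_of_linearIndependent hli fun k => hp k k.2

end Lines

/-! ## Exponential coefficients -/

section Exponential

variable (U : Opens (ℝ × ℝ))

/-- The function `exp (μ · (z - z₀))`. -/
def expFun (μ : Fin 2 → ℝ) (z₀ : ℝ × ℝ) : Smooth U :=
  ofContDiff U (fun z => Real.exp (μ 0 * (z.1 - z₀.1) + μ 1 * (z.2 - z₀.2))) (by fun_prop)

theorem evalAt_expFun (μ : Fin 2 → ℝ) (z : U) : evalAt z (expFun U μ z) = 1 := by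
  rw [expFun, evalAt_ofContDiff]
  simp

theorem partialD_expFun (μ : Fin 2 → ℝ) (z₀ : ℝ × ℝ) (i : Fin 2) :
    partialD i (expFun U μ z₀) = algebraMap ℝ (Smooth U) (μ i) * expFun U μ z₀ := by
  refine smooth_ext fun q => ?_
  rw [expFun, partialD_ofContDiff, map_mul, evalAt_algebraMap, evalAt_ofContDiff]
  have h1 : HasFDerivAt (fun z : ℝ × ℝ => μ 0 * (z.1 - z₀.1) + μ 1 * (z.2 - z₀.2))
      (μ 0 • ContinuousLinearMap.fst ℝ ℝ ℝ + μ 1 • ContinuousLinearMap.snd ℝ ℝ ℝ) (q : ℝ × ℝ) :=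
    ((hasFDerivAt_fst.sub_const _).const_mul _).add ((hasFDerivAt_snd.sub_const _).const_mul _)
  rw [h1.exp.fderiv]
  fin_cases i <;> simp [coordVec, mul_comm]

/-- Moving `∂ᵢ` through `e^{μ·z}` turns it into `∂ᵢ + μᵢ`. -/
theorem leftDPow_expFun (μ : Fin 2 → ℝ) (z₀ : ℝ × ℝ) (u : MvPolynomial (Fin 2) ℝ)
    (α : Fin 2 →₀ ℕ) : Op.leftDPow α (expFun U μ z₀ • cst U u) =
      expFun U μ z₀ • cst U (shift μ (monomial α 1) * u) := by
  induction α using exponent_induction with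
  | zero =>
    have h : (monomial 0 1 : MvPolynomial (Fin 2) ℝ) = 1 := rfl
    rw [h, map_one, one_mul]
    rfl
  | step α i h =>
    have h2 : (monomial (α + Finsupp.single i 1) 1 : MvPolynomial (Fin 2) ℝ) =
        X i * monomial α 1 := by rw [X, monomial_mul, one_mul, add_comm]
    rw [leftDPow_add_single, h, h2, map_mul (shift μ), shift_X, smul_eq_C_mul, leftD_C_mul, leftD_cst,
      partialD_expFun, smul_eq_C_mul, mul_assoc, map_mul (cst U) (X i + _), map_add, cst_X, cst_C,
      map_mul C]
    ring

theorem compVal_expFun (μ : Fin 2 → ℝ) (z : U) (u w : MvPolynomial (Fin 2) ℝ) :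
    compVal (expFun U μ z • cst U u) z w = shift μ w * u := by
  induction w using MvPolynomial.induction_on' with
  | monomial α c =>
    have h : (monomial α c : MvPolynomial (Fin 2) ℝ) = c • monomial α 1 := by
      rw [smul_monomial, smul_eq_mul, mul_one]
    rw [compVal_monomial, leftDPow_expFun, val_smul, evalAt_expFun, one_smul, val_cst, h, map_smul,
      smul_mul_assoc]
  | add p q hp hq => rw [map_add, hp, hq, map_add, add_mul]

end Exponential

/-! ## Generic systems -/

section Model

variable {U : Opens (ℝ × ℝ)}

/-- The constant vector field. -/
def constVec (U : Opens (ℝ × ℝ)) (w : Fin 2 → ℝ) : Fin 2 → Smooth U :=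
  fun j => algebraMap ℝ (Smooth U) (w j)

theorem firstOrder_constVec (w : Fin 2 → ℝ) :
    firstOrder (constVec U w) 0 = cst U (linForm (w 0) (w 1)) := by
  rw [firstOrder_eq, C_0, add_zero, linForm, linForm, map_add, map_mul, map_mul, cst_C, cst_C, cst_X,
    cst_X]
  rfl

/-- An operator with constant symbol `lam` and generic lower terms. -/
def modelOp (U : Opens (ℝ × ℝ)) (lam V : MvPolynomial (Fin 2) ℝ) (μ ν : Fin 2 → ℝ) (t : ℝ)
    (z : ℝ × ℝ) : Op U :=
  cst U lam + (expFun U μ z • cst U V + algebraMap ℝ (Smooth U) t • expFun U ν z • cst U 1)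

variable {lam V : MvPolynomial (Fin 2) ℝ} {μ ν : Fin 2 → ℝ} {t : ℝ}

theorem modelOp_sub_mem (hV : V ∈ ordLT ℝ 2) (z : ℝ × ℝ) :
    modelOp U lam V μ ν t z - cst U lam ∈ ordLT (Smooth U) 2 := by
  rw [modelOp, add_sub_cancel_left]
  refine Submodule.add_mem _ (Submodule.smul_mem _ _ (cst_mem_ordLT hV))
    (Submodule.smul_mem _ _ (Submodule.smul_mem _ _ (cst_mem_ordLT ?_)))
  exact ordLT_mono (by norm_num) (C_mem_ordLT (1 : ℝ))

theorem modelOp_mem_ordLT (hlam : lam.IsHomogeneous 3) (hV : V ∈ ordLT ℝ 2) (z : ℝ × ℝ) :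
    modelOp U lam V μ ν t z ∈ ordLT (Smooth U) (3 + 1) := by
  rw [← sub_add_cancel (modelOp U lam V μ ν t z) (cst U lam)]
  exact Submodule.add_mem _ (ordLT_mono (by norm_num) (modelOp_sub_mem hV z))
    (cst_mem_ordLT (IsHomogeneous.mem_ordLT hlam (by norm_num)))

theorem homogeneousComponent_modelOp (hlam : lam.IsHomogeneous 3) (hV : V ∈ ordLT ℝ 2) (z : ℝ × ℝ)
    (q : U) : val q (homogeneousComponent 3 (modelOp U lam V μ ν t z)) = lam := by
  have h : modelOp U lam V μ ν t z - cst U lam ∈ ordLT (Smooth U) 3 :=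
    ordLT_mono (by norm_num) (modelOp_sub_mem hV z)
  rw [homogeneousComponent_eq_of_sub_mem h]
  have h2 : val q (homogeneousComponent 3 (cst U lam)) =
    homogeneousComponent 3 (val q (cst U lam)) := map_homogeneousComponent _ _ _
  rw [h2, val_cst, homogeneousComponent_eq_self hlam]

/-- At the base point the exponentials equal one, and only the translations by `μ` and `ν` remain of
their derivatives. -/
theorem compVal_modelOp (z : U) (u : MvPolynomial (Fin 2) ℝ) :
    compVal (modelOp U lam V μ ν t z) z u = u * lam + (shift μ u * V + t • shift ν u) := by
  have hadd : ∀ P Q : Op U, compVal (P + Q) z u = compVal P z u + compVal Q z u := fun P Q => by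
    rw [compVal_eq, compVal_eq, compVal_eq, comp_add, map_add]
  have h1 : algebraMap ℝ (Smooth U) t • expFun U ν z • cst U (1 : MvPolynomial (Fin 2) ℝ) =
      expFun U ν z • cst U (C t) := by
    rw [cst_C, smul_smul, mul_comm, mul_smul, map_one]
    refine congrArg (fun x => expFun U ν z • x) ?_
    rw [smul_eq_C_mul, mul_one]
  rw [modelOp, hadd, hadd, compVal_cst, compVal_expFun, h1, compVal_expFun, smul_eq_C_mul,
    mul_comm (C t)]

variable {r : ℕ} {e d : Fin r → ℕ} {w : Fin r → MvPolynomial (Fin 2) ℝ}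

theorem compVal_mem_rowSpan {N : Op U} (hed : ∀ j, d j = e j + 3) (L : Op U) {k n : ℕ} (hkn : k + 3 ≤ n)
    {u : MvPolynomial (Fin 2) ℝ} (hu : u ∈ genSpan e w k) (q : U) :
    compVal N q u ∈ rowSpan (multiples w N) L d n q := by
  have hle : genSpan e w k ≤ (rowSpan (multiples w N) L d n q).comap (compVal N q) := by
    refine Submodule.span_le.2 ?_
    rintro _ ⟨j, α, h, rfl⟩
    refine Submodule.subset_span ⟨(some j, α), mem_rowSet.2 ?_, ?_⟩
    · simp only [Option.elim_some, hed]
      omega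
    · simp only [Option.elim_some]
      rw [leftDPow_multiples, val_comp, val_cst]
  exact hle hu

/-- The lower bound for the rank of the derivatives of `w_j ∘ N` and `l(∂)` by restriction to the
line `l = 0`. -/
theorem rank_ge_of_line {a b : ℝ} (hab : a ≠ 0 ∨ b ≠ 0) (F : Fin r → Op U)
    (d : Fin r → ℕ) (n : ℕ) (q : U) [FiniteDimensional ℝ (rowSpan F (cst U (linForm a b)) d n q)] :
    tri n + Module.finrank ℝ ((rowSpan F (cst U (linForm a b)) d n q).map
      (line ![-b, a]).toLinearMap) ≤
      Module.finrank ℝ (rowSpan F (cst U (linForm a b)) d n q) := by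
  have h1 : (compVal (cst U (linForm a b)) q) = LinearMap.mulLeft ℝ (linForm a b) :=
    LinearMap.ext fun u => by rw [compVal_cst, LinearMap.mulLeft_apply, mul_comm]
  have h2 := map_compVal_le_rowSpan F (cst U (linForm a b)) d n q
  have h3 := finrank_map_add_le (line ![-b, a]).toLinearMap h2 (by
    rintro _ ⟨u, -, rfl⟩
    rw [h1, LinearMap.mulLeft_apply, AlgHom.toLinearMap_apply, map_mul, line_linForm_self, zero_mul])
  rwa [h1, finrank_map_mulLeft (linForm_ne_zero hab), finrank_ordLT] at h3

end Model

/-! ### Ranks of the model on a characteristic line -/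

section ModelRank

variable {U : Opens (ℝ × ℝ)} {r : ℕ} {e d : Fin r → ℕ} {w : Fin r → MvPolynomial (Fin 2) ℝ}
  {lam V f : MvPolynomial (Fin 2) ℝ} {ν : Fin 2 → ℝ} {t a b : ℝ} {z : U}

/-- The restriction to the line `l = 0` of the values of the rows of the model. -/
def lineRows (w : Fin r → MvPolynomial (Fin 2) ℝ) (d : Fin r → ℕ) (lam V : MvPolynomial (Fin 2) ℝ)
    (ν : Fin 2 → ℝ) (t a b : ℝ) (z : U) (n : ℕ) : Submodule ℝ (Polynomial ℝ) :=
  (rowSpan (multiples w (modelOp U lam V ((2 : ℝ) • ν) ν t z)) (cst U (linForm a b)) d n z).map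
    (line ![-b, a]).toLinearMap

theorem lineRows_mem (hed : ∀ j, d j = e j + 3) (hf : lam = linForm a b * f) {k n : ℕ}
    (hkn : k + 3 ≤ n) {u : MvPolynomial (Fin 2) ℝ} (hu : u ∈ genSpan e w k) :
    line ![-b, a] (shift ((2 : ℝ) • ν) u) * line ![-b, a] V + t • line ![-b, a] (shift ν u) ∈
      lineRows w d lam V ν t a b z n := by
  refine ⟨_, compVal_mem_rowSpan hed _ hkn hu z, ?_⟩
  have h0 := line_linForm_self a b
  rw [AlgHom.toLinearMap_apply, compVal_modelOp, map_add, map_mul, hf, map_mul (line _) (linForm a b),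
    h0, zero_mul, mul_zero, zero_add, map_add, map_mul, map_smul]

/-- On the line, the translated form `l` is the constant `2c` under the shift by `2ν` and `c` under
the shift by `ν`, where `c = l(ν)`. So the row of `l u` minus `2c` times the row of `u` isolates the
term `t u(· + ν)`. This is why the model has two different exponents; the factor `l` costs one
order. -/
theorem lineRows_mem_shift (hed : ∀ j, d j = e j + 3) (hf : lam = linForm a b * f) (ht : t ≠ 0)
    (hν : eval ν (linForm a b) ≠ 0) {k n : ℕ}
    (hkn : k + 4 ≤ n) {u : MvPolynomial (Fin 2) ℝ} (hu : u ∈ genSpan e w k) :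
    line ![-b, a] (shift ν u) ∈ lineRows w d lam V ν t a b z n := by
  have hlu : linForm a b * u ∈ genSpan e w (k + 1) := by
    rw [linForm, add_mul, mul_assoc, mul_assoc, ← smul_eq_C_mul, ← smul_eq_C_mul]
    exact Submodule.add_mem _ (Submodule.smul_mem _ _ (X_mul_mem_genSpan 0 hu))
      (Submodule.smul_mem _ _ (X_mul_mem_genSpan 1 hu))
  have h1 := lineRows_mem (V := V) (ν := ν) (t := t) (z := z) hed hf (n := n) (by omega) hlu
  have h2 := lineRows_mem (V := V) (ν := ν) (t := t) (z := z) hed hf (n := n) (by omega) hu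
  have h0 := line_linForm_self a b
  have h2ν : eval ((2 : ℝ) • ν) (linForm a b) = 2 * eval ν (linForm a b) := by
    rw [eval_smul_of_isHomogeneous (isHomogeneous_linForm a b), pow_one]
  set c := eval ν (linForm a b) with hc
  rw [map_mul, map_mul, map_mul, map_mul, shift_linForm, shift_linForm, map_add, map_add, h0, line_C,
    line_C, h2ν, ← hc, zero_add, zero_add] at h1
  have h3 := Submodule.sub_mem _ h1 (Submodule.smul_mem _ (2 * c) h2)
  have h4 : Polynomial.C (2 * c) * line ![-b, a] (shift ((2 : ℝ) • ν) u) * line ![-b, a] V +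
      t • (Polynomial.C c * line ![-b, a] (shift ν u)) -
      (2 * c) • (line ![-b, a] (shift ((2 : ℝ) • ν) u) * line ![-b, a] V +
        t • line ![-b, a] (shift ν u)) = (-(c * t)) • line ![-b, a] (shift ν u) := by
    simp only [Polynomial.smul_eq_C_mul, map_mul, map_neg]
    rw [show (2 : ℝ) = 1 + 1 by norm_num, map_add, map_one]
    ring
  rw [h4] at h3
  exact (Submodule.smul_mem_iff _ (neg_ne_zero.2 (mul_ne_zero hν ht))).1 h3

theorem lineRows_mem_shift_mul (hed : ∀ j, d j = e j + 3) (hf : lam = linForm a b * f) (ht : t ≠ 0)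
    (hν : eval ν (linForm a b) ≠ 0) {k n : ℕ}
    (hkn : k + 4 ≤ n) {u : MvPolynomial (Fin 2) ℝ} (hu : u ∈ genSpan e w k) :
    line ![-b, a] (shift ((2 : ℝ) • ν) u) * line ![-b, a] V ∈ lineRows w d lam V ν t a b z n := by
  have h1 := lineRows_mem (V := V) (ν := ν) (t := t) (z := z) hed hf (n := n) (by omega) hu
  have h2 := lineRows_mem_shift (V := V) (z := z) hed hf ht hν hkn hu
  exact (Submodule.add_mem_iff_left _ (Submodule.smul_mem _ t h2)).1 h1

/-- The full rank of the model in large orders. -/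
theorem le_finrank_lineRows (hed : ∀ j, d j = e j + 3) (hf : lam = linForm a b * f) (ht : t ≠ 0)
    (hab : a ≠ 0 ∨ b ≠ 0) (hν : eval ν (linForm a b) ≠ 0)
    (hV : line ![-b, a] V = Polynomial.C (eval ν (linForm a b)) * Polynomial.X) {s : ℕ}
    (hs : ∀ k ≥ s, homogeneousSubmodule (Fin 2) ℝ k ≤ genSpan e w k)
    [FiniteDimensional ℝ (lineRows w d lam V ν t a b z (s + 4))] :
    s + 3 ≤ Module.finrank ℝ (lineRows w d lam V ν t a b z (s + 4)) := by
  set c := eval ν (linForm a b) with hc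
  set g := linForm (-b) a with hg
  set m := a ^ 2 + b ^ 2 with hm
  have hm0 : m ≠ 0 := sq_add_sq_ne_zero hab
  have hgl : line ![-b, a] g = Polynomial.C m * Polynomial.X := by
    rw [hg, line_linForm, eval_linForm, hm]
    congr 2
    simp only [Matrix.cons_val_zero, Matrix.cons_val_one]
    ring
  clear_value m
  have hgs : ∀ κ : Fin 2 → ℝ, ∀ k, line ![-b, a] (shift κ (g ^ k)) =
      (Polynomial.C m * Polynomial.X + Polynomial.C (eval κ g)) ^ k := fun κ k => by
    rw [map_pow, map_pow, hg, shift_linForm, ← hg, map_add, hgl, line_C]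
  have hdeg : ∀ x : ℝ, (Polynomial.C m * Polynomial.X + Polynomial.C x).natDegree = 1 := fun x =>
    Polynomial.natDegree_linear hm0
  have hne : ∀ x : ℝ, Polynomial.C m * Polynomial.X + Polynomial.C x ≠ 0 := fun x h0 => by
    have := hdeg x
    rw [h0, Polynomial.natDegree_zero] at this
    omega
  have hdegk : ∀ (x : ℝ) (k : ℕ),
      ((Polynomial.C m * Polynomial.X + Polynomial.C x) ^ k).natDegree = k := fun x k => by
    rw [Polynomial.natDegree_pow, hdeg, mul_one]
  have hcX : (Polynomial.C c * Polynomial.X : Polynomial ℝ) ≠ 0 :=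
    mul_ne_zero (Polynomial.C_ne_zero.2 hν) Polynomial.X_ne_zero
  have hgh : ∀ k, (g ^ k).IsHomogeneous k := fun k => by
    have := (isHomogeneous_linForm (-b) a).pow k
    rwa [one_mul] at this
  have hdegX : ∀ (x : ℝ) (k : ℕ), ((Polynomial.C m * Polynomial.X + Polynomial.C x) ^ k *
      (Polynomial.C c * Polynomial.X)).natDegree = k + 1 := fun x k => by
    rw [Polynomial.natDegree_mul (pow_ne_zero _ (hne x)) hcX, hdegk,
      Polynomial.natDegree_C_mul_X _ hν]
  -- Polynomials of every degree up to `s + 2` are found: `g^k l^(s-k)` under the shift by `ν` gives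
  -- degree `k ≤ s`, `g^s` under the shift by `2ν` times `V` gives `s + 1`, and the full row of
  -- `g^(s+1)`, where `V` dominates, gives `s + 2`.
  refine le_finrank_of_natDegree fun k hk => ?_
  rcases Nat.lt_or_ge s k with hsk | hsk
  · rcases Nat.lt_or_ge (s + 1) k with hsk' | hsk'
    · obtain rfl : k = s + 2 := by omega
      have h1 := lineRows_mem (V := V) (ν := ν) (t := t) (z := z) hed hf (n := s + 4) (by omega)
        (hs (s + 1) (by omega) (hgh (s + 1)))
      rw [hV, hgs, hgs] at h1
      have h2 : (t • (Polynomial.C m * Polynomial.X + Polynomial.C (eval ν g)) ^ (s + 1)).natDegree <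
          ((Polynomial.C m * Polynomial.X + Polynomial.C (eval ((2 : ℝ) • ν) g)) ^ (s + 1) *
            (Polynomial.C c * Polynomial.X)).natDegree := by
        rw [hdegX]
        exact (Polynomial.natDegree_smul_le _ _).trans_lt (by rw [hdegk]; omega)
      have h3 := (Polynomial.natDegree_add_eq_left_of_natDegree_lt h2).trans (hdegX _ _)
      refine ⟨_, h1, fun h0 => ?_, h3⟩
      rw [h0, Polynomial.natDegree_zero] at h3
      omega
    · obtain rfl : k = s + 1 := by omega
      refine ⟨_, lineRows_mem_shift_mul (V := V) (z := z) hed hf ht hν le_rfl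
        (hs s le_rfl (hgh s)), ?_, ?_⟩
      · rw [hV, hgs]
        exact mul_ne_zero (pow_ne_zero _ (hne _)) hcX
      · rw [hV, hgs, hdegX]
  · have hhom : (g ^ k * linForm a b ^ (s - k)).IsHomogeneous s := by
      have h1 := (hgh k).mul ((isHomogeneous_linForm a b).pow (s - k))
      rwa [one_mul, Nat.add_sub_cancel' hsk] at h1
    have h2 := lineRows_mem_shift (V := V) (z := z) hed hf ht hν le_rfl (hs s le_rfl hhom)
    have h0 := line_linForm_self a b
    rw [map_mul, map_mul, hgs, map_pow, map_pow, shift_linForm, map_add, h0, zero_add, line_C, ← hc,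
      ← map_pow, mul_comm, ← Polynomial.smul_eq_C_mul] at h2
    exact ⟨_, (Submodule.smul_mem_iff _ (pow_ne_zero _ hν)).1 h2, pow_ne_zero _ (hne _), hdegk _ _⟩

/-- In the order following the first equations the model has, for almost all parameters, at least one
more independent row than needed. -/
theorem finite_finrank_lineRows_lt (hed : ∀ j, d j = e j + 3) (hf : lam = linForm a b * f)
    (hab : a ≠ 0 ∨ b ≠ 0) (hν : eval ν (linForm a b) ≠ 0)
    (hV : line ![-b, a] V = Polynomial.C (eval ν (linForm a b)) * Polynomial.X)
    (hw : ∀ j, (w j).IsHomogeneous (e j)) {c : ℕ} {u₀ : MvPolynomial (Fin 2) ℝ}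
    (hu₀ : u₀ ∈ genSpan e w c) (hu₀ν : eval ν u₀ ≠ 0)
    (hfd : ∀ t, FiniteDimensional ℝ (lineRows w d lam V ν t a b z (c + 4))) :
    {t : ℝ | t ≠ 0 ∧ Module.finrank ℝ (lineRows w d lam V ν t a b z (c + 4)) <
      Module.finrank ℝ (genSpan e w (c + 1)) + 1}.Finite := by
  have hhom := genSpan_le_homogeneousSubmodule hw (c + 1)
  have : FiniteDimensional ℝ (genSpan e w (c + 1)) := Submodule.finiteDimensional_of_le hhom
  let B := Module.finBasis ℝ (genSpan e w (c + 1))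
  have h2ν : eval ((2 : ℝ) • ν) (linForm a b) ≠ 0 := by
    rw [eval_smul_of_isHomogeneous (isHomogeneous_linForm a b), pow_one]
    exact mul_ne_zero two_ne_zero hν
  have hcX : (Polynomial.C (eval ν (linForm a b)) * Polynomial.X : Polynomial ℝ) ≠ 0 :=
    mul_ne_zero (Polynomial.C_ne_zero.2 hν) Polynomial.X_ne_zero
  -- This is the family at `t = 0`: the rows of a basis in degree `c + 1`, and the additional row
  -- isolated from `u₀` in degree `c`. Its independence carries over to almost all `t`.
  let x : Fin (Module.finrank ℝ (genSpan e w (c + 1)) + 1) → Polynomial ℝ :=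
    Fin.cons (line ![-b, a] (shift ν u₀)) fun i =>
      line ![-b, a] (shift ((2 : ℝ) • ν) (B i : MvPolynomial (Fin 2) ℝ)) * line ![-b, a] V
  let y : Fin (Module.finrank ℝ (genSpan e w (c + 1)) + 1) → Polynomial ℝ :=
    Fin.cons 0 fun i => line ![-b, a] (shift ν (B i : MvPolynomial (Fin 2) ℝ))
  have hx : LinearIndependent ℝ x := by
    refine linearIndependent_finCons.2 ⟨?_, ?_⟩
    · refine Fintype.linearIndependent_iff.2 fun κ hκ => ?_
      have h1 : line ![-b, a] (shift ((2 : ℝ) • ν)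
          ((∑ i, κ i • B i : genSpan e w (c + 1)) : MvPolynomial (Fin 2) ℝ)) *
            line ![-b, a] V = 0 := by
        rw [← hκ, Submodule.coe_sum, map_sum, map_sum, Finset.sum_mul]
        refine Finset.sum_congr rfl fun i _ => ?_
        rw [Submodule.coe_smul, map_smul, map_smul, smul_mul_assoc]
      rw [hV] at h1
      have h2 := eq_zero_of_line_shift h2ν hab (hhom (∑ i, κ i • B i).2)
        ((mul_eq_zero.1 h1).resolve_right hcX)
      exact Fintype.linearIndependent_iff.1 B.linearIndependent κ (Subtype.ext h2)
    -- Every multiple of the restriction of `V` vanishes at the origin of the line, whereas the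
    -- additional row takes the value `u₀(ν) ≠ 0` there.
    · intro h1
      have h2 : Submodule.span ℝ (Set.range fun i =>
          line ![-b, a] (shift ((2 : ℝ) • ν) (B i : MvPolynomial (Fin 2) ℝ)) * line ![-b, a] V) ≤
          LinearMap.ker (Polynomial.leval (0 : ℝ)) := by
        refine Submodule.span_le.2 ?_
        rintro _ ⟨i, rfl⟩
        refine LinearMap.mem_ker.2 ?_
        rw [Polynomial.leval_apply, hV, Polynomial.eval_mul, Polynomial.eval_mul, Polynomial.eval_X,
          mul_zero, mul_zero]
      have h3 := LinearMap.mem_ker.1 (h2 h1)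
      rw [Polynomial.leval_apply, eval_line, eval_shift] at h3
      refine hu₀ν ?_
      rw [← h3]
      congr 2
      funext i
      simp
  refine (finite_not_linearIndependent_of_left hx y).subset fun t ⟨ht, hlt⟩ => fun hli => ?_
  have := hfd t
  refine hlt.not_ge (le_finrank_of_linearIndependent hli fun i => ?_)
  refine Fin.cases ?_ (fun i => ?_) i
  · simp only [x, y, Fin.cons_zero, smul_zero, add_zero]
    exact lineRows_mem_shift hed hf ht hν le_rfl hu₀
  · simp only [x, y, Fin.cons_succ]
    exact lineRows_mem hed hf (by omega) (B i).2

end ModelRank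

/-! ### A generic system with the symbols of a given one -/

section GenericModel

variable {U U₀ : Opens (ℝ × ℝ)} {r : ℕ} {d e : Fin r → ℕ} {h : ℕ → ℕ}

theorem genSpan_add {b : ℕ} (hde : ∀ j, d j = e j + b) (f : Fin r → MvPolynomial (Fin 2) ℝ) (k : ℕ) :
    genSpan d f (k + b) = genSpan e f k := by
  have h1 : ∀ j (α : Fin 2 →₀ ℕ), α.degree + d j = k + b ↔ α.degree + e j = k := fun j α => by
    rw [hde]
    omega
  rw [genSpan, genSpan]
  simp only [h1]

theorem newEquations_le {I : Submodule (Smooth U) (Op U)} (k : ℕ) (q : U) :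
    newEquations (I : Set (Op U)) k q ≤ Module.finrank ℝ (symbolSpace (I : Set (Op U)) k q) :=
  Submodule.finrank_quotient_le _

variable {F₀ : Fin r → Op U₀} {v₀ : Fin 3 → Fin 2 → Smooth U₀}

/-- There are no nonzero symbols below degree three, hence no new equations there. -/
theorem IsClassThreeOfType.three_le (h₀ : IsClassThreeOfType d h F₀ v₀) (q : U₀) (j : Fin r) :
    3 ≤ d j := by
  by_contra hc
  have h1 := h₀.hasType (d j) q
  have h2 := newEquations_le (I := systemMod F₀) (d j) q
  rw [h₀.toIsClassThree.threeChar.symbolSpace_eq_bot (not_le.1 hc), finrank_bot] at h2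
  have h3 : 0 < (Finset.univ.filter fun j' => d j' = d j).card :=
    Finset.card_pos.2 ⟨j, Finset.mem_filter.2 ⟨Finset.mem_univ _, rfl⟩⟩
  rw [← h1] at h3
  exact absurd h2 (not_le.2 h3)

/-- The symbols of a system of class three at a point are the multiples of the product of the three
characteristic forms by the forms of an ideal with generators of degrees `d_j - 3`. -/
theorem IsClassThreeOfType.exists_genSpan (h₀ : IsClassThreeOfType d h F₀ v₀) (q : U₀) :
    ∃ (e : Fin r → ℕ) (w : Fin r → MvPolynomial (Fin 2) ℝ), (∀ j, d j = e j + 3) ∧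
      (∀ j, (w j).IsHomogeneous (e j)) ∧
      (∀ k, symbolSpace (systemIdeal F₀) k q =
        genSpan (fun j => e j + 3) (fun j => triForm (vecAt v₀ q) * w j) k) ∧
      ∀ k, Module.finrank ℝ (genSpan e w k) + h (k + 3) = k + 4 := by
  have hT := h₀.toIsClassThree.threeChar
  obtain ⟨f, hf, hS⟩ := exists_symbolSpace_eq_genSpan (isLeft_systemMod F₀) h₀.hasType q
  have hd : ∀ j, d j = (d j - 3) + 3 := fun j => (Nat.sub_add_cancel (h₀.three_le q j)).symm
  have hw : ∀ j, ∃ g : MvPolynomial (Fin 2) ℝ, g.IsHomogeneous (d j - 3) ∧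
      triForm (vecAt v₀ q) * g = f j := fun j => by
    have h1 := hf j
    rw [hd j] at h1
    exact hT.symbolSpace_le _ q h1
  choose w hw hwf using hw
  have hS' : ∀ k, symbolSpace (systemIdeal F₀) k q =
      genSpan (fun j => d j - 3 + 3) (fun j => triForm (vecAt v₀ q) * w j) k := fun k => by
    rw [show (fun j => d j - 3 + 3) = d from funext fun j => (hd j).symm,
      show (fun j => triForm (vecAt v₀ q) * w j) = f from funext hwf]
    exact hS k
  refine ⟨fun j => d j - 3, w, hd, hw, hS', fun k => ?_⟩
  have h1 := hT.regular.finrank_symbolSpace (k + 3) q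
  rw [coe_systemMod, hS', genSpan_add (fun _ => rfl), ← genSpan_map_mulLeft,
    finrank_map_mulLeft (hT.indep q).triForm_ne_zero] at h1
  omega

theorem exists_eval_ne_zero {u : MvPolynomial (Fin 2) ℝ} (hu : u ≠ 0) : ∃ ν, eval ν u ≠ 0 := by
  by_contra! hc
  exact hu (MvPolynomial.funext fun ν => by rw [hc, map_zero])

/-- For all types and dimensions of symbols that occur there are systems, on any domain, for which the
ranks are as large as possible for the three transformations. -/
theorem IsClassThreeOfType.exists_generic (h₀ : IsClassThreeOfType d h F₀ v₀) (q₀ : U₀) {s b : ℕ}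
    (hs : ∀ k ≥ s, h (k + 3) = 3) (hb : h (b + 3) < b + 4) (z : U) :
    ∃ (F : Fin r → Op U) (v : Fin 3 → Fin 2 → Smooth U), IsClassThreeOfType d h F v ∧
      ∀ i, ∃ a, IsAdapted (systemIdeal F) (firstOrder (v i) a) ∧
        tri (s + 4) + (s + 3) ≤
          Module.finrank ℝ (rowSpan F (firstOrder (v i) a) d (s + 4) z) ∧
        tri (b + 4) + (b + 5 - h (b + 4)) + 1 ≤
          Module.finrank ℝ (rowSpan F (firstOrder (v i) a) d (b + 4) z) := by
  have hP := h₀.toIsClassThree.threeChar.indep q₀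
  obtain ⟨e, w, hed, hw, hS, hdim⟩ := h₀.exists_genSpan q₀
  set p := vecAt v₀ q₀ with hp
  set lam := triForm p with hlam
  have hlam0 : lam ≠ 0 := hP.triForm_ne_zero
  have hlamh : lam.IsHomogeneous 3 := isHomogeneous_triForm p
  have hfull : ∀ k ≥ s, homogeneousSubmodule (Fin 2) ℝ k ≤ genSpan e w k := fun k hk => by
    have h1 := hdim k
    rw [hs k hk] at h1
    refine (Submodule.eq_of_le_of_finrank_eq (genSpan_le_homogeneousSubmodule hw k) ?_).ge
    rw [finrank_homogeneousSubmodule]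
    omega
  have hWb : genSpan e w b ≠ ⊥ := fun h0 => by
    have h1 := hdim b
    rw [h0, finrank_bot] at h1
    omega
  obtain ⟨u₀, hu₀, hu₀0⟩ := Submodule.exists_mem_ne_zero_of_ne_bot hWb
  -- `ν` avoids the zeros of all three characteristic forms and of `u₀` at once.
  obtain ⟨ν, hν⟩ := exists_eval_ne_zero (mul_ne_zero hlam0 hu₀0)
  rw [map_mul] at hν
  have hνl : ∀ i, eval ν (linForm (p i 0) (p i 1)) ≠ 0 := fun i h0 => by
    obtain ⟨f, hf, -⟩ := linForm_dvd_triForm p hP i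
    refine left_ne_zero_of_mul hν ?_
    rw [hlam, hf, map_mul, h0, zero_mul]
  -- This choice makes the restriction of `V` to the `i`-th line equal to `l_i(ν)` times the
  -- coordinate, so one `V` serves the three transformations.
  set V := linForm (-ν 1) (ν 0) with hVdef
  have hVline : ∀ i, line ![-p i 1, p i 0] V =
      Polynomial.C (eval ν (linForm (p i 0) (p i 1))) * Polynomial.X := fun i => by
    rw [hVdef, line_linForm, eval_linForm, eval_linForm]
    congr 2
    simp only [Matrix.cons_val_zero, Matrix.cons_val_one]
    ring
  have hV : V ∈ ordLT ℝ 2 := linForm_mem_ordLT _ _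
  have hFord : ∀ t j, multiples w (modelOp U lam V ((2 : ℝ) • ν) ν t z) j ∈
      ordLT (Smooth U) (d j + 1) := fun t j => by
    rw [hed j]
    exact multiples_mem_ordLT (modelOp_mem_ordLT hlamh hV z) hw j
  have hLord : ∀ i, cst U (linForm (p i 0) (p i 1)) ∈ ordLT (Smooth U) 2 := fun i =>
    cst_mem_ordLT (linForm_mem_ordLT _ _)
  have hfd : ∀ t i n, FiniteDimensional ℝ (rowSpan (multiples w
      (modelOp U lam V ((2 : ℝ) • ν) ν t z)) (cst U (linForm (p i 0) (p i 1))) d n z) :=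
    fun t i n => finiteDimensional_of_le_ordLT (n := n + 1) (by
      refine Submodule.span_le.2 ?_
      rintro _ ⟨x, hx, rfl⟩
      exact map_mem_ordLT _ (leftDPow_elim_mem_ordLT (hFord t) (hLord i) hx))
  have hfd' : ∀ t i n, FiniteDimensional ℝ
      (lineRows w d lam V ν t (p i 0) (p i 1) z n) := fun t i n => by
    have := hfd t i n
    exact Module.Finite.map _ _
  choose f hf hf0 hfh using linForm_dvd_triForm p hP
  have hbad := Set.finite_iUnion fun i : Fin 3 => finite_finrank_lineRows_lt (z := z) hed (hf i)
    (hP.ne_zero i) (hνl i) (hVline i) hw hu₀ (right_ne_zero_of_mul hν) (fun t => hfd' t i (b + 4))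
  -- Finitely many parameters are bad for each characteristic; `0` is excluded as well because the
  -- isolation of rows divides by `t`.
  obtain ⟨t, ht⟩ := (hbad.union (Set.finite_singleton (0 : ℝ))).exists_notMem
  have ht0 : t ≠ 0 := fun h0 => ht (Or.inr h0)
  set N := modelOp U lam V ((2 : ℝ) • ν) ν t z with hN
  have hNord : N ∈ ordLT (Smooth U) (3 + 1) := modelOp_mem_ordLT hlamh hV z
  have hN3 : ∀ q, val q (homogeneousComponent 3 N) = lam := homogeneousComponent_modelOp hlamh hV z
  have hL : ∀ i, firstOrder (constVec U (p i)) 0 = cst U (linForm (p i 0) (p i 1)) := fun i =>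
    firstOrder_constVec _
  refine ⟨multiples w N, fun i => constVec U (p i), ?_, fun i => ⟨0, ?_, ?_, ?_⟩⟩
  · refine h₀.of_symbolSpace_eq (hFord t) fun q => ⟨q₀, fun i j => ?_, fun k => ?_⟩
    · rw [constVec, evalAt_algebraMap]
      rfl
    · rw [hS, ← coe_systemMod, symbolSpace_multiples hNord (fun q => by rw [hN3]; exact hlam0) hw,
        hN3]
  · rw [hL]
    refine multiples_isAdapted hNord (fun q => by rw [hN3]; exact hlam0) (G := cst U (f i))
      (cst_mem_ordLT (IsHomogeneous.mem_ordLT (hfh i) (by norm_num))) ?_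
    rw [comp_cst, ← map_mul, mul_comm, ← hf i]
    exact modelOp_sub_mem hV z
  · rw [hL]
    have := hfd t i (s + 4)
    have := hfd' t i (s + 4)
    exact (Nat.add_le_add_left (le_finrank_lineRows hed (hf i) ht0 (hP.ne_zero i) (hνl i) (hVline i)
      hfull) _).trans (rank_ge_of_line (hP.ne_zero i) _ d (s + 4) z)
  · rw [hL]
    have := hfd t i (b + 4)
    have h1 : Module.finrank ℝ (genSpan e w (b + 1)) + 1 ≤ Module.finrank ℝ
        (lineRows w d lam V ν t (p i 0) (p i 1) z (b + 4)) := by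
      by_contra hc
      exact ht (Or.inl (Set.mem_iUnion.2 ⟨i, ht0, not_le.1 hc⟩))
    have h2 := hdim (b + 1)
    have h3 := (Nat.add_le_add_left h1 _).trans
      (rank_ge_of_line (hP.ne_zero i) (multiples w N) d (b + 4) z)
    have h4 : h (b + 1 + 3) = h (b + 4) := rfl
    omega

end GenericModel

/-! ## Principal systems -/

section Principal

variable {U : Opens (ℝ × ℝ)} {r : ℕ} {d e : Fin r → ℕ} {f w : Fin r → MvPolynomial (Fin 2) ℝ}

theorem genSpan_eq_bot {k : ℕ} (h : ∀ j, k < d j) : genSpan d f k = ⊥ := by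
  refine eq_bot_iff.2 (Submodule.span_le.2 ?_)
  rintro _ ⟨j, α, hα, rfl⟩
  exact absurd hα (by have := h j; omega)

theorem homogeneousSubmodule_le_of_monomial {k : ℕ} {E : Submodule ℝ (MvPolynomial (Fin 2) ℝ)}
    (hE : ∀ α : Fin 2 →₀ ℕ, α.degree = k → monomial α 1 ∈ E) : homogeneousSubmodule (Fin 2) ℝ k ≤ E := by
  intro u hu
  rw [u.as_sum]
  refine Submodule.sum_mem _ fun α hα => ?_
  have h1 : (monomial α (coeff α u) : MvPolynomial (Fin 2) ℝ) = coeff α u • monomial α 1 := by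
    rw [smul_monomial, smul_eq_mul, mul_one]
  rw [h1]
  exact Submodule.smul_mem _ _ (hE α (by
    rw [Finsupp.degree_eq_weight_one]
    exact hu (mem_support_iff.1 hα)))

theorem genSpan_one (k : ℕ) :
    genSpan (fun _ : Fin 1 => 0) (fun _ => 1) k = homogeneousSubmodule (Fin 2) ℝ k := by
  refine le_antisymm (genSpan_le_homogeneousSubmodule (fun _ => isHomogeneous_one _ _) k)
    (homogeneousSubmodule_le_of_monomial fun α hα => ?_)
  exact Submodule.subset_span ⟨0, α, hα, (mul_one _).symm⟩

theorem genSpan_X (k : ℕ) :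
    genSpan (fun _ : Fin 2 => 1) X (k + 1) = homogeneousSubmodule (Fin 2) ℝ (k + 1) := by
  refine le_antisymm (genSpan_le_homogeneousSubmodule (fun j => isHomogeneous_X ℝ j) _)
    (homogeneousSubmodule_le_of_monomial fun α hα => ?_)
  obtain ⟨i, hi⟩ : ∃ i, α i ≠ 0 := by
    by_contra! hc
    have h0 : α = 0 := Finsupp.ext hc
    rw [h0, map_zero] at hα
    omega
  have h1 : α - Finsupp.single i 1 + Finsupp.single i 1 = α :=
    tsub_add_cancel_of_le (Finsupp.single_le_iff.2 (Nat.one_le_iff_ne_zero.2 hi))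
  refine Submodule.subset_span ⟨i, α - Finsupp.single i 1, ?_, ?_⟩
  · have h2 := congrArg Finsupp.degree h1
    rwa [map_add, Finsupp.degree_single, hα] at h2
  · rw [X, monomial_mul, h1, mul_one]

theorem genSpan_principal (b : ℕ) (σ : MvPolynomial (Fin 2) ℝ) (k : ℕ) :
    genSpan (fun _ : Fin 1 => b) (fun _ => σ) (k + b) =
      (homogeneousSubmodule (Fin 2) ℝ k).map (LinearMap.mulLeft ℝ σ) := by
  rw [genSpan_add (e := fun _ => 0) (fun _ => (Nat.zero_add b).symm), ← genSpan_one,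
    genSpan_map_mulLeft, mul_one]

/-- A principal ideal has one new equation. -/
theorem newEquations_of_principal {I : Set (Op U)} {q : U} {b : ℕ} {σ : MvPolynomial (Fin 2) ℝ}
    (hb : 0 < b) (hσ : σ ≠ 0)
    (hS : ∀ k, symbolSpace I k q = genSpan (fun _ : Fin 1 => b) (fun _ => σ) k) (k : ℕ) :
    newEquations I k q = if b = k then 1 else 0 := by
  have hbot : ∀ k < b, symbolSpace I k q = ⊥ := fun k hk => by
    rw [hS, genSpan_eq_bot fun _ => hk]
  rcases lt_trichotomy k b with hk | rfl | hk
  · rw [if_neg hk.ne', newEquations, hbot k hk]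
    exact Module.finrank_zero_of_subsingleton
  · rw [if_pos rfl, newEquations]
    have hP : prolongedSymbols I k q = ⊥ := by
      cases k with
      | zero => rfl
      | succ k =>
        simp only [prolongedSymbols, hbot k (Nat.lt_succ_self k), Submodule.map_bot, iSup_bot]
    have h1 := hS k
    have h2 := genSpan_principal k σ 0
    rw [zero_add] at h2
    rw [h2] at h1
    have h3 : Module.finrank ℝ (symbolSpace I k q) = 1 := by
      rw [h1, finrank_map_mulLeft hσ, finrank_homogeneousSubmodule]
    rw [hP, (Submodule.quotEquivOfEqBot _ (by
      rw [Submodule.comap_bot, Submodule.ker_subtype])).finrank_eq, h3]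
  · rw [if_neg hk.ne, newEquations]
    have hP : symbolSpace I k q ≤ prolongedSymbols I k q := by
      obtain ⟨m, rfl⟩ : ∃ m, k = m + 1 := ⟨k - 1, by omega⟩
      rw [hS]
      refine Submodule.span_le.2 ?_
      rintro _ ⟨j, α, (hα : α.degree + b = m + 1), rfl⟩
      have h1 : (monomial α 1 : MvPolynomial (Fin 2) ℝ) ∈ genSpan (fun _ : Fin 2 => 1) X (m - b + 1) := by
        rw [genSpan_X]
        exact isHomogeneous_monomial 1 (by omega)
      have h2 : genSpan (fun _ : Fin 2 => 1) X (m - b + 1) ≤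
          (prolongedSymbols I (m + 1) q).comap (LinearMap.mulRight ℝ σ) := by
        refine Submodule.span_le.2 ?_
        rintro _ ⟨i, β, (hβ : β.degree + 1 = m - b + 1), rfl⟩
        refine Submodule.mem_iSup_of_mem i ⟨monomial β 1 * σ, ?_, ?_⟩
        · rw [hS]
          exact monomial_mul_mem_genSpan (fun _ : Fin 1 => b) (fun _ => σ) 0
            (show β.degree + b = m by omega)
        · rw [LinearMap.mulLeft_apply, LinearMap.mulRight_apply]
          ring
      exact h2 h1
    have h1 : (prolongedSymbols I k q).comap (symbolSpace I k q).subtype = ⊤ :=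
      Submodule.comap_subtype_eq_top.2 hP
    rw [h1]
    exact Module.finrank_zero_of_subsingleton

/-- Left multiples of one operator with constant symbol define a regular system. -/
theorem isRegular_multiples {N : Op U} {b : ℕ} (hN : N ∈ ordLT (Smooth U) (b + 1))
    (hN0 : ∀ q, val q (homogeneousComponent b N) ≠ 0) (hw : ∀ j, (w j).IsHomogeneous (e j))
    {c : ℕ → ℕ} (hc : ∀ k, Module.finrank ℝ (genSpan e w k) = c k) :
    IsRegular (systemMod (multiples w N) : Set (Op U))
      (fun k => k + 1 - if k < b then 0 else c (k - b)) := by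
  refine isRegular_iff.2 fun k q => ?_
  rw [symbolSpace_multiples hN hN0 hw]
  rcases Nat.lt_or_ge k b with hk | hk
  · rw [genSpan_eq_bot fun j => by omega, finrank_bot]
    simp only [if_pos hk]
    omega
  · obtain ⟨m, rfl⟩ : ∃ m, k = m + b := ⟨k - b, by omega⟩
    have h2 : c m ≤ m + 1 := by
      have h3 := Submodule.finrank_mono (genSpan_le_homogeneousSubmodule hw m)
      rwa [hc, finrank_homogeneousSubmodule] at h3
    rw [genSpan_add (fun _ => rfl), ← genSpan_map_mulLeft, finrank_map_mulLeft (hN0 q), hc]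
    simp only [if_neg (not_lt.2 hk), Nat.add_sub_cancel]
    omega

theorem mem_systemMod_multiples_one {n : MvPolynomial (Fin 2) ℝ} {P : Op U} :
    P ∈ systemMod (multiples (fun _ : Fin 1 => 1) (cst U n)) ↔ ∃ R, P = R * cst U n := by
  refine ⟨fun hP => ?_, ?_⟩
  · obtain ⟨c, hc⟩ := exists_comp_eq_of_mem_multiples hP
    exact ⟨_, hc.trans (comp_cst _ _)⟩
  · rintro ⟨R, rfl⟩
    have h1 := mem_systemMod (multiples (fun _ : Fin 1 => (1 : MvPolynomial (Fin 2) ℝ)) (cst U n)) 0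
    rw [multiples, map_one, one_comp] at h1
    rw [← comp_cst]
    exact (isLeft_systemMod _).comp_mem R h1

end Principal

/-! ## Singular transformations -/

section Examples

variable {U : Opens (ℝ × ℝ)}

/-- The vectors `(1,0)`, `(0,1)`, `(1,1)`. -/
def exampleVec : Fin 3 → Fin 2 → ℝ := ![![1, 0], ![0, 1], ![1, 1]]

theorem pairIndep_exampleVec : PairIndep exampleVec := by
  intro i j hij
  fin_cases i <;> fin_cases j <;> simp [exampleVec] at hij ⊢

/-- The form `η (ξ + η)`. -/
def exampleForm : MvPolynomial (Fin 2) ℝ := X 1 * (X 0 + X 1)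

theorem triForm_exampleVec : triForm exampleVec = X 0 * exampleForm := by
  simp [triForm, exampleVec, linForm, exampleForm]

theorem isHomogeneous_exampleForm : exampleForm.IsHomogeneous 2 :=
  (isHomogeneous_X ℝ 1).mul ((isHomogeneous_X ℝ 0).add (isHomogeneous_X ℝ 1))

/-- The constant operator `∂x ∂y (∂x + ∂y) + c`. -/
def exampleOp (U : Opens (ℝ × ℝ)) (c : ℝ) : Op U := cst U (triForm exampleVec + C c)

variable {c : ℝ}

theorem exampleOp_mem : exampleOp U c ∈ ordLT (Smooth U) (3 + 1) :=
  cst_mem_ordLT (Submodule.add_mem _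
    (IsHomogeneous.mem_ordLT (isHomogeneous_triForm _) (by norm_num))
    (ordLT_mono (by norm_num) (C_mem_ordLT c)))

theorem symbol_exampleOp (q : U) :
    val q (homogeneousComponent 3 (exampleOp U c)) = triForm exampleVec := by
  have h2 : val q (homogeneousComponent 3 (exampleOp U c)) =
    homogeneousComponent 3 (val q (exampleOp U c)) := map_homogeneousComponent _ _ _
  rw [h2, exampleOp, val_cst, map_add, homogeneousComponent_eq_self (isHomogeneous_triForm _),
    homogeneousComponent_of_mem (isHomogeneous_C (Fin 2) c), if_neg (by norm_num), add_zero]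

theorem symbol_exampleOp_ne_zero (q : U) :
    val q (homogeneousComponent 3 (exampleOp U c)) ≠ 0 := by
  rw [symbol_exampleOp]
  exact pairIndep_exampleVec.triForm_ne_zero

theorem firstOrder_exampleVec : firstOrder (constVec U (exampleVec 0)) 0 = X 0 := by
  rw [firstOrder_constVec]
  simp [exampleVec, linForm, cst_X]

variable {r : ℕ} {e : Fin r → ℕ} {w : Fin r → MvPolynomial (Fin 2) ℝ}

theorem isAdapted_exampleOp :
    IsAdapted (systemIdeal (multiples w (exampleOp U c)))
      (firstOrder (constVec U (exampleVec 0)) 0) := by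
  rw [firstOrder_exampleVec, ← cst_X]
  refine multiples_isAdapted exampleOp_mem symbol_exampleOp_ne_zero (G := cst U exampleForm)
    (cst_mem_ordLT (IsHomogeneous.mem_ordLT isHomogeneous_exampleForm (by norm_num))) ?_
  rw [comp_cst, exampleOp, triForm_exampleVec, ← map_mul, ← map_sub, mul_comm, add_sub_cancel_left]
  exact cst_mem_ordLT (ordLT_mono (by norm_num) (C_mem_ordLT c))

theorem isClassThree_exampleOp (hw : ∀ j, (w j).IsHomogeneous (e j)) {b : ℕ}
    (hb : ∀ k, Module.finrank ℝ (genSpan e w k) = if k < b then 0 else k + 1) :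
    IsClassThree (multiples w (exampleOp U c))
      (fun k => k + 1 - if k < 3 then 0 else if k - 3 < b then 0 else k - 3 + 1)
      (fun i => constVec U (exampleVec i)) where
  regular := isRegular_multiples exampleOp_mem symbol_exampleOp_ne_zero hw hb
  hasClass := by
    refine eventually_atTop.2 ⟨b + 3, fun k hk => ?_⟩
    simp only
    rw [if_neg (by omega), if_neg (by omega)]
    omega
  independent i j hij _ := pairIndep_exampleVec i j hij
  characteristic i k q σ hσ := by
    rw [← coe_systemMod, symbolSpace_multiples exampleOp_mem symbol_exampleOp_ne_zero hw,
      symbol_exampleOp, ← genSpan_map_mulLeft] at hσ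
    obtain ⟨u, -, rfl⟩ := hσ
    rw [LinearMap.mulLeft_apply, map_mul]
    have h1 := eval_triForm exampleVec i
    simp only [constVec, evalAt_algebraMap]
    rw [h1, zero_mul]

theorem finrank_genSpan_one (k : ℕ) :
    Module.finrank ℝ (genSpan (fun _ : Fin 1 => 0) (fun _ => 1) k) = if k < 0 then 0 else k + 1 := by
  rw [genSpan_one, finrank_homogeneousSubmodule, if_neg (by omega)]

theorem finrank_genSpan_X (k : ℕ) :
    Module.finrank ℝ (genSpan (fun _ : Fin 2 => 1) X k) = if k < 1 then 0 else k + 1 := by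
  cases k with
  | zero => rw [genSpan_eq_bot fun _ => Nat.one_pos, finrank_bot, if_pos Nat.one_pos]
  | succ k => rw [genSpan_X, finrank_homogeneousSubmodule, if_neg (by omega)]

theorem isClassThreeOfType_exampleOp :
    IsClassThreeOfType (fun _ : Fin 1 => 3) (fun k => k + 1 - if k < 3 then 0 else
      if k - 3 < 0 then 0 else k - 3 + 1) (multiples (fun _ => 1) (exampleOp U c))
      (fun i => constVec U (exampleVec i)) where
  toIsClassThree := isClassThree_exampleOp (fun _ => isHomogeneous_one _ _) finrank_genSpan_one
  order_le j := totalDegree_le_iff.2 (by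
    have := multiples_mem_ordLT (w := fun _ : Fin 1 => 1) (e := fun _ => 0)
      (exampleOp_mem (U := U) (c := c)) (fun _ => isHomogeneous_one _ _) j
    exact this)
  hasType k q := by
    have h1 := newEquations_of_principal (I := systemIdeal (multiples (fun _ : Fin 1 => 1)
      (exampleOp U c))) (q := q) (b := 3) (σ := triForm exampleVec) (by norm_num)
      pairIndep_exampleVec.triForm_ne_zero (fun k => by
        rw [← coe_systemMod, symbolSpace_multiples (e := fun _ => 0) exampleOp_mem
          symbol_exampleOp_ne_zero (fun _ => isHomogeneous_one _ _), symbol_exampleOp, mul_one]) k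
    rw [h1]
    split_ifs with h
    · simp [h]
    · simp [h]

theorem complexity_eq {b : ℕ} {h : ℕ → ℕ} (hb : ∀ k ≥ b, h k = 3) :
    complexity h 3 = ∑ k ∈ Finset.range b, ((h k : ℤ) - 3) + 3 := by
  have h1 : ∑ᶠ i : ℕ, ((h i : ℤ) - ((3 : ℕ) : ℤ)) =
      ∑ i ∈ Finset.range b, ((h i : ℤ) - ((3 : ℕ) : ℤ)) := by
    refine finsum_eq_sum_of_support_subset _ fun i hi => ?_
    by_contra hc
    simp only [Finset.coe_range, Set.mem_Iio, not_lt] at hc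
    exact hi (by simp [hb i hc])
  rw [complexity, h1]
  norm_num

theorem X_mul_cancel {P Q : Op U} (h : P * X 0 = Q * X 0) : P = Q := by
  refine op_ext fun q => ?_
  have h1 := congrArg (val q) h
  rw [map_mul, map_mul, map_X] at h1
  exact mul_right_cancel₀ (X_ne_zero 0) h1

/-- The operator is `1` modulo `∂x`. If `Q ∂x = R N` with `N = ∂x η(∂) + 1`, then `R = (Q - R η(∂))
∂x`, and `∂x` can be cancelled. Products replace compositions since the right factors have constant
coefficients. -/
theorem exists_of_mul_X_eq {Q R : Op U}
    (h : Q * X 0 = R * exampleOp U 1) : ∃ R', R = R' * X 0 ∧ Q = R' * exampleOp U 1 := by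
  have h1 : exampleOp U 1 = X 0 * cst U exampleForm + 1 := by
    rw [exampleOp, triForm_exampleVec, map_add, map_mul, cst_X, C_1, map_one]
  have h2 : R = (Q - R * cst U exampleForm) * X 0 := by
    rw [h1] at h
    linear_combination -h
  refine ⟨_, h2, X_mul_cancel ?_⟩
  rw [h]
  nth_rw 1 [h2]
  ring

theorem laplace_exampleOp_one :
    laplaceMod (systemMod (multiples (fun _ : Fin 1 => 1) (exampleOp U 1)))
      (firstOrder (constVec U (exampleVec 0)) 0) =
      systemMod (multiples (fun _ : Fin 1 => 1) (exampleOp U 1)) := by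
  ext Q
  rw [mem_laplaceMod, firstOrder_exampleVec, ← cst_X, comp_cst, cst_X, exampleOp,
    mem_systemMod_multiples_one, mem_systemMod_multiples_one]
  constructor
  · rintro ⟨R, hR⟩
    obtain ⟨R', -, h⟩ := exists_of_mul_X_eq hR
    exact ⟨R', h⟩
  · rintro ⟨R, rfl⟩
    exact ⟨R * X 0, by ring⟩

/-- The element `N ∂x` is one of the two generators, so the transform contains `N` itself, and by
divisibility nothing but multiples of `N`. -/
theorem laplace_exampleOp_X :
    laplaceMod (systemMod (multiples (fun i : Fin 2 => X i) (exampleOp U 1)))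
      (firstOrder (constVec U (exampleVec 0)) 0) =
      systemMod (multiples (fun _ : Fin 1 => 1) (exampleOp U 1)) := by
  ext Q
  rw [mem_laplaceMod, firstOrder_exampleVec, ← cst_X, comp_cst, cst_X]
  rw [show exampleOp U 1 = cst U (triForm exampleVec + C 1) from rfl, mem_systemMod_multiples_one]
  constructor
  · intro hQ
    obtain ⟨c, hc⟩ := exists_comp_eq_of_mem_multiples hQ
    rw [comp_cst] at hc
    obtain ⟨R', -, h⟩ := exists_of_mul_X_eq hc
    exact ⟨R', h⟩
  · rintro ⟨R, rfl⟩
    have h1 := (isLeft_systemMod _).comp_mem R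
      (mem_systemMod (multiples (fun i : Fin 2 => X i) (exampleOp U 1)) 0)
    rw [multiples, exampleOp, comp_cst, ← map_mul, comp_cst, map_mul, cst_X] at h1
    rw [mul_assoc, mul_comm _ (X 0)]
    exact h1

/-- For `c = 0` the operator is reducible with right factor `∂x`, and cancelling it leaves an
equation of order two. -/
theorem laplace_exampleOp_zero :
    laplaceMod (systemMod (multiples (fun _ : Fin 1 => 1) (exampleOp U 0)))
      (firstOrder (constVec U (exampleVec 0)) 0) =
      systemMod (multiples (fun _ : Fin 1 => 1) (cst U exampleForm)) := by
  ext Q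
  rw [mem_laplaceMod, firstOrder_exampleVec, ← cst_X, comp_cst, cst_X, exampleOp,
    mem_systemMod_multiples_one, mem_systemMod_multiples_one, C_0, add_zero, triForm_exampleVec,
    map_mul, cst_X]
  constructor
  · rintro ⟨R, hR⟩
    exact ⟨R, X_mul_cancel (by rw [hR]; ring)⟩
  · rintro ⟨R, rfl⟩
    exact ⟨R, by ring⟩

/-- A transformation that preserves the type. -/
theorem exists_type_preserved (U : Opens (ℝ × ℝ)) :
    ∃ (r : ℕ) (d : Fin r → ℕ) (F : Fin r → Op U) (h h' : ℕ → ℕ)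
      (v : Fin 3 → Fin 2 → Smooth U) (i : Fin 3) (a : Smooth U),
      IsClassThreeOfType d h F v ∧ IsAdapted (systemIdeal F) (firstOrder (v i) a) ∧
      IsRegular (laplace (systemIdeal F) (firstOrder (v i) a)) h' ∧ HasClass h' 3 ∧
      HasType (laplace (systemIdeal F) (firstOrder (v i) a)) d := by
  have h1 := isClassThreeOfType_exampleOp (U := U) (c := 1)
  have h2 : laplace (systemIdeal (multiples (fun _ : Fin 1 => 1) (exampleOp U 1)))
      (firstOrder (constVec U (exampleVec 0)) 0) =
      systemIdeal (multiples (fun _ : Fin 1 => 1) (exampleOp U 1)) :=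
    by
    simp only [← coe_systemMod]
    rw [← coe_laplaceMod, laplace_exampleOp_one]
  refine ⟨1, _, _, _, _, _, 0, 0, h1, isAdapted_exampleOp, ?_, h1.hasClass, ?_⟩
  · rw [h2]
    exact h1.regular
  · rw [h2]
    exact h1.hasType

/-- A transformation that lowers the complexity. -/
theorem exists_complexity_lt (U : Opens (ℝ × ℝ)) :
    ∃ (r : ℕ) (F : Fin r → Op U) (h h' : ℕ → ℕ)
      (v : Fin 3 → Fin 2 → Smooth U) (i : Fin 3) (a : Smooth U),
      IsClassThree F h v ∧ IsAdapted (systemIdeal F) (firstOrder (v i) a) ∧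
      IsRegular (laplace (systemIdeal F) (firstOrder (v i) a)) h' ∧ HasClass h' 3 ∧
      complexity h' 3 < complexity h 3 := by
  have h1 := isClassThreeOfType_exampleOp (U := U) (c := 1)
  have h2 : laplace (systemIdeal (multiples (fun i : Fin 2 => X i) (exampleOp U 1)))
      (firstOrder (constVec U (exampleVec 0)) 0) =
      systemIdeal (multiples (fun _ : Fin 1 => 1) (exampleOp U 1)) :=
    by
    simp only [← coe_systemMod]
    rw [← coe_laplaceMod, laplace_exampleOp_X]
  refine ⟨2, _, _, _, _, 0, 0, isClassThree_exampleOp (c := 1) (fun i => isHomogeneous_X ℝ i)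
    finrank_genSpan_X, isAdapted_exampleOp, ?_, h1.hasClass, ?_⟩
  · rw [h2]
    exact h1.regular
  -- The symbol dimensions are `1, 2, 3, 3, …` after and `1, 2, 3, 4, 3, …` before the
  -- transformation, so the complexity drops from `1` to `0`.
  · rw [complexity_eq (b := 4) fun k hk => ?_, complexity_eq (b := 4) fun k hk => ?_]
    · simp [Finset.sum_range_succ]
    · rw [if_neg (by omega), if_neg (by omega)]
      omega
    · rw [if_neg (by omega), if_neg (by omega)]
      omega

/-- A transformation that reduces the class. -/
theorem exists_class_lt (U : Opens (ℝ × ℝ)) :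
    ∃ (r : ℕ) (F : Fin r → Op U) (h h' : ℕ → ℕ)
      (v : Fin 3 → Fin 2 → Smooth U) (i : Fin 3) (a : Smooth U),
      IsClassThree F h v ∧ IsAdapted (systemIdeal F) (firstOrder (v i) a) ∧
      IsRegular (laplace (systemIdeal F) (firstOrder (v i) a)) h' ∧ ∃ w < 3, HasClass h' w := by
  have h2 : laplace (systemIdeal (multiples (fun _ : Fin 1 => 1) (exampleOp U 0)))
      (firstOrder (constVec U (exampleVec 0)) 0) =
      systemIdeal (multiples (fun _ : Fin 1 => 1) (cst U exampleForm)) :=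
    by
    simp only [← coe_systemMod]
    rw [← coe_laplaceMod, laplace_exampleOp_zero]
  have h3 : cst U exampleForm ∈ ordLT (Smooth U) (2 + 1) :=
    cst_mem_ordLT (IsHomogeneous.mem_ordLT isHomogeneous_exampleForm (by norm_num))
  have h4 : ∀ q : U, val q (homogeneousComponent 2 (cst U exampleForm)) ≠ 0 := fun q => by
    have h5 : val q (homogeneousComponent 2 (cst U exampleForm)) =
      homogeneousComponent 2 (val q (cst U exampleForm)) := map_homogeneousComponent _ _ _
    rw [h5, val_cst, homogeneousComponent_eq_self isHomogeneous_exampleForm]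
    intro h0
    refine pairIndep_exampleVec.triForm_ne_zero ?_
    rw [triForm_exampleVec, h0, mul_zero]
  refine ⟨1, _, _, fun k => k + 1 - if k < 2 then 0 else if k - 2 < 0 then 0 else k - 2 + 1, _, 0, 0,
    (isClassThreeOfType_exampleOp (c := 0)).toIsClassThree, isAdapted_exampleOp, ?_, 2, by norm_num,
    ?_⟩
  · rw [h2]
    exact isRegular_multiples h3 h4 (e := fun _ => 0) (fun _ => isHomogeneous_one _ _)
      finrank_genSpan_one
  · refine eventually_atTop.2 ⟨2, fun k hk => ?_⟩
    beta_reduce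
    rw [if_neg (by omega), if_neg (by omega)]
    omega

end Examples

/-! ## Complexity zero -/

section ComplexityZero

variable {U : Opens (ℝ × ℝ)} {r : ℕ} {d : Fin r → ℕ} {h : ℕ → ℕ} {F : Fin r → Op U}
  {v : Fin 3 → Fin 2 → Smooth U}

theorem multiples_one (F : Fin 1 → Op U) : multiples (fun _ => 1) (F 0) = F := by
  funext j
  rw [multiples, map_one, one_comp, Subsingleton.elim j 0]

theorem compVal_zero (q : U) : compVal (0 : Op U) q = 0 := by
  have h1 := compVal_cst (U := U) 0
  refine LinearMap.ext fun u => ?_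
  rw [← map_zero (cst U), h1, mul_zero, LinearMap.zero_apply]

/-- The value involves all derivatives of the coefficients of `N` at `q`, and these vanish together
with `N` on a neighbourhood. -/
theorem compVal_eq_zero_of_eventually {N : Op U} {q : U} (hN : ∀ᶠ z in 𝓝 q, val z N = 0) :
    compVal N q = 0 := by
  obtain ⟨O, hO, hOo, hq⟩ := eventually_nhds_iff.1 hN
  obtain ⟨O', hO', rfl⟩ := isOpen_induced_iff.1 hOo
  let W : Opens (ℝ × ℝ) := ⟨O' ∩ U, hO'.inter U.isOpen⟩
  have hWU : W ≤ U := fun _ hz => hz.2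
  have h1 : N.restrict hWU = 0 := op_ext fun z => by
    rw [val_restrict, map_zero]
    exact hO _ z.2.1
  have h2 := compVal_restrict hWU N (⟨q, hq, q.2⟩ : W)
  rw [h1, compVal_zero] at h2
  exact h2.symm

/-- The dimensions `1, 2, 3` in orders below three contribute `-3`, which cancels the constant `3`.
The remaining terms are nonnegative with sum zero. -/
theorem ThreeChar.h_eq_three {I : Submodule (Smooth U) (Op U)} (hI : ThreeChar I h v)
    (h0 : complexity h 3 = 0) (q : U) (k : ℕ) : h (k + 3) = 3 := by
  obtain ⟨b, hb⟩ := eventually_atTop.1 hI.hasClass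
  have h1 := complexity_eq (b := b + k + 1 + 3) fun k hk => hb k (by omega)
  rw [h0, Finset.sum_range_succ', Finset.sum_range_succ', Finset.sum_range_succ', zero_add,
    hI.h_of_lt (by norm_num) q, hI.h_of_lt (by norm_num) q, hI.h_of_lt (by norm_num) q] at h1
  have h2 : ∑ k ∈ Finset.range (b + k + 1), ((h (k + 3) : ℤ) - 3) = 0 := by
    push_cast at h1
    have h3 : ∀ k, h (k + 1 + 1 + 1) = h (k + 3) := fun _ => rfl
    simp only [h3] at h1
    linarith
  have h4 := (Finset.sum_eq_zero_iff_of_nonneg fun k _ => by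
    have := hI.three_le k q
    omega).1 h2 k (Finset.mem_range.2 (by omega))
  omega

theorem ThreeChar.symbolSpace_eq_genSpan {I : Submodule (Smooth U) (Op U)} (hI : ThreeChar I h v)
    (h3 : ∀ k, h (k + 3) = 3) (k : ℕ) (q : U) :
    symbolSpace (I : Set (Op U)) k q =
      genSpan (fun _ : Fin 1 => 3) (fun _ => triForm (vecAt v q)) k := by
  rcases Nat.lt_or_ge k 3 with hk | hk
  · rw [hI.symbolSpace_eq_bot hk, genSpan_eq_bot fun _ => hk]
  · obtain ⟨m, rfl⟩ : ∃ m, k = m + 3 := ⟨k - 3, by omega⟩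
    rw [hI.symbolSpace_eq (h3 m), genSpan_principal]
    rfl

/-- A system of complexity zero consists of one equation of order three. -/
theorem IsClassThreeOfType.eq_one (hF : IsClassThreeOfType d h F v) (h3 : ∀ k, h (k + 3) = 3)
    (q : U) : r = 1 ∧ ∀ j, d j = 3 := by
  have hI := hF.toIsClassThree.threeChar
  have hnew : ∀ k, (Finset.univ.filter fun j => d j = k).card = if 3 = k then 1 else 0 := fun k => by
    rw [← hF.hasType k q]
    exact newEquations_of_principal (by norm_num) (hI.indep q).triForm_ne_zero
      (fun k => hI.symbolSpace_eq_genSpan h3 k q) k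
  have hd : ∀ j, d j = 3 := fun j => by
    by_contra hc
    have h1 := hnew (d j)
    rw [if_neg (Ne.symm hc), Finset.card_eq_zero] at h1
    exact Finset.notMem_empty j (h1 ▸ Finset.mem_filter.2 ⟨Finset.mem_univ _, rfl⟩)
  have h1 := hnew 3
  rw [if_pos rfl, Finset.filter_true_of_mem fun j _ => hd j, Finset.card_univ, Fintype.card_fin] at h1
  exact ⟨h1, hd⟩

/-- The generator of a principal system of complexity zero has order three everywhere. -/
theorem ThreeChar.symbol_ne_zero {N : Op U} (hI : ThreeChar (systemMod fun _ : Fin 1 => N) h v)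
    (h3 : ∀ k, h (k + 3) = 3) (hN : N ∈ ordLT (Smooth U) (3 + 1)) (q : U) :
    val q (homogeneousComponent 3 N) ≠ 0 := by
  intro hq
  set I := systemMod fun _ : Fin 1 => N with hIdef
  have hsym : ∀ P ∈ trunc I 4, ∀ z, ∃ c : ℝ,
      val z (homogeneousComponent 3 P) = c • triForm (vecAt v z) := fun P hP z => by
    have h1 : val z (homogeneousComponent 3 P) ∈ symbolSpace (I : Set (Op U)) (0 + 3) z :=
      mem_symbolSpace.2 ⟨P, hP, rfl⟩
    rw [hI.symbolSpace_eq (h3 0)] at h1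
    obtain ⟨u, hu, hu'⟩ := h1
    rw [← hu', ← homogeneousComponent_eq_self hu, homogeneousComponent_zero]
    exact ⟨coeff 0 u, by rw [LinearMap.mulLeft_apply, mul_comm, smul_eq_C_mul]⟩
  have hNI : N ∈ trunc I 4 := ⟨mem_systemMod _ 0, hN⟩
  obtain ⟨P, hP, hPq⟩ : ∃ P ∈ trunc I 4,
      val q (homogeneousComponent 3 P) = triForm (vecAt v q) := by
    have h1 : triForm (vecAt v q) ∈ symbolSpace (I : Set (Op U)) (0 + 3) q := by
      rw [hI.symbolSpace_eq (h3 0)]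
      exact ⟨1, isHomogeneous_one _ _, mul_one _⟩
    obtain ⟨P, hP, hPq⟩ := mem_symbolSpace.1 h1
    exact ⟨P, hP, hPq⟩
  obtain ⟨α, hα⟩ := MvPolynomial.ne_zero_iff.1 (hI.indep q).triForm_ne_zero
  set p := coeff α (homogeneousComponent 3 P) with hp
  set f := coeff α (homogeneousComponent 3 N) with hf
  have hpq : evalAt q p ≠ 0 := by
    rw [hp, ← coeff_map, hPq]
    exact hα
  -- The symbols of `N` and `P` are multiples of the same cubic, with factors proportional to `f`
  -- and `p`. So `p N - f P` has order `≤ 2`, and `I` contains no such operator except zero.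
  have heq : p • N = f • P := by
    rw [← sub_eq_zero, ← Submodule.mem_bot (Smooth U), ← hI.trunc_three le_rfl]
    refine ⟨Submodule.sub_mem _ (Submodule.smul_mem _ _ hNI.1) (Submodule.smul_mem _ _ hP.1),
      mem_ordLT_of_homogeneousComponent (Submodule.sub_mem _ (Submodule.smul_mem _ _ hNI.2)
        (Submodule.smul_mem _ _ hP.2)) (op_ext fun z => ?_)⟩
    obtain ⟨c, hc⟩ := hsym N hNI z
    obtain ⟨c', hc'⟩ := hsym P hP z
    have h1 : evalAt z p = c' * coeff α (triForm (vecAt v z)) := by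
      rw [hp, ← coeff_map, hc', coeff_smul, smul_eq_mul]
    have h2 : evalAt z f = c * coeff α (triForm (vecAt v z)) := by
      rw [hf, ← coeff_map, hc, coeff_smul, smul_eq_mul]
    rw [map_sub, map_smul, map_smul, map_sub, val_smul, val_smul, hc, hc', h1, h2, smul_smul,
      smul_smul, map_zero, sub_eq_zero]
    ring_nf
  obtain ⟨Q, hQ⟩ : ∃ Q, P = Op.comp Q N := by
    have h1 := hP.1
    rw [hIdef, ← multiples_one fun _ : Fin 1 => N] at h1
    obtain ⟨c, hc⟩ := exists_comp_eq_of_mem_multiples h1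
    exact ⟨_, hc⟩
  have hfq : evalAt q f = 0 := by rw [hf, ← coeff_map, hq, coeff_zero]
  -- Where the symbol of `N` does not vanish, `Q` has order zero, and `P = Q ∘ N` together with `p N
  -- = f P` gives `f Q₀ = p`.
  have key : ∀ z, evalAt z p ≠ 0 → evalAt z f ≠ 0 →
      evalAt z f * evalAt z (coeff 0 Q) = evalAt z p := fun z _ hz => by
    have hNz : val z (homogeneousComponent 3 N) ≠ 0 := fun h0 => hz (by
      rw [hf, ← coeff_map, h0, coeff_zero])
    have h1 : val z Q ∈ ordLT ℝ 1 := by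
      refine mem_ordLT_of_compVal hN hNz ?_
      rw [← val_comp, ← hQ]
      exact map_mem_ordLT _ hP.2
    have h2 : val z Q = C (evalAt z (coeff 0 Q)) := by
      ext β
      rw [coeff_C]
      split_ifs with hβ
      · rw [← hβ, coeff_map]
      · refine mem_ordLT.1 h1 β (Nat.one_le_iff_ne_zero.2 fun h0 => hβ ?_)
        exact ((Finsupp.degree_eq_zero_iff β).1 h0).symm
    have h3 : val z P = evalAt z (coeff 0 Q) • val z N := by
      have h4 : compVal N z (C (evalAt z (coeff 0 Q))) = evalAt z (coeff 0 Q) • val z N :=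
        compVal_monomial N z 0 _
      rw [hQ, val_comp, h2, h4]
    have h5 := congrArg (val z) heq
    rw [val_smul, val_smul, h3, smul_smul, ← sub_eq_zero, ← sub_smul, smul_eq_zero] at h5
    rcases h5 with h5 | h5
    · linarith
    · refine absurd ?_ hNz
      rw [show val z (homogeneousComponent 3 N) = homogeneousComponent 3 (val z N) from
        map_homogeneousComponent _ _ _, h5, map_zero]
  have hpe : ∀ᶠ z in 𝓝 q, evalAt z p ≠ 0 := (continuous_smooth p).continuousAt.eventually_ne hpq
  -- If `f` vanishes near `q`, then so does `N`, and `P = Q ∘ N` would vanish at `q`. Otherwise `f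
  -- Q₀ = p` holds at points arbitrarily close to `q`, although `f(q) = 0`, `p(q) ≠ 0` and all
  -- functions are continuous.
  by_cases hfe : ∀ᶠ z in 𝓝 q, evalAt z f = 0
  · have hN0 : ∀ᶠ z in 𝓝 q, val z N = 0 := by
      filter_upwards [hfe, hpe] with z h1 h2
      have h3 := congrArg (val z) heq
      rw [val_smul, val_smul, h1, zero_smul] at h3
      exact (smul_eq_zero.1 h3).resolve_left h2
    have h1 : val q P = 0 := by
      rw [hQ, val_comp, compVal_eq_zero_of_eventually hN0, LinearMap.zero_apply]
    refine (hI.indep q).triForm_ne_zero ?_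
    rw [← hPq, show val q (homogeneousComponent 3 P) = homogeneousComponent 3 (val q P) from
      map_homogeneousComponent _ _ _, h1, map_zero]
  · have hfr : ∃ᶠ z in 𝓝 q, evalAt z f ≠ 0 := not_eventually.1 hfe
    have h1 : Tendsto (fun z => evalAt z f * evalAt z (coeff 0 Q) - evalAt z p) (𝓝 q)
        (𝓝 (evalAt q f * evalAt q (coeff 0 Q) - evalAt q p)) :=
      (((continuous_smooth f).mul (continuous_smooth _)).sub (continuous_smooth p)).continuousAt
    have h2 : ∀ᶠ z in 𝓝 q, evalAt z f * evalAt z (coeff 0 Q) - evalAt z p ≠ 0 := by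
      refine h1.eventually_ne ?_
      rw [hfq, zero_mul, zero_sub]
      exact neg_ne_zero.2 hpq
    obtain ⟨z, hz, hz1, hz2⟩ := (hfr.and_eventually (h2.and hpe)).exists
    exact hz1 (sub_eq_zero.2 (key z hz2 hz))

end ComplexityZero

/-! ## Perturbations by operators of order one -/

section Perturbation

variable {U : Opens (ℝ × ℝ)}

theorem leftD_firstOrder (j : Fin 2) (v : Fin 2 → Smooth U) (a : Smooth U) :
    Op.leftD j (firstOrder v a) =
      firstOrder (fun k => partialD j (v k)) (partialD j a) + X j * firstOrder v a := by
  have hX : ∀ k, coefD j (X k : Op U) = 0 := fun k => by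
    have h1 := coefD_X_mul (U := U) j k (C 1)
    have h2 : coefD j (C 1 : Op U) = 0 := by
      refine MvPolynomial.ext _ _ fun α => ?_
      rw [coeff_coefD, coeff_C, coeff_zero]
      split_ifs
      · exact partialD_one j
      · exact partialD_zero j
    rwa [h2, C_1, mul_one, mul_zero] at h1
  have hC : coefD j (C a : Op U) = C (partialD j a) := by
    refine MvPolynomial.ext _ _ fun α => ?_
    rw [coeff_coefD, coeff_C, coeff_C]
    split_ifs
    · rfl
    · exact partialD_zero j
  rw [leftD_eq]
  congr 1
  rw [firstOrder, coefD_add, coefD_add, coefD_C_mul, coefD_C_mul, hX, hX, hC, mul_zero, mul_zero,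
    zero_add, zero_add, firstOrder]

theorem val_firstOrder (v : Fin 2 → Smooth U) (a : Smooth U) (q : U) :
    val q (firstOrder v a) = linForm (evalAt q (v 0)) (evalAt q (v 1)) + C (evalAt q a) := by
  simp only [firstOrder, linForm, map_add, map_mul, map_C, map_X]

theorem exists_eq_of_mem_ordLT_two {u : MvPolynomial (Fin 2) ℝ} (hu : u ∈ ordLT ℝ 2) :
    ∃ κ A B : ℝ, u = C κ + (C A * X 0 + C B * X 1) := by
  rw [ordLT_eq_span] at hu
  refine Submodule.span_induction
    (p := fun u _ => ∃ κ A B : ℝ, u = C κ + (C A * X 0 + C B * X 1)) ?_ ?_ ?_ ?_ hu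
  · rintro _ ⟨α, hα, rfl⟩
    simp only [Set.mem_ofPred_eq] at hα
    induction α using exponent_induction with
    | zero => exact ⟨1, 0, 0, by rw [C_0]; simp⟩
    | step α i _ =>
      rw [map_add, Finsupp.degree_single] at hα
      have h1 : α = 0 := (Finsupp.degree_eq_zero_iff α).1 (by omega)
      rw [h1, zero_add]
      fin_cases i
      · exact ⟨0, 1, 0, by simp [X]⟩
      · exact ⟨0, 0, 1, by simp [X]⟩
  · exact ⟨0, 0, 0, by simp⟩
  · rintro _ _ _ _ ⟨κ, A, B, rfl⟩ ⟨κ', A', B', rfl⟩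
    exact ⟨κ + κ', A + A', B + B', by simp only [map_add]; ring⟩
  · rintro c _ _ ⟨κ, A, B, rfl⟩
    exact ⟨c * κ, c * A, c * B, by simp only [smul_eq_C_mul, map_mul]; ring⟩

/-- The real identities behind the independence of the derivatives of an operator of order one and of
the gauge. -/
theorem eq_zero_of_firstOrder_relation {V₀ V₁ θ₀ θ₁ l₀ l₁ a m₀₀ m₀₁ m₁₀ m₁₁ α₀ α₁ : ℝ}
    (hD : l₀ * V₁ - l₁ * V₀ ≠ 0)
    (hθ : (l₀ * V₁ - l₁ * V₀) * (l₀ * θ₀ + l₁ * θ₁) ≠ (l₀ * V₁ - l₁ * V₀) * (V₀ * α₀ + V₁ * α₁) +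
      ((V₀ * m₀₁ + V₁ * m₁₁) * V₀ - (V₀ * m₀₀ + V₁ * m₁₀) * V₁) * a)
    {c c₀ c₁ κ A B : ℝ}
    (h : ∀ x y : ℝ, c * (V₀ * x + V₁ * y) + c₀ * (θ₀ + x * (V₀ * x + V₁ * y)) +
      c₁ * (θ₁ + y * (V₀ * x + V₁ * y)) = κ * (l₀ * x + l₁ * y + a) +
      A * (m₀₀ * x + m₀₁ * y + α₀ + x * (l₀ * x + l₁ * y + a)) +
      B * (m₁₀ * x + m₁₁ * y + α₁ + y * (l₀ * x + l₁ * y + a))) :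
    c = 0 ∧ c₀ = 0 ∧ c₁ = 0 := by
  -- Six points determine a quadratic polynomial in `x`, `y`; the following combinations are its
  -- coefficients.
  have e0 := h 0 0
  have e1 := h 1 0
  have e2 := h (-1) 0
  have e3 := h 0 1
  have e4 := h 0 (-1)
  have e5 := h 1 1
  have f0 : c₀ * θ₀ + c₁ * θ₁ = κ * a + A * α₀ + B * α₁ := by linear_combination e0
  have f1 : c * V₀ = κ * l₀ + A * (m₀₀ + a) + B * m₁₀ := by linear_combination (e1 - e2) / 2
  have f2 : c * V₁ = κ * l₁ + A * m₀₁ + B * (m₁₁ + a) := by linear_combination (e3 - e4) / 2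
  have f3 : c₀ * V₀ = A * l₀ := by linear_combination (e1 + e2) / 2 - e0
  have f4 : c₁ * V₁ = B * l₁ := by linear_combination (e3 + e4) / 2 - e0
  have f5 : c₀ * V₁ + c₁ * V₀ = A * l₁ + B * l₀ := by
    linear_combination e5 - e1 - e3 + e0
  have g1 : c₁ * l₀ = c₀ * l₁ := by
    refine sub_eq_zero.1 ((mul_eq_zero.1 ?_).resolve_left hD)
    linear_combination l₀ * l₀ * f4 + l₁ * l₁ * f3 - l₀ * l₁ * f5
  have g2 : B * V₀ = A * V₁ := by
    refine sub_eq_zero.1 ((mul_eq_zero.1 ?_).resolve_left hD)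
    linear_combination V₀ * V₀ * f4 + V₁ * V₁ * f3 - V₀ * V₁ * f5
  -- The quadratic part forces `(c₀, c₁)` to be proportional to `(l₀, l₁)` and `(A, B)` to `(V₀,
  -- V₁)`, with the same factor `k / D`. The linear part then determines `κ`, and the constant term
  -- contradicts `hθ` unless `k = 0`.
  set D := l₀ * V₁ - l₁ * V₀ with hDdef
  set k := c₀ * V₁ - c₁ * V₀ with hk
  have k0 : D * c₀ = k * l₀ := by rw [hDdef, hk]; linear_combination V₀ * g1
  have k1 : D * c₁ = k * l₁ := by rw [hDdef, hk]; linear_combination V₁ * g1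
  have kA : D * A = k * V₀ := by
    rw [hDdef, hk]; linear_combination -2 * V₁ * f3 + V₀ * f5 + l₀ * g2
  have kB : D * B = k * V₁ := by
    rw [hDdef, hk]; linear_combination 2 * V₀ * f4 - V₁ * f5 + l₁ * g2
  have hκ : D * D * κ = k * ((V₀ * m₀₁ + V₁ * m₁₁) * V₀ - (V₀ * m₀₀ + V₁ * m₁₀) * V₁) := by
    have h1 : D * κ = A * (m₀₁ * V₀ - m₀₀ * V₁) + B * (m₁₁ * V₀ - m₁₀ * V₁) := by
      rw [hDdef]; linear_combination V₀ * f2 - V₁ * f1 + a * g2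
    linear_combination D * h1 + (m₀₁ * V₀ - m₀₀ * V₁) * kA + (m₁₁ * V₀ - m₁₀ * V₁) * kB
  have hk0 : k = 0 := by
    by_contra hk0
    refine hθ (mul_left_cancel₀ hk0 ?_)
    linear_combination D * D * f0 - D * θ₀ * k0 - D * θ₁ * k1 + D * α₀ * kA + D * α₁ * kB + a * hκ
  rw [hk0, zero_mul] at k0 k1 kA kB hκ
  have r0 := (mul_eq_zero.1 k0).resolve_left hD
  have r1 := (mul_eq_zero.1 k1).resolve_left hD
  have rA := (mul_eq_zero.1 kA).resolve_left hD
  have rB := (mul_eq_zero.1 kB).resolve_left hD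
  have rκ := (mul_eq_zero.1 hκ).resolve_left (mul_ne_zero hD hD)
  refine ⟨?_, r0, r1⟩
  rw [rA, rB, rκ] at f1 f2
  refine (mul_eq_zero.1 (?_ : D * c = 0)).resolve_left hD
  rw [hDdef]
  linear_combination l₀ * f2 - l₁ * f1

theorem compVal_C (L : Op U) (q : U) (κ : ℝ) : compVal L q (C κ) = κ • val q L :=
  compVal_monomial L q 0 κ

theorem compVal_C_mul_X (L : Op U) (q : U) (A : ℝ) (i : Fin 2) :
    compVal L q (C A * X i) = A • val q (Op.leftD i L) := by
  rw [← smul_eq_C_mul, map_smul, compVal_eq, cst_X, X_comp]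

variable {v : Fin 2 → Smooth U} {a θ : Smooth U} {V : Fin 2 → ℝ} {q : U}

/-- The numerical condition on the coefficient of order zero of the perturbation. -/
def forbidden (v : Fin 2 → Smooth U) (a : Smooth U) (V : Fin 2 → ℝ) (q : U) : ℝ :=
  (evalAt q (v 0) * V 1 - evalAt q (v 1) * V 0) *
      (V 0 * evalAt q (partialD 0 a) + V 1 * evalAt q (partialD 1 a)) +
    ((V 0 * evalAt q (partialD 0 (v 1)) + V 1 * evalAt q (partialD 1 (v 1))) * V 0 -
      (V 0 * evalAt q (partialD 0 (v 0)) + V 1 * evalAt q (partialD 1 (v 0))) * V 1) * evalAt q a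

/-- A dependence modulo `D ∘ L` between derivatives of order `≤ 2` has the form `u ∘ L`, and
comparison of degrees forces `u` to have order `≤ 1`. So it is an identity of quadratic polynomials
with the three coefficients of `u` as unknowns. -/
theorem linearIndependent_mkQ_firstOrder (hv : ∀ q, evalAt q (v 0) ≠ 0 ∨ evalAt q (v 1) ≠ 0)
    (hD : evalAt q (v 0) * V 1 - evalAt q (v 1) * V 0 ≠ 0) (hθ0 : evalAt q θ = 0)
    (hθ : (evalAt q (v 0) * V 1 - evalAt q (v 1) * V 0) *
      (evalAt q (v 0) * evalAt q (partialD 0 θ) + evalAt q (v 1) * evalAt q (partialD 1 θ)) ≠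
      forbidden v a V q) :
    LinearIndependent ℝ fun i : Fin 3 =>
      ((ordLT ℝ 4).map (compVal (firstOrder v a) q)).mkQ
        (![val q (firstOrder (constVec U V) θ), val q (Op.leftD 0 (firstOrder (constVec U V) θ)),
          val q (Op.leftD 1 (firstOrder (constVec U V) θ))] i) := by
  have hG : firstOrder (constVec U V) θ ∈ ordLT (Smooth U) 2 := firstOrder_mem_ordLT _ _
  refine Fintype.linearIndependent_iff.2 fun c hc => ?_
  simp only [← map_smul, ← map_sum] at hc
  rw [Submodule.mkQ_apply, Submodule.Quotient.mk_eq_zero] at hc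
  obtain ⟨u, -, hu⟩ := hc
  rw [Fin.sum_univ_three] at hu
  simp only [Matrix.cons_val_zero, Matrix.cons_val_one, Matrix.cons_val_two, Matrix.head_cons,
    Matrix.tail_cons] at hu
  have hu2 : u ∈ ordLT ℝ 2 := by
    refine mem_ordLT_of_compVal (firstOrder_mem_ordLT v a)
      (val_homogeneousComponent_firstOrder_ne_zero hv a q) ?_
    rw [hu]
    refine Submodule.add_mem _ (Submodule.add_mem _ (Submodule.smul_mem _ _ ?_)
      (Submodule.smul_mem _ _ ?_)) (Submodule.smul_mem _ _ ?_)
    · exact map_mem_ordLT _ (ordLT_mono (by norm_num) hG)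
    · exact map_mem_ordLT _ (leftD_mem_ordLT 0 hG)
    · exact map_mem_ordLT _ (leftD_mem_ordLT 1 hG)
  obtain ⟨κ, A, B, rfl⟩ := exists_eq_of_mem_ordLT_two hu2
  rw [map_add, map_add, compVal_C, compVal_C_mul_X, compVal_C_mul_X] at hu
  simp only [leftD_firstOrder, map_add, map_mul, map_X, val_firstOrder, constVec,
    partialD_algebraMap, evalAt_algebraMap, map_zero, hθ0, add_zero] at hu
  have key := eq_zero_of_firstOrder_relation (c := c 0) (c₀ := c 1) (c₁ := c 2) (κ := κ) (A := A)
    (B := B) hD hθ fun x y => by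
      have h1 := congrArg (eval ![x, y]) hu
      simp only [map_add, map_mul, smul_eval, eval_linForm, eval_C, eval_X, Matrix.cons_val_zero,
        Matrix.cons_val_one] at h1
      linear_combination -h1
  intro i
  fin_cases i
  · exact key.1
  · exact key.2.1
  · exact key.2.2

/-- Almost all perturbations have maximal rank. -/
theorem finite_finrank_rowSpan_lt (hv : ∀ q, evalAt q (v 0) ≠ 0 ∨ evalAt q (v 1) ≠ 0)
    (hD : evalAt q (v 0) * V 1 - evalAt q (v 1) * V 0 ≠ 0) (hθ0 : evalAt q θ = 0)
    (hθ : (evalAt q (v 0) * V 1 - evalAt q (v 1) * V 0) *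
      (evalAt q (v 0) * evalAt q (partialD 0 θ) + evalAt q (v 1) * evalAt q (partialD 1 θ)) ≠
      forbidden v a V q) {N : Op U} (hN : N ∈ ordLT (Smooth U) (3 + 1)) :
    {ε : ℝ | Module.finrank ℝ (rowSpan (fun _ : Fin 1 => N + ε • firstOrder (constVec U V) θ)
      (firstOrder v a) (fun _ => 3) 4 q) < tri 4 + 3}.Finite := by
  set L := firstOrder v a with hL
  set G := firstOrder (constVec U V) θ with hG
  set Λ := (ordLT ℝ 4).map (compVal L q) with hΛ
  have hL2 : L ∈ ordLT (Smooth U) (1 + 1) := firstOrder_mem_ordLT _ _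
  have hinj : Function.Injective (compVal L q) :=
    compVal_injective hL2 (val_homogeneousComponent_firstOrder_ne_zero hv a q)
  -- The rows of `N + ε G` are affine in `ε` with independent leading terms, those of `G`; so
  -- nothing has to be known about `N`.
  refine (finite_not_linearIndependent_of_right
    (fun i => Λ.mkQ (![val q N, val q (Op.leftD 0 N), val q (Op.leftD 1 N)] i))
    (linearIndependent_mkQ_firstOrder hv hD hθ0 hθ)).subset fun ε hε hli => ?_
  have hNε : ∀ _ : Fin 1, N + ε • G ∈ ordLT (Smooth U) (3 + 1) := fun _ =>
    Submodule.add_mem _ hN (by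
      rw [← algebraMap_smul (Smooth U) ε G]
      exact Submodule.smul_mem _ _ (ordLT_mono (by norm_num) (firstOrder_mem_ordLT _ _)))
  set E := rowSpan (fun _ : Fin 1 => N + ε • G) L (fun _ => 3) 4 q with hE
  have hfd : FiniteDimensional ℝ E := finiteDimensional_of_le_ordLT (n := 5) (by
    refine Submodule.span_le.2 ?_
    rintro _ ⟨x, hx, rfl⟩
    exact map_mem_ordLT _ (leftDPow_elim_mem_ordLT hNε hL2 hx))
  have h1 := finrank_map_add_le Λ.mkQ (A := Λ) (E := E) (map_compVal_le_rowSpan _ _ _ _ _)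
    fun u hu => (Submodule.Quotient.mk_eq_zero Λ).2 hu
  rw [finrank_map_of_injective hinj, finrank_ordLT] at h1
  have hfd' : FiniteDimensional ℝ (E.map Λ.mkQ) := Module.Finite.map _ _
  have hsm : ∀ P : Op U, val q (ε • P) = ε • val q P := fun P => by
    rw [← algebraMap_smul (Smooth U) ε P, val_smul, evalAt_algebraMap]
  have hlD : ∀ j, Op.leftD j (N + ε • G) = Op.leftD j N + ε • Op.leftD j G := fun j => by
    rw [leftD_add, ← algebraMap_smul (Smooth U) ε G, smul_eq_C_mul, leftD_C_mul, partialD_algebraMap,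
      C_0, zero_mul, ← smul_eq_C_mul, algebraMap_smul]
    simp
  have hmem : ∀ α : Fin 2 →₀ ℕ, α.degree ≤ 1 → val q (Op.leftDPow α (N + ε • G)) ∈ E :=
    fun α hα => Submodule.subset_span ⟨(some 0, α), mem_rowSet.2 (by
      simp only [Option.elim_some]
      omega), rfl⟩
  have h2 := le_finrank_of_linearIndependent (E := E.map Λ.mkQ) hli fun i => by
    refine Fin.cases ?_ (fun j => ?_) i
    · have h3 := hmem 0 (by simp)
      rw [leftDPow_zero, map_add, hsm] at h3
      exact ⟨_, h3, by rw [map_add, map_smul]; rfl⟩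
    · have h3 := hmem (Finsupp.single j 1) (by rw [Finsupp.degree_single])
      rw [leftDPow_single, hlD, map_add, hsm] at h3
      refine ⟨_, h3, ?_⟩
      rw [map_add, map_smul]
      fin_cases j <;> rfl
  exact absurd hε (not_lt.2 ((Nat.add_le_add_left h2 _).trans h1))

/-- The function `μ · (z - z₀)`. -/
def affineFun (U : Opens (ℝ × ℝ)) (μ : Fin 2 → ℝ) (z₀ : ℝ × ℝ) : Smooth U :=
  ofContDiff U (fun z => μ 0 * (z.1 - z₀.1) + μ 1 * (z.2 - z₀.2)) (by fun_prop)

theorem evalAt_affineFun (μ : Fin 2 → ℝ) (q : U) : evalAt q (affineFun U μ q) = 0 := by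
  rw [affineFun, evalAt_ofContDiff]
  simp

theorem evalAt_partialD_affineFun (μ : Fin 2 → ℝ) (z₀ : ℝ × ℝ) (q : U) (i : Fin 2) :
    evalAt q (partialD i (affineFun U μ z₀)) = μ i := by
  rw [affineFun, partialD_ofContDiff]
  have h1 : HasFDerivAt (fun z : ℝ × ℝ => μ 0 * (z.1 - z₀.1) + μ 1 * (z.2 - z₀.2))
      (μ 0 • ContinuousLinearMap.fst ℝ ℝ ℝ + μ 1 • ContinuousLinearMap.snd ℝ ℝ ℝ) (q : ℝ × ℝ) :=
    ((hasFDerivAt_fst.sub_const _).const_mul _).add ((hasFDerivAt_snd.sub_const _).const_mul _)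
  rw [h1.fderiv]
  fin_cases i <;> simp [coordVec]

/-- Perturbations of order one of a system of complexity zero make the ranks as large as possible. -/
theorem IsClassThreeOfType.exists_perturbation {r : ℕ} {d : Fin r → ℕ} {h : ℕ → ℕ} {F : Fin r → Op U}
    {v : Fin 3 → Fin 2 → Smooth U} (hF : IsClassThreeOfType d h F v) (h3 : ∀ k, h (k + 3) = 3)
    (q : U) : ∃ G : Fin r → Op U, (∀ j, (G j).totalDegree ≤ 1) ∧
      ∀ᶠ ε : ℝ in 𝓝[≠] 0, IsClassThreeOfType d h (fun j => F j + ε • G j) v ∧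
        ∀ (i : Fin 3) (a : Smooth U),
          IsAdapted (systemIdeal fun j => F j + ε • G j) (firstOrder (v i) a) →
          tri 4 + 3 ≤ Module.finrank ℝ
            (rowSpan (fun j => F j + ε • G j) (firstOrder (v i) a) d 4 q) := by
  obtain ⟨rfl, hd⟩ := hF.eq_one h3 q
  obtain rfl : d = fun _ => 3 := funext hd
  obtain ⟨N, rfl⟩ : ∃ N, F = fun _ => N := ⟨F 0, funext fun j => by rw [Subsingleton.elim j 0]⟩
  have hI := hF.toIsClassThree.threeChar
  have hl := isLeft_systemMod fun _ : Fin 1 => N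
  have hN : N ∈ ordLT (Smooth U) (3 + 1) := totalDegree_le_iff.1 (hF.order_le 0)
  have hN0 := hI.symbol_ne_zero h3 hN
  have hv : ∀ i q, evalAt q (v i 0) ≠ 0 ∨ evalAt q (v i 1) ≠ 0 := fun i q => (hI.indep q).ne_zero i
  choose a ha _ using fun i => hI.existsUnique_isAdapted hl i
  obtain ⟨ν, hν⟩ := exists_eval_ne_zero (hI.indep q).triForm_ne_zero
  have hνl : ∀ i, evalAt q (v i 0) * ν 0 + evalAt q (v i 1) * ν 1 ≠ 0 := fun i h0 => by
    obtain ⟨f, hf, -⟩ := linForm_dvd_triForm _ (hI.indep q) i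
    refine hν ?_
    rw [hf, map_mul, eval_linForm]
    exact mul_eq_zero_of_left h0 _
  -- Rotating `ν` makes the determinant of `v i` and `V` equal to `l_i(ν)`, nonzero for all three
  -- characteristics.
  set V : Fin 2 → ℝ := ![-ν 1, ν 0] with hV
  have hD : ∀ i, evalAt q (v i 0) * V 1 - evalAt q (v i 1) * V 0 =
      evalAt q (v i 0) * ν 0 + evalAt q (v i 1) * ν 1 := fun i => by
    simp only [hV, Matrix.cons_val_zero, Matrix.cons_val_one]
    ring
  -- With the gradient of `θ` equal to `s ν`, the condition for the `i`-th characteristic reads `s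
  -- l_i(ν) ^ 2 ≠ forbidden`, so only three values of `s` are excluded.
  obtain ⟨s, hs⟩ := (Set.finite_range fun i => forbidden (v i) (a i) V q /
    (evalAt q (v i 0) * ν 0 + evalAt q (v i 1) * ν 1) ^ 2).exists_notMem
  set θ := affineFun U (s • ν) q with hθdef
  have hθ : ∀ i, (evalAt q (v i 0) * V 1 - evalAt q (v i 1) * V 0) *
      (evalAt q (v i 0) * evalAt q (partialD 0 θ) + evalAt q (v i 1) * evalAt q (partialD 1 θ)) ≠
      forbidden (v i) (a i) V q := fun i h0 => by
    refine hs ⟨i, ?_⟩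
    rw [hD, hθdef, evalAt_partialD_affineFun, evalAt_partialD_affineFun, Pi.smul_apply, Pi.smul_apply,
      smul_eq_mul, smul_eq_mul] at h0
    refine (div_eq_iff (pow_ne_zero 2 (hνl i))).2 ?_
    rw [← h0]
    ring
  set G := firstOrder (constVec U V) θ with hG
  have hG2 : G ∈ ordLT (Smooth U) (1 + 1) := firstOrder_mem_ordLT _ _
  refine ⟨fun _ => G, fun _ => totalDegree_le_iff.2 hG2, ?_⟩
  have hfin := Set.finite_iUnion fun i => finite_finrank_rowSpan_lt (hv i)
    (by rw [hD]; exact hνl i) (evalAt_affineFun (s • ν) q) (hθ i) hN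
  filter_upwards [nhdsNE_le_cofinite 0 hfin.compl_mem_cofinite] with ε hε
  have hεG : ε • G ∈ ordLT (Smooth U) (1 + 1) := by
    rw [← algebraMap_smul (Smooth U) ε G]
    exact Submodule.smul_mem _ _ hG2
  have hNε : N + ε • G ∈ ordLT (Smooth U) (3 + 1) :=
    Submodule.add_mem _ hN (ordLT_mono (by norm_num) hεG)
  have hsymb : homogeneousComponent 3 (N + ε • G) = homogeneousComponent 3 N :=
    homogeneousComponent_eq_of_sub_mem (by
      rw [add_sub_cancel_left]
      exact ordLT_mono (by norm_num) hεG)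
  have hNε0 : ∀ z, val z (homogeneousComponent 3 (N + ε • G)) ≠ 0 := fun z => by
    rw [hsymb]
    exact hN0 z
  have hw : ∀ _ : Fin 1, (1 : MvPolynomial (Fin 2) ℝ).IsHomogeneous 0 := fun _ =>
    isHomogeneous_one _ _
  have hS : ∀ (P : Op U), P ∈ ordLT (Smooth U) (3 + 1) →
      (∀ z, val z (homogeneousComponent 3 P) ≠ 0) → ∀ k z,
      symbolSpace (systemIdeal fun _ : Fin 1 => P) k z =
        genSpan (fun _ => 0 + 3) (fun _ => val z (homogeneousComponent 3 P) * 1) k :=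
    fun P hP hP0 k z => by
      rw [← coe_systemMod, ← multiples_one fun _ => P]
      exact symbolSpace_multiples hP hP0 hw k z
  have hFε : IsClassThreeOfType (fun _ : Fin 1 => 3) h (fun _ => N + ε • G) v := by
    refine hF.of_symbolSpace_eq (fun _ => hNε) fun z => ⟨z, fun _ _ => rfl, fun k => ?_⟩
    rw [hS _ hNε hNε0, hS _ hN hN0, hsymb]
  refine ⟨hFε, fun i a' ha' => ?_⟩
  -- Adaptedness only concerns the generator modulo operators of order `≤ 1`, and `ε G` is one of
  -- these. Hence the gauge does not depend on `ε`, and one finite set of bad `ε` is enough.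
  have had : IsAdapted (systemIdeal fun _ : Fin 1 => N + ε • G) (firstOrder (v i) (a i)) := by
    obtain ⟨G₀, hG₀, hR⟩ := PlanePDE.isAdapted_iff.1 (ha i) 1 N ⟨mem_systemMod _ 0, hN⟩
    rw [← coe_systemMod, ← multiples_one fun _ => N + ε • G]
    refine multiples_isAdapted hNε hNε0 hG₀ ?_
    rw [add_sub_right_comm]
    exact Submodule.add_mem _ hR hεG
  obtain rfl := (hFε.toIsClassThree.threeChar.existsUnique_isAdapted
    (isLeft_systemMod fun _ : Fin 1 => N + ε • G) i).unique ha' had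
  by_contra hc
  exact hε (Set.mem_iUnion.2 ⟨i, not_le.1 hc⟩)

end Perturbation

/-! ## The discriminant -/

section Discriminant

variable {U : Opens (ℝ × ℝ)} {r : ℕ} {d : Fin r → ℕ} {h : ℕ → ℕ} {F : Fin r → Op U}
  {v : Fin 3 → Fin 2 → Smooth U}

theorem ThreeChar.evalAt_ne_zero {I : Submodule (Smooth U) (Op U)} (hI : ThreeChar I h v) (i : Fin 3)
    (q : U) : evalAt q (v i 0) ≠ 0 ∨ evalAt q (v i 1) ≠ 0 := (hI.indep q).ne_zero i

/-- The number of equations of the lowest order. -/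
theorem IsClassThreeOfType.card_add (hF : IsClassThreeOfType d h F v) (q : U) {c : ℕ}
    (hc : h c = c + 1) :
    (Finset.univ.filter fun j => d j = c + 1).card + h (c + 1) = c + 1 + 1 := by
  have hI := hF.toIsClassThree.threeChar.regular
  have h1 := hI.finrank_symbolSpace c q
  have h2 := hI.finrank_symbolSpace (c + 1) q
  have hfd : FiniteDimensional ℝ (symbolSpace (systemMod F : Set (Op U)) c q) :=
    finiteDimensional_of_le_ordLT ((symbolSpace_le _ c q).trans (homogeneousSubmodule_le_ordLT c))
  have h3 : symbolSpace (systemMod F : Set (Op U)) c q = ⊥ :=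
    Submodule.finrank_eq_zero.1 (by omega)
  have h4 : prolongedSymbols (systemMod F : Set (Op U)) (c + 1) q = ⊥ := by
    simp only [prolongedSymbols, h3, Submodule.map_bot, iSup_bot]
  rw [← hF.hasType (c + 1) q, ← coe_systemMod, newEquations, h4,
    (Submodule.quotEquivOfEqBot _ (by rw [Submodule.comap_bot, Submodule.ker_subtype])).finrank_eq,
    add_comm]
  exact h2

/-- The differential polynomial that detects the singular systems. -/
def discriminant (d : Fin r → ℕ) (h : ℕ → ℕ) (s b : ℕ) : DiffPoly r :=
  rankPoly d (s + 4) (tri (s + 4) + (s + 3)) *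
    rankPoly d (b + 4) (tri (b + 4) + (b + 5 - h (b + 4)) + 1)

theorem evalAt_discriminant_ne_zero (hF : ∀ j, F j ∈ ordLT (Smooth U) (d j + 1)) {L : Op U}
    (hL : L ∈ ordLT (Smooth U) 2) {s b : ℕ} {q : U} :
    evalAt q ((discriminant d h s b).value F L) ≠ 0 ↔
      tri (s + 4) + (s + 3) ≤ Module.finrank ℝ (rowSpan F L d (s + 4) q) ∧
      tri (b + 4) + (b + 5 - h (b + 4)) + 1 ≤ Module.finrank ℝ (rowSpan F L d (b + 4) q) := by
  rw [← evalAt_rankPoly_ne_zero hF hL, ← evalAt_rankPoly_ne_zero hF hL, ← mul_ne_zero_iff, ← map_mul]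
  simp only [discriminant, DiffPoly.value, map_mul]

/-- Here `b + 3` is taken as the order of the first equations, all symbols of lower order being
zero, so the type is tested in order `b + 4`; the factor in order `s + 4` makes the rank maximal
there and hence from there on. -/
theorem IsClassThreeOfType.generic (hF : IsClassThreeOfType d h F v) {s b : ℕ}
    (hb : ∀ k < b + 3, h k = k + 1) (i : Fin 3) {a : Smooth U}
    (hA : IsAdapted (systemIdeal F) (firstOrder (v i) a)) {q : U}
    (hq : evalAt q ((discriminant d h s b).value F (firstOrder (v i) a)) ≠ 0) :
    (∀ h' : ℕ → ℕ, IsRegular (laplace (systemIdeal F) (firstOrder (v i) a)) h' →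
      HasClass h' 3 ∧ complexity h' 3 = complexity h 3 + 1 ∧
      ¬ HasType (laplace (systemIdeal F) (firstOrder (v i) a)) d) ∧
    (∀ V : Opens (ℝ × ℝ), (q : ℝ × ℝ) ∈ V →
      ∃ (W : Opens (ℝ × ℝ)) (hWU : W ≤ U) (h' : ℕ → ℕ),
        W ≤ V ∧ (W : Set (ℝ × ℝ)).Nonempty ∧
        IsRegular (laplace (systemIdeal fun j => (F j).restrict hWU)
          ((firstOrder (v i) a).restrict hWU)) h' ∧
        HasClass h' 3 ∧ complexity h' 3 = complexity h 3 + 1 ∧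
        ¬ HasType (laplace (systemIdeal fun j => (F j).restrict hWU)
          ((firstOrder (v i) a).restrict hWU)) d) := by
  have hI := hF.toIsClassThree.threeChar
  have hL := isNondegenerate_firstOrder (hI.evalAt_ne_zero i) a
  have hFo : ∀ j, F j ∈ ordLT (Smooth U) (d j + 1) := fun j => totalDegree_le_iff.1 (hF.order_le j)
  have hval : evalAt q ((discriminant d h s b).value F (firstOrder (v i) a)) =
      evalAt q ((rankPoly d (s + 4) (tri (s + 4) + (s + 3))).value F (firstOrder (v i) a)) *
      evalAt q ((rankPoly d (b + 4) (tri (b + 4) + (b + 5 - h (b + 4)) + 1)).value F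
        (firstOrder (v i) a)) := by
    simp only [discriminant, DiffPoly.value, map_mul]
  rw [hval] at hq
  exact hL.generic hI.regular hI.hasClass hA (c := b + 3) (m := s + 2) hb
    (hF.card_add q (c := b + 2) (hb _ (by omega)))
    (le_lapRank_of_rankPoly hFo hL (left_ne_zero_of_mul hq))
    (le_lapRank_of_rankPoly hFo hL (right_ne_zero_of_mul hq))

end Discriminant

end

end PlanePDE

theorem mainTheorem9 :
    -- the three transformations are well defined: each characteristic has exactly one basic gauge
    (∀ (U : Opens (ℝ × ℝ)) (r : ℕ) (F : Fin r → Op U) (h : ℕ → ℕ) (v : Fin 3 → Fin 2 → Smooth U),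
      (U : Set (ℝ × ℝ)).Nonempty → IsClassThree F h v →
      ∀ i : Fin 3, ∃! a : Smooth U, IsAdapted (systemIdeal F) (firstOrder (v i) a)) ∧
    -- always: the class drops, or it is preserved and the complexity rises by at most one
    (∀ (U : Opens (ℝ × ℝ)) (r : ℕ) (F : Fin r → Op U) (h : ℕ → ℕ) (v : Fin 3 → Fin 2 → Smooth U),
      (U : Set (ℝ × ℝ)).Nonempty → IsClassThree F h v →
      ∀ (i : Fin 3) (a : Smooth U), IsAdapted (systemIdeal F) (firstOrder (v i) a) →
      ∀ h' : ℕ → ℕ, IsRegular (laplace (systemIdeal F) (firstOrder (v i) a)) h' →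
        (∃ w < 3, HasClass h' w) ∨
        (HasClass h' 3 ∧ complexity h' 3 ≤ complexity h 3 + 1)) ∧
    -- generically, for each type and all symbol dimensions that occur for it
    (∀ (r : ℕ) (d : Fin r → ℕ) (h : ℕ → ℕ),
      (∃ (U : Opens (ℝ × ℝ)) (F : Fin r → Op U) (v : Fin 3 → Fin 2 → Smooth U),
        (U : Set (ℝ × ℝ)).Nonempty ∧ IsClassThreeOfType d h F v) →
      ∃ Δ : DiffPoly r,
        -- off the singular locus `Δ = 0` the complexity rises by one and the type changes
        (∀ (U : Opens (ℝ × ℝ)) (F : Fin r → Op U) (v : Fin 3 → Fin 2 → Smooth U),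
          IsClassThreeOfType d h F v →
          ∀ (i : Fin 3) (a : Smooth U), IsAdapted (systemIdeal F) (firstOrder (v i) a) →
          ∀ q : U, evalAt q (Δ.value F (firstOrder (v i) a)) ≠ 0 →
            (∀ h' : ℕ → ℕ, IsRegular (laplace (systemIdeal F) (firstOrder (v i) a)) h' →
              HasClass h' 3 ∧ complexity h' 3 = complexity h 3 + 1 ∧
              ¬ HasType (laplace (systemIdeal F) (firstOrder (v i) a)) d) ∧
            (∀ V : Opens (ℝ × ℝ), (q : ℝ × ℝ) ∈ V →
              ∃ (W : Opens (ℝ × ℝ)) (hWU : W ≤ U) (h' : ℕ → ℕ),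
                W ≤ V ∧ (W : Set (ℝ × ℝ)).Nonempty ∧
                IsRegular (laplace (systemIdeal fun j => (F j).restrict hWU)
                  ((firstOrder (v i) a).restrict hWU)) h' ∧
                HasClass h' 3 ∧ complexity h' 3 = complexity h 3 + 1 ∧
                ¬ HasType (laplace (systemIdeal fun j => (F j).restrict hWU)
                  ((firstOrder (v i) a).restrict hWU)) d)) ∧
        -- the singular locus is proper, for the three transformations at once
        (∀ U : Opens (ℝ × ℝ), (U : Set (ℝ × ℝ)).Nonempty →
          ∃ (F : Fin r → Op U) (v : Fin 3 → Fin 2 → Smooth U),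
            IsClassThreeOfType d h F v ∧
            ∀ (i : Fin 3) (a : Smooth U), IsAdapted (systemIdeal F) (firstOrder (v i) a) →
              ∃ q : U, evalAt q (Δ.value F (firstOrder (v i) a)) ≠ 0) ∧
        -- in complexity zero, arbitrarily small perturbations of lower order leave it at any point
        (complexity h 3 = 0 →
          ∀ (U : Opens (ℝ × ℝ)) (F : Fin r → Op U) (v : Fin 3 → Fin 2 → Smooth U),
            IsClassThreeOfType d h F v → ∀ q : U,
            ∃ G : Fin r → Op U, (∀ j, (G j).totalDegree ≤ 1) ∧
              ∀ᶠ ε : ℝ in 𝓝[≠] 0,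
                IsClassThreeOfType d h (fun j => F j + ε • G j) v ∧
                ∀ (i : Fin 3) (a : Smooth U),
                  IsAdapted (systemIdeal fun j => F j + ε • G j) (firstOrder (v i) a) →
                  evalAt q (Δ.value (fun j => F j + ε • G j) (firstOrder (v i) a)) ≠ 0)) ∧
    -- the singular cases do occur: the type is preserved, the complexity drops, the class drops
    (∀ U : Opens (ℝ × ℝ), (U : Set (ℝ × ℝ)).Nonempty →
      (∃ (r : ℕ) (d : Fin r → ℕ) (F : Fin r → Op U) (h h' : ℕ → ℕ)
          (v : Fin 3 → Fin 2 → Smooth U) (i : Fin 3) (a : Smooth U),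
        IsClassThreeOfType d h F v ∧ IsAdapted (systemIdeal F) (firstOrder (v i) a) ∧
        IsRegular (laplace (systemIdeal F) (firstOrder (v i) a)) h' ∧ HasClass h' 3 ∧
        HasType (laplace (systemIdeal F) (firstOrder (v i) a)) d) ∧
      (∃ (r : ℕ) (F : Fin r → Op U) (h h' : ℕ → ℕ)
          (v : Fin 3 → Fin 2 → Smooth U) (i : Fin 3) (a : Smooth U),
        IsClassThree F h v ∧ IsAdapted (systemIdeal F) (firstOrder (v i) a) ∧
        IsRegular (laplace (systemIdeal F) (firstOrder (v i) a)) h' ∧ HasClass h' 3 ∧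
        complexity h' 3 < complexity h 3) ∧
      (∃ (r : ℕ) (F : Fin r → Op U) (h h' : ℕ → ℕ)
          (v : Fin 3 → Fin 2 → Smooth U) (i : Fin 3) (a : Smooth U),
        IsClassThree F h v ∧ IsAdapted (systemIdeal F) (firstOrder (v i) a) ∧
        IsRegular (laplace (systemIdeal F) (firstOrder (v i) a)) h' ∧
        ∃ w < 3, HasClass h' w)) := by
  refine ⟨fun U r F h v _ hF i => hF.threeChar.existsUnique_isAdapted (isLeft_systemMod F) i,
    fun U r F h v hU hF i a hA h' hJ => ?_, fun r d h ⟨U₀, F₀, v₀, ⟨z₀, hz₀⟩, h₀⟩ => ?_, fun U _ =>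
    ⟨exists_type_preserved U, exists_complexity_lt U, exists_class_lt U⟩⟩
  · have : Nonempty U := hU.to_subtype
    have hI := hF.threeChar
    exact (isNondegenerate_firstOrder (hI.evalAt_ne_zero i) a).laplace_class hI.regular
      (isLeft_systemMod F) hI.hasClass (by rw [coe_laplaceMod]; exact hJ) hA
  · classical
    have hI := h₀.toIsClassThree.threeChar
    let q₀ : U₀ := ⟨z₀, hz₀⟩
    have hs : ∃ s, ∀ k ≥ s, h (k + 3) = 3 := by
      obtain ⟨s, hs⟩ := eventually_atTop.1 hI.hasClass
      exact ⟨s, fun k hk => hs _ (by omega)⟩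
    -- The least such `b` makes `b + 3` the order of the first equations.
    have hb : ∃ b, h (b + 3) < b + 4 := by
      obtain ⟨s, hs⟩ := hs
      exact ⟨s, by rw [hs s le_rfl]; omega⟩
    have hlow : ∀ k < Nat.find hb + 3, h k = k + 1 := fun k hk => by
      rcases Nat.lt_or_ge k 3 with h3 | h3
      · exact hI.h_of_lt h3 q₀
      · obtain ⟨m, rfl⟩ : ∃ m, k = m + 3 := ⟨k - 3, by omega⟩
        have h1 := Nat.find_min hb (m := m) (by omega)
        have h2 := hI.regular.finrank_symbolSpace (m + 3) q₀
        omega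
    refine ⟨discriminant d h (Nat.find hs) (Nat.find hb), fun U F v hF i a hA q hq =>
      hF.generic hlow i hA hq, fun U ⟨z, hz⟩ => ?_, fun h0 U F v hF q => ?_⟩
    · obtain ⟨F, v, hF, hgen⟩ := h₀.exists_generic q₀ (Nat.find_spec hs) (Nat.find_spec hb)
        (⟨z, hz⟩ : U)
      refine ⟨F, v, hF, fun i a hA => ⟨⟨z, hz⟩, ?_⟩⟩
      obtain ⟨a', hA', hrank⟩ := hgen i
      -- The ranks of the model are known for its own gauge `l_i(∂)`; uniqueness identifies it with
      -- the given one.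
      obtain rfl := (hF.toIsClassThree.threeChar.existsUnique_isAdapted (isLeft_systemMod F) i).unique
        hA hA'
      exact (evalAt_discriminant_ne_zero (fun j => totalDegree_le_iff.1 (hF.order_le j))
        (firstOrder_mem_ordLT _ _)).2 hrank
    · have h3 := hI.h_eq_three h0 q₀
      have hs0 : Nat.find hs = 0 := (Nat.find_eq_zero hs).2 fun k _ => h3 k
      have hb0 : Nat.find hb = 0 := (Nat.find_eq_zero hb).2 (by rw [h3]; norm_num)
      obtain ⟨G, hG, hev⟩ := hF.exists_perturbation h3 q
      refine ⟨G, hG, hev.mono fun ε hε => ⟨hε.1, fun i a hA => ?_⟩⟩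
      rw [hs0, hb0]
      have hrank := hε.2 i a hA
      refine (evalAt_discriminant_ne_zero (fun j => totalDegree_le_iff.1 (hε.1.order_le j))
        (firstOrder_mem_ordLT _ _)).2 ⟨hrank, ?_⟩
      -- In complexity zero both indices are `0`, and since `5 - h 4 + 1 = 3` the two factors of the
      -- discriminant express the same rank condition.
      have h4 : h (0 + 4) = 3 := h3 1
      rw [h4]
      exact hrank
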